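/- An instance of adaptive seeding consists of a finite set $X$ of first-stage nodes, a finite set $Y$ of second-stage nodes, a set of neighbours $\mathcal N(x)\subseteq Y$ for each $x\in X$ (write $\mathcal N(S)=\bigcup_{x\in S}\mathcal N(x)$), probabilities $p_y\in[0,1]$ for $y\in Y$, a budget $k\in\mathbb N$, and a normalized ($f(\emptyset)=0$), monotone, submodular function $f:2^{Y}\to\mathbb R$. The realization $R\subseteq Y$ is random: each $y\in Y$ belongs to $R$ independently with probability $p_y$. An adaptive policy consists of a set $S\subseteq X$ and, for every $R\subseteq Y$, a set $T_R\subseteq R\cap\mathcal N(S)$ with $|S|+|T_R|\le k$; its value is $\mathbb E_R[f(T_R)]=\sum_{R\subseteq Y}\prod_{y\in R}p_y\prod_{y\in Y\setminus R}(1-p_y)\,f(T_R)$. Algorithms are randomized real-RAM programs: they perform unit-cost field operations and comparisons on real numbers, unit-cost additions, truncated subtractions and comparisons on natural numbers, draw independent random bits with a given computed bias, and query $f$ at a set at unit cost; the $p_y$, the neighbourhoods, $k$ and a parameter $r$ are given as input. An algorithm returns an adaptive policy as follows: a first program computes $S$ together with data left in memory, and a second program, started on that memory after $R\cap\mathcal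 N(S)$ has been revealed, computes $T_R$ with no dependence on further random bits. Theorem. For every constant $\varepsilon>0$ there are an algorithm and constants $C,d\in\mathbb N$ such that for every instance and every integer $r\ge1$, each of the two programs (the second one for every $R$) always halts within $C\,(|X|+|Y|+r+1)^d$ steps; the algorithm always returns an adaptive policy; and, with probability at least $1-1/r$ over the random bits of the first program, the value of the returned policy is at least $\bigl((1-1/e)^2-\varepsilon\bigr)$ times the value of every adaptive policy, that is, it is a $\bigl((1-1/e)^2-\varepsilon\bigr)$-approximation to the optimal adaptive policy. -/

import Mathlib

open scoped ENNReal

/-! ### The adaptive seeding problem -/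

/-- An instance of adaptive seeding: first-stage nodes `X = Fin numX`, second-stage nodes
`Y = Fin numY`, the neighbourhoods of the first-stage nodes, the probabilities with which the
second-stage nodes materialize (independently), a budget, and a normalized monotone submodular
objective on sets of second-stage nodes. -/
structure SeedingInstance where
  numX : ℕ
  numY : ℕ
  nbr : Fin numX → Finset (Fin numY)
  prob : Fin numY → ℝ
  prob_nonneg : ∀ y, 0 ≤ prob y
  prob_le_one : ∀ y, prob y ≤ 1
  budget : ℕ
  f : Finset (Fin numY) → ℝ
  f_empty : f ∅ = 0
  f_mono : ∀ A B, A ⊆ B → f A ≤ f B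
  f_submodular : ∀ A B, f (A ∪ B) ≤ f A + f B - f (A ∩ B)

namespace SeedingInstance

/-- The set of neighbours of a set of first-stage nodes. -/
def nbrs (I : SeedingInstance) (S : Finset (Fin I.numX)) : Finset (Fin I.numY) :=
  S.biUnion I.nbr

/-- The probability that exactly the nodes of `R` materialize. -/
def realizationProb (I : SeedingInstance) (R : Finset (Fin I.numY)) : ℝ :=
  (∏ y ∈ R, I.prob y) * ∏ y ∈ Rᶜ, (1 - I.prob y)

end SeedingInstance

/-- An adaptive policy: a set `S` of first-stage nodes, and for each realization `R` a set `T R` of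
realized neighbours of `S`, of total size at most the budget. -/
structure AdaptivePolicy (I : SeedingInstance) where
  S : Finset (Fin I.numX)
  T : Finset (Fin I.numY) → Finset (Fin I.numY)
  T_subset : ∀ R, T R ⊆ R ∩ I.nbrs S
  card_le : ∀ R, S.card + (T R).card ≤ I.budget

/-- The value of an adaptive policy: the expectation of `f (T R)` over the realization `R`. -/
def AdaptivePolicy.value {I : SeedingInstance} (π : AdaptivePolicy I) : ℝ :=
  ∑ R : Finset (Fin I.numY), I.realizationProb R * I.f (π.T R)

/-! ### Randomized real random access machines with a value oracle

Programs are finite texts in a small imperative language. The memory consists of two-dimensional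
arrays of natural numbers and of real numbers; array names and numerical literals are part of the
program text. On natural numbers there are only addition and truncated subtraction, so that numbers
of more than polynomially many bits cannot arise in polynomially many steps; on real numbers there
are the field operations, without rounding. Each assignment, each random bit, and each evaluation
of a test takes one step; the size of an expression is bounded by that of the program text, so this
agrees with counting individual operations and oracle queries up to a constant factor. -/

/-- The memory: `σ.nat A i j` and `σ.real A i j` are the entries `A[i, j]` of the arrays named `A`
of natural numbers and of real numbers. -/
@[ext] structure Mem where
  nat : ℕ → ℕ → ℕ → ℕ
  real : ℕ → ℕ → ℕ → ℝ

namespace Mem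

/-- `A[i, j] := v` for an array of natural numbers. -/
def setNat (σ : Mem) (A i j v : ℕ) : Mem :=
  { σ with nat := fun A₁ i₁ j₁ => if A₁ = A ∧ i₁ = i ∧ j₁ = j then v else σ.nat A₁ i₁ j₁ }

/-- `A[i, j] := v` for an array of real numbers. -/
noncomputable def setReal (σ : Mem) (A i j : ℕ) (v : ℝ) : Mem :=
  { σ with real := fun A₁ i₁ j₁ => if A₁ = A ∧ i₁ = i ∧ j₁ = j then v else σ.real A₁ i₁ j₁ }

/-- The subset of `Fin n` whose characteristic vector (nonzero meaning membership) is the row `i` of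
the array `A`. -/
def row (σ : Mem) (n A i : ℕ) : Finset (Fin n) :=
  Finset.univ.filter fun j => σ.nat A i j ≠ 0

end Mem

/-- Expressions for natural numbers. -/
inductive NatExpr where
  | lit (n : ℕ)
  | read (A : ℕ) (i j : NatExpr)
  | plus (a b : NatExpr)
  | minus (a b : NatExpr)

/-- Expressions for real numbers; `oracle A i` is a query to the value oracle, at the set of
second-stage nodes stored in row `i` of the array `A` of natural numbers. -/
inductive RealExpr where
  | ofNat (e : NatExpr)
  | read (A : ℕ) (i j : NatExpr)
  | plus (a b : RealExpr)
  | minus (a b : RealExpr)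
  | times (a b : RealExpr)
  | divide (a b : RealExpr)
  | oracle (A : ℕ) (i : NatExpr)

/-- Tests. -/
inductive TestExpr where
  | natLe (a b : NatExpr)
  | realLe (a b : RealExpr)
  | not (b : TestExpr)
  | and (a b : TestExpr)

/-- Commands: the two kinds of assignment, `A[i, j] := ` a random bit that is `1` with probability
`q` (clamped to `[0, 1]`) and `0` otherwise, composition, branching, and while-loops. The bits drawn by `flip` are independent. -/
inductive Cmd where
  | setNat (A : ℕ) (i j e : NatExpr)
  | setReal (A : ℕ) (i j : NatExpr) (e : RealExpr)
  | flip (A : ℕ) (i j : NatExpr) (q : RealExpr)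
  | seq (c d : Cmd)
  | branch (b : TestExpr) (c d : Cmd)
  | loop (b : TestExpr) (c : Cmd)

namespace NatExpr

def eval (σ : Mem) : NatExpr → ℕ
  | lit n => n
  | read A i j => σ.nat A (eval σ i) (eval σ j)
  | plus a b => eval σ a + eval σ b
  | minus a b => eval σ a - eval σ b

end NatExpr

namespace RealExpr

/-- Division by zero returns zero. -/
noncomputable def eval {n : ℕ} (f : Finset (Fin n) → ℝ) (σ : Mem) : RealExpr → ℝ
  | ofNat e => (e.eval σ : ℝ)
  | read A i j => σ.real A (i.eval σ) (j.eval σ)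
  | plus a b => eval f σ a + eval f σ b
  | minus a b => eval f σ a - eval f σ b
  | times a b => eval f σ a * eval f σ b
  | divide a b => eval f σ a / eval f σ b
  | oracle A i => f (σ.row n A (i.eval σ))

end RealExpr

namespace TestExpr

def Holds {n : ℕ} (f : Finset (Fin n) → ℝ) (σ : Mem) : TestExpr → Prop
  | natLe a b => a.eval σ ≤ b.eval σ
  | realLe a b => a.eval f σ ≤ b.eval f σ
  | not b => ¬ Holds f σ b
  | and a b => Holds f σ a ∧ Holds f σ b

end TestExpr

/-- A random bit that is `true` with probability `q`, clamped to `[0, 1]`. -/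
noncomputable def coin (q : ℝ) : PMF Bool :=
  PMF.ofFintype (fun b => if b = true then min 1 (ENNReal.ofReal q) else 1 - min 1 (ENNReal.ofReal q))
    (by simp)

/-- A configuration of the machine: the commands that remain to be executed, and the memory. The
machine has halted when no command remains. -/
abbrev Config := List Cmd × Mem

open Classical in
/-- One step of the machine, with value oracle `f`. -/
noncomputable def step {n : ℕ} (f : Finset (Fin n) → ℝ) : Config → PMF Config
  | ([], σ) => PMF.pure ([], σ)
  | (.setNat A i j e :: K, σ) =>
      PMF.pure (K, σ.setNat A (i.eval σ) (j.eval σ) (e.eval σ))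
  | (.setReal A i j e :: K, σ) =>
      PMF.pure (K, σ.setReal A (i.eval σ) (j.eval σ) (e.eval f σ))
  | (.flip A i j q :: K, σ) =>
      (coin (q.eval f σ)).map fun b =>
        (K, σ.setNat A (i.eval σ) (j.eval σ) (if b = true then 1 else 0))
  | (.seq c d :: K, σ) => PMF.pure (c :: d :: K, σ)
  | (.branch b c d :: K, σ) => PMF.pure ((if b.Holds f σ then c else d) :: K, σ)
  | (.loop b c :: K, σ) =>
      PMF.pure (if b.Holds f σ then c :: .loop b c :: K else K, σ)

/-- The distribution of the configuration after `t` steps. -/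
noncomputable def runFor {n : ℕ} (f : Finset (Fin n) → ℝ) : ℕ → Config → PMF Config
  | 0, c => PMF.pure c
  | t + 1, c => (step f c).bind (runFor f t)

/-! ### Algorithms for adaptive seeding -/

/-- An algorithm for adaptive seeding: `plan` computes, from the instance, a set of first-stage
nodes together with data stored in memory; `respond` is then executed on that memory, once the
realized neighbours of the chosen set have been written to it, and computes the set of second-stage
nodes. -/
structure SeedingAlgorithm where
  plan : Cmd
  respond : Cmd

/-- The memory at the start. Natural-number array `0`, row `0`: the number of first-stage nodes, the
number of second-stage nodes, the budget, and the confidence parameter `r`. Natural-number array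
`1`: the adjacency matrix. Real array `0`, row `0`: the probabilities. All other entries are `0`. -/
noncomputable def SeedingInstance.input (I : SeedingInstance) (r : ℕ) : Mem where
  nat := fun A i j =>
    match A with
    | 0 => if i = 0 then [I.numX, I.numY, I.budget, r].getD j 0 else 0
    | 1 => if h : i < I.numX ∧ j < I.numY then
        (if (⟨j, h.2⟩ : Fin I.numY) ∈ I.nbr ⟨i, h.1⟩ then 1 else 0) else 0
    | _ => 0
  real := fun A i j =>
    if h : A = 0 ∧ i = 0 ∧ j < I.numY then I.prob ⟨j, h.2.2⟩ else 0

/-- The set of first-stage nodes selected by the plan: row `0` of natural-number array `2`. -/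
def SeedingInstance.firstStage (I : SeedingInstance) (σ : Mem) : Finset (Fin I.numX) :=
  σ.row I.numX 2 0

/-- Natural-number array `3` is overwritten, with the characteristic vector of `Q` in row `0`. -/
def SeedingInstance.reveal (I : SeedingInstance) (σ : Mem) (Q : Finset (Fin I.numY)) : Mem :=
  { σ with nat := fun A i j =>
      if A = 3 then
        (if h : i = 0 ∧ j < I.numY then (if (⟨j, h.2⟩ : Fin I.numY) ∈ Q then 1 else 0) else 0)
      else σ.nat A i j }

/-- The set of second-stage nodes selected in the end: row `0` of natural-number array `4`. -/
def SeedingInstance.secondStage (I : SeedingInstance) (σ : Mem) : Finset (Fin I.numY) :=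
  σ.row I.numY 4 0

/-- The memory `σ` left by the plan represents the adaptive policy `π`, with second stage computed
in at most `t` steps: `π.S` is the set stored in `σ`, and for each realization `R`, if the realized
neighbours of `π.S` are revealed, then `respond` halts within `t` steps, without any dependence on
random bits, having computed `π.T R`. -/
def SeedingAlgorithm.Represents (alg : SeedingAlgorithm) (I : SeedingInstance) (t : ℕ) (σ : Mem)
    (π : AdaptivePolicy I) : Prop :=
  π.S = I.firstStage σ ∧
    ∀ R : Finset (Fin I.numY), ∃ τ : Mem,
      runFor I.f t ([alg.respond], I.reveal σ (R ∩ I.nbrs π.S)) = PMF.pure ([], τ) ∧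
        π.T R = I.secondStage τ

/-!
The algorithm is a greedy algorithm on small sets of nodes, analysed by sampling.

*The algorithm.* Let `M` be the size of the input plus a constant. The budget, truncated to the
number of all nodes, is spent in rounds of a constant cost `L` (or in a single round, if it is at
most a constant `k₀`). A candidate is a set of at most `k₀` first-stage nodes; there are
polynomially many, and so are the sets of at most `k₀` second-stage nodes, which are listed in a
table. After a round with candidate `q`, a scenario that realizes the set `R` adds to its
selection the best set in the table that consists of nodes of `R` adjacent to the candidate and
that fits into the cost of the round (`Tables.step`). The second stage depends only on the
candidates and on the realized neighbours, so the program `respond` can replay it. The candidate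
of each round maximizes an estimate of the expected value after the round: the average over
`M ^ 11` samples of the set of realized common nodes, those of probability at least `1 / M ^ 2`, plus
the exact contribution of the scenarios in which a single rare node is realized
(`SeedingInstance.estimate`). That this can be programmed within polynomial time on the machine is
`exists_algorithm`.

*The comparator.* An optimal policy selects the common nodes with certain marginal probabilities.
If the nodes were selected independently with these probabilities, the expected value would still
be at least `1 - 1 / e` times as large (`correlation_gap`). Its first stage, and the second-stage
nodes with their marginals, can be packed into bundles of weight nearly `L`, each second-stage
node together with a neighbour (`exists_packed`). Overfull bundles are unlikely, and discarding
them costs little (`expect_trim`), by a contention resolution argument (`expect_contention`) that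
rests on the positive correlation of monotone functions of independent bits. What remains in each
bundle is available to a candidate of the algorithm. Since the number of rounds nearly equals the
number `J` of bundles and every greedy round closes a fraction `1 / J` of the gap, the greedy
rounds achieve another factor `1 - 1 / e` (`Tables.Greedy.le_estimate`,
`exists_comparator_of_lt`). For small budgets the first stage of the optimal policy is itself a
candidate (`exists_comparator_of_le`).

*The errors.* The values of sets of common nodes that can be reached are at most `M ^ 3` times the
optimum, since a single such node can be seeded with a probability of at least `1 / M ^ 2`
(`SeedingInstance.f_le_of_common`). So a Chernoff bound and a union bound over the sequences of
candidates show that with probability at least `1 - 1 / r` the estimate overrates none of them by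
more than a small fraction of the optimum, nor underrates the comparator by more than that
(`measure_deviation_le`, `Comparator.measure_failure_le`). Rare nodes are realized so seldom that
scenarios with two of them do not matter: one inequality bounds the optimum by the separate
contributions of common and rare nodes (`SeedingInstance.value_le`), the other one bounds the
value of the computed policy from below in the same form (`SeedingInstance.le_expect_prob`).
-/

/-! ### Deterministic structured programs -/

/-- Running `c` from the memory `σ` takes exactly `t` steps, uses no random bits, and leaves the
memory `τ`, whatever commands remain to be executed afterwards. -/
def Steps {n : ℕ} (f : Finset (Fin n) → ℝ) (c : Cmd) (σ τ : Mem) (t : ℕ) : Prop :=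
  ∀ (K : List Cmd) (s : ℕ), runFor f (t + s) (c :: K, σ) = runFor f s (K, τ)

section Steps

variable {n : ℕ} {f : Finset (Fin n) → ℝ}

theorem runFor_succ (t : ℕ) (c : Config) :
    runFor f (t + 1) c = (step f c).bind (runFor f t) := rfl

theorem runFor_nil (t : ℕ) (σ : Mem) : runFor f t ([], σ) = PMF.pure ([], σ) := by
  induction t with
  | zero => rfl
  | succ t ih => rw [runFor_succ, step, PMF.pure_bind, ih]

theorem Steps.setNat (A : ℕ) (i j e : NatExpr) (σ : Mem) :
    Steps f (.setNat A i j e) σ (σ.setNat A (i.eval σ) (j.eval σ) (e.eval σ)) 1 := by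
  intro K s
  rw [add_comm, runFor_succ, step, PMF.pure_bind]

theorem Steps.setReal (A : ℕ) (i j : NatExpr) (e : RealExpr) (σ : Mem) :
    Steps f (.setReal A i j e) σ (σ.setReal A (i.eval σ) (j.eval σ) (e.eval f σ)) 1 := by
  intro K s
  rw [add_comm, runFor_succ, step, PMF.pure_bind]

theorem Steps.seq {c d : Cmd} {σ τ υ : Mem} {t u : ℕ} (hc : Steps f c σ τ t)
    (hd : Steps f d τ υ u) : Steps f (.seq c d) σ υ (1 + t + u) := by
  intro K s
  rw [show 1 + t + u + s = (t + (u + s)) + 1 by ring, runFor_succ, step, PMF.pure_bind, hc, hd]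

theorem Steps.branch_pos {b : TestExpr} {c d : Cmd} {σ τ : Mem} {t : ℕ} (hb : b.Holds f σ)
    (hc : Steps f c σ τ t) : Steps f (.branch b c d) σ τ (1 + t) := by
  intro K s
  rw [show 1 + t + s = (t + s) + 1 by ring, runFor_succ, step, PMF.pure_bind, if_pos hb, hc]

theorem Steps.branch_neg {b : TestExpr} {c d : Cmd} {σ τ : Mem} {t : ℕ} (hb : ¬ b.Holds f σ)
    (hd : Steps f d σ τ t) : Steps f (.branch b c d) σ τ (1 + t) := by
  intro K s
  rw [show 1 + t + s = (t + s) + 1 by ring, runFor_succ, step, PMF.pure_bind, if_neg hb, hd]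

theorem Steps.loop_pos {b : TestExpr} {c : Cmd} {σ τ υ : Mem} {t u : ℕ} (hb : b.Holds f σ)
    (hc : Steps f c σ τ t) (hl : Steps f (.loop b c) τ υ u) :
    Steps f (.loop b c) σ υ (1 + t + u) := by
  intro K s
  rw [show 1 + t + u + s = (t + (u + s)) + 1 by ring, runFor_succ, step, PMF.pure_bind, if_pos hb,
    hc, hl]

theorem Steps.loop_neg {b : TestExpr} {c : Cmd} {σ : Mem} (hb : ¬ b.Holds f σ) :
    Steps f (.loop b c) σ σ 1 := by
  intro K s
  rw [add_comm, runFor_succ, step, PMF.pure_bind, if_neg hb]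

end Steps

/-- The content of the scalar variable `v`, stored as the entry `v[0, 0]`. -/
abbrev NatExpr.var (v : ℕ) : NatExpr := .read v (.lit 0) (.lit 0)

/-- Deterministic programs whose only loops are counting loops: `forTo v u p` runs `p` with the
scalar `v` counting from `0` up to the scalar `u`. -/
inductive Prog where
  | skip
  | nat (A : ℕ) (i j e : NatExpr)
  | real (A : ℕ) (i j : NatExpr) (e : RealExpr)
  | seq (p q : Prog)
  | ite (b : TestExpr) (p q : Prog)
  | forTo (v u : ℕ) (p : Prog)

namespace Prog

/-- The command that a program stands for; `skip` becomes a loop that is never entered. -/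
def compile : Prog → Cmd
  | skip => .loop (.not (.natLe (.lit 0) (.lit 0))) (.setNat 0 (.lit 0) (.lit 0) (.lit 0))
  | nat A i j e => .setNat A i j e
  | real A i j e => .setReal A i j e
  | seq p q => .seq p.compile q.compile
  | ite b p q => .branch b p.compile q.compile
  | forTo v u p => .seq (.setNat v (.lit 0) (.lit 0) (.lit 0))
      (.loop (.natLe (.plus (.var v) (.lit 1)) (.var u))
        (.seq p.compile (.setNat v (.lit 0) (.lit 0) (.plus (.var v) (.lit 1)))))

/-- The memory after `i` iterations of a counting loop with counter `v` and body `g`. -/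
noncomputable def loopState (v : ℕ) (g : Mem → Mem) (σ : Mem) : ℕ → Mem
  | 0 => σ.setNat v 0 0 0
  | i + 1 => (g (loopState v g σ i)).setNat v 0 0 (i + 1)

open Classical in
/-- The memory left by a program. -/
noncomputable def denote {n : ℕ} (f : Finset (Fin n) → ℝ) : Prog → Mem → Mem
  | skip, σ => σ
  | nat A i j e, σ => σ.setNat A (i.eval σ) (j.eval σ) (e.eval σ)
  | real A i j e, σ => σ.setReal A (i.eval σ) (j.eval σ) (e.eval f σ)
  | seq p q, σ => denote f q (denote f p σ)
  | ite b p q, σ => if b.Holds f σ then denote f p σ else denote f q σ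
  | forTo v u p, σ => loopState v (denote f p) σ (σ.nat u 0 0)

open Classical in
/-- The number of steps taken by a program. -/
noncomputable def time {n : ℕ} (f : Finset (Fin n) → ℝ) : Prog → Mem → ℕ
  | skip, _ => 1
  | nat _ _ _ _, _ => 1
  | real _ _ _ _, _ => 1
  | seq p q, σ => 1 + time f p σ + time f q (denote f p σ)
  | ite b p q, σ => 1 + if b.Holds f σ then time f p σ else time f q σ
  | forTo v u p, σ =>
      3 + ∑ i ∈ Finset.range (σ.nat u 0 0), (time f p (loopState v (denote f p) σ i) + 3)

/-- The arrays of natural numbers that a program may modify. -/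
def writes : Prog → List ℕ
  | skip => []
  | nat A _ _ _ => [A]
  | real _ _ _ _ => []
  | seq p q => p.writes ++ q.writes
  | ite _ p q => p.writes ++ q.writes
  | forTo v _ p => v :: p.writes

/-- The arrays of real numbers that a program may modify. -/
def realWrites : Prog → List ℕ
  | skip => []
  | nat _ _ _ _ => []
  | real A _ _ _ => [A]
  | seq p q => p.realWrites ++ q.realWrites
  | ite _ p q => p.realWrites ++ q.realWrites
  | forTo _ _ p => p.realWrites

/-- The scalars that bound the counting loops of a program. -/
def bounds : Prog → List ℕ
  | skip => []
  | nat _ _ _ _ => []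
  | real _ _ _ _ => []
  | seq p q => p.bounds ++ q.bounds
  | ite _ p q => p.bounds ++ q.bounds
  | forTo _ u p => u :: p.bounds

/-- No counting loop modifies its counter or its bound. -/
def WF : Prog → Prop
  | skip => True
  | nat _ _ _ _ => True
  | real _ _ _ _ => True
  | seq p q => p.WF ∧ q.WF
  | ite _ p q => p.WF ∧ q.WF
  | forTo v u p => v ≠ u ∧ v ∉ p.writes ∧ u ∉ p.writes ∧ p.WF

/-- A bound on the number of steps if all loop bounds stay below `B`. -/
def cost (B : ℕ) : Prog → ℕ
  | skip => 1
  | nat _ _ _ _ => 1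
  | real _ _ _ _ => 1
  | seq p q => 1 + cost B p + cost B q
  | ite _ p q => 1 + (cost B p + cost B q)
  | forTo _ _ p => 3 + B * (cost B p + 3)

end Prog

namespace Mem

theorem setNat_nat (σ : Mem) (A i j v A' i' j' : ℕ) : (σ.setNat A i j v).nat A' i' j' =
    if A' = A ∧ i' = i ∧ j' = j then v else σ.nat A' i' j' := rfl

theorem setNat_nat_self (σ : Mem) (A i j v : ℕ) : (σ.setNat A i j v).nat A i j = v := by
  simp [setNat]

theorem setNat_nat_of_ne (σ : Mem) {A A' : ℕ} (h : A' ≠ A) (i j v : ℕ) :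
    (σ.setNat A i j v).nat A' = σ.nat A' := by
  ext; simp [setNat, h]

@[simp] theorem setNat_real (σ : Mem) (A i j v : ℕ) : (σ.setNat A i j v).real = σ.real := rfl

@[simp] theorem setReal_nat (σ : Mem) (A i j : ℕ) (v : ℝ) : (σ.setReal A i j v).nat = σ.nat := rfl

theorem setReal_real (σ : Mem) (A i j : ℕ) (v : ℝ) (A' i' j' : ℕ) :
    (σ.setReal A i j v).real A' i' j' = if A' = A ∧ i' = i ∧ j' = j then v else σ.real A' i' j' :=
  rfl

theorem setReal_real_of_ne (σ : Mem) {A A' : ℕ} (h : A' ≠ A) (i j : ℕ) (v : ℝ) :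
    (σ.setReal A i j v).real A' = σ.real A' := by
  ext; simp [setReal, h]

theorem mem_row {σ : Mem} {n A i : ℕ} {j : Fin n} : j ∈ σ.row n A i ↔ σ.nat A i j ≠ 0 := by
  simp [row]

theorem row_congr {σ τ : Mem} {n A B i k : ℕ} (h : ∀ j < n, σ.nat A i j = τ.nat B k j) :
    σ.row n A i = τ.row n B k := by
  ext j; simp [mem_row, h j j.2]

end Mem

namespace Prog

variable {n : ℕ} {f : Finset (Fin n) → ℝ}

theorem loopState_nat_of_ne {v A : ℕ} {g : Mem → Mem} (hA : A ≠ v)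
    (hg : ∀ σ, (g σ).nat A = σ.nat A) (σ : Mem) (i : ℕ) :
    (loopState v g σ i).nat A = σ.nat A := by
  induction i with
  | zero => exact Mem.setNat_nat_of_ne _ hA _ _ _
  | succ i ih => rw [loopState, Mem.setNat_nat_of_ne _ hA, hg, ih]

theorem loopState_real {v A : ℕ} {g : Mem → Mem}
    (hg : ∀ σ, (g σ).real A = σ.real A) (σ : Mem) (i : ℕ) :
    (loopState v g σ i).real A = σ.real A := by
  induction i with
  | zero => rfl
  | succ i ih => rw [loopState, Mem.setNat_real, hg, ih]

theorem loopState_counter (v : ℕ) (g : Mem → Mem) (σ : Mem) (i : ℕ) :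
    (loopState v g σ i).nat v 0 0 = i := by
  cases i <;> exact Mem.setNat_nat_self _ _ _ _ _

theorem denote_seq (p q : Prog) (σ : Mem) :
    denote f (seq p q) σ = denote f q (denote f p σ) := rfl

theorem denote_ite {b : TestExpr} {p q : Prog} {σ : Mem} {P : Prop} [Decidable P]
    (h : b.Holds f σ ↔ P) :
    denote f (ite b p q) σ = if P then denote f p σ else denote f q σ := by
  by_cases hb : b.Holds f σ
  · rw [denote, if_pos hb, if_pos (h.1 hb)]
  · rw [denote, if_neg hb, if_neg fun hP => hb (h.2 hP)]

theorem denote_nat_of_notMem {p : Prog} {A : ℕ} (hA : A ∉ p.writes) (σ : Mem) :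
    (denote f p σ).nat A = σ.nat A := by
  induction p generalizing σ with
  | skip => rfl
  | nat B i j e => exact Mem.setNat_nat_of_ne _ (by simpa [writes] using hA) _ _ _
  | real B i j e => rfl
  | seq p q hp hq =>
    simp only [writes, List.mem_append, not_or] at hA
    rw [denote, hq hA.2, hp hA.1]
  | ite b p q hp hq =>
    simp only [writes, List.mem_append, not_or] at hA
    rw [denote]
    split_ifs
    · exact hp hA.1 σ
    · exact hq hA.2 σ
  | forTo v u p hp =>
    simp only [writes, List.mem_cons, not_or] at hA
    exact loopState_nat_of_ne hA.1 (hp hA.2) _ _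

theorem denote_real_of_notMem {p : Prog} {A : ℕ} (hA : A ∉ p.realWrites) (σ : Mem) :
    (denote f p σ).real A = σ.real A := by
  induction p generalizing σ with
  | skip => rfl
  | nat B i j e => rfl
  | real B i j e => exact Mem.setReal_real_of_ne _ (by simpa [realWrites] using hA) _ _ _
  | seq p q hp hq =>
    simp only [realWrites, List.mem_append, not_or] at hA
    rw [denote, hq hA.2, hp hA.1]
  | ite b p q hp hq =>
    simp only [realWrites, List.mem_append, not_or] at hA
    rw [denote]
    split_ifs
    · exact hp hA.1 σ
    · exact hq hA.2 σ
  | forTo v u p hp =>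
    simp only [realWrites] at hA
    exact loopState_real (hp hA) _ _

/-- The compiled program does what the denotation says, in the stated number of steps. -/
theorem steps_compile {p : Prog} (hp : p.WF) (σ : Mem) :
    Steps f p.compile σ (denote f p σ) (time f p σ) := by
  induction p generalizing σ with
  | skip => exact Steps.loop_neg (by simp [TestExpr.Holds])
  | nat A i j e => exact Steps.setNat A i j e σ
  | real A i j e => exact Steps.setReal A i j e σ
  | seq p q ihp ihq => exact Steps.seq (ihp hp.1 σ) (ihq hp.2 _)
  | ite b p q ihp ihq =>
    by_cases hb : b.Holds f σ
    · simpa [denote, time, hb] using! Steps.branch_pos hb (ihp hp.1 σ)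
    · simpa [denote, time, hb] using! Steps.branch_neg hb (ihq hp.2 σ)
  | forTo v u p ih =>
    obtain ⟨hvu, hv, hu, hp⟩ := hp
    set N := σ.nat u 0 0 with hN
    have hun : ∀ i, (loopState v (denote f p) σ i).nat u 0 0 = N := fun i => by
      rw [loopState_nat_of_ne hvu.symm (denote_nat_of_notMem hu)]
    have key : ∀ k i, i + k = N → Steps f
        (.loop (.natLe (.plus (.var v) (.lit 1)) (.var u))
          (.seq p.compile (.setNat v (.lit 0) (.lit 0) (.plus (.var v) (.lit 1)))))
        (loopState v (denote f p) σ i) (loopState v (denote f p) σ N)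
        (1 + ∑ j ∈ Finset.Ico i N, (time f p (loopState v (denote f p) σ j) + 3)) := by
      intro k
      induction k with
      | zero =>
        intro i hi
        obtain rfl : i = N := by omega
        simpa using Steps.loop_neg (f := f) (by
          simp [TestExpr.Holds, NatExpr.eval, hun, loopState_counter])
      | succ k ihk =>
        intro i hi
        have h1 := ihk (i + 1) (by omega)
        have h2 := Steps.seq (ih hp (loopState v (denote f p) σ i))
          (Steps.setNat v (.lit 0) (.lit 0) (.plus (.var v) (.lit 1)) _)
        simp only [NatExpr.eval, denote_nat_of_notMem hv, loopState_counter] at h2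
        have h3 := Steps.loop_pos (f := f)
          (b := .natLe (.plus (.var v) (.lit 1)) (.var u)) (by
            simp only [TestExpr.Holds, NatExpr.eval, hun, loopState_counter]; omega) h2 h1
        rw [Finset.sum_eq_sum_Ico_succ_bot (by omega)]
        convert! h3 using 1
        ring
    have h0 := Steps.seq (Steps.setNat (f := f) v (.lit 0) (.lit 0) (.lit 0) σ) (key N 0 (by omega))
    rw [denote, time, Finset.range_eq_Ico]
    convert! h0 using 1
    ring

/-- A loop bound that the program never modifies keeps its initial value, so the bounds can be
read off the initial memory. -/
theorem time_le_cost {p : Prog} (hp : p.WF) {σ : Mem} {B : ℕ}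
    (h : ∀ u ∈ p.bounds, u ∉ p.writes ∧ σ.nat u 0 0 ≤ B) : time f p σ ≤ cost B p := by
  induction p generalizing σ with
  | skip => exact le_rfl
  | nat A i j e => exact le_rfl
  | real A i j e => exact le_rfl
  | seq p q ihp ihq =>
    simp only [bounds, writes, List.mem_append, not_or] at h
    have h1 := ihp hp.1 (σ := σ) fun u hu => ⟨(h u (.inl hu)).1.1, (h u (.inl hu)).2⟩
    have h2 := ihq hp.2 (σ := denote f p σ) fun u hu => ⟨(h u (.inr hu)).1.2, by
      rw [denote_nat_of_notMem (h u (.inr hu)).1.1]; exact (h u (.inr hu)).2⟩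
    simp only [time, cost]; omega
  | ite b p q ihp ihq =>
    simp only [bounds, writes, List.mem_append, not_or] at h
    have h1 := ihp hp.1 (σ := σ) fun u hu => ⟨(h u (.inl hu)).1.1, (h u (.inl hu)).2⟩
    have h2 := ihq hp.2 (σ := σ) fun u hu => ⟨(h u (.inr hu)).1.2, (h u (.inr hu)).2⟩
    simp only [time, cost]; split_ifs <;> omega
  | forTo v u p ih =>
    obtain ⟨hvu, hv, hu, hp⟩ := hp
    simp only [bounds, writes, List.mem_cons, not_or] at h
    have h1 : ∀ i, time f p (loopState v (denote f p) σ i) ≤ cost B p := fun i =>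
      ih hp fun w hw => by
        obtain ⟨⟨hwv, hw'⟩, hwB⟩ := h w (.inr hw)
        refine ⟨hw', ?_⟩
        rwa [loopState_nat_of_ne hwv (denote_nat_of_notMem hw')]
    have h2 := (h u (.inl rfl)).2
    simp only [time, cost]
    gcongr 3 + ?_
    calc _ ≤ ∑ i ∈ Finset.range (σ.nat u 0 0), (cost B p + 3) :=
          Finset.sum_le_sum fun i _ => by have := h1 i; omega
      _ ≤ B * (cost B p + 3) := by
          rw [Finset.sum_const, Finset.card_range, smul_eq_mul]
          exact Nat.mul_le_mul_right _ h2

/-- The cost is polynomial in the loop bounds. -/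
theorem exists_cost_le (p : Prog) : ∃ C d : ℕ, ∀ B, 1 ≤ B → cost B p ≤ C * B ^ d := by
  have aux : ∀ {C C' d d' B : ℕ}, 1 ≤ B → C * B ^ d + C' * B ^ d' ≤ (C + C') * B ^ (d + d') := by
    intro C C' d d' B hB
    rw [add_mul]
    gcongr <;> omega
  induction p with
  | skip => exact ⟨1, 0, by simp [cost]⟩
  | nat A i j e => exact ⟨1, 0, by simp [cost]⟩
  | real A i j e => exact ⟨1, 0, by simp [cost]⟩
  | seq p q ihp ihq =>
    obtain ⟨C, d, h⟩ := ihp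
    obtain ⟨C', d', h'⟩ := ihq
    refine ⟨1 + (C + C'), d + d', fun B hB => ?_⟩
    have h1 := h B hB
    have h2 := h' B hB
    have h3 := aux (C := C) (C' := C') (d := d) (d' := d') hB
    have h4 : 1 ≤ B ^ (d + d') := Nat.one_le_pow _ _ hB
    simp only [cost]; rw [add_mul 1]; omega
  | ite b p q ihp ihq =>
    obtain ⟨C, d, h⟩ := ihp
    obtain ⟨C', d', h'⟩ := ihq
    refine ⟨1 + (C + C'), d + d', fun B hB => ?_⟩
    have h1 := h B hB
    have h2 := h' B hB
    have h3 := aux (C := C) (C' := C') (d := d) (d' := d') hB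
    have h4 : 1 ≤ B ^ (d + d') := Nat.one_le_pow _ _ hB
    simp only [cost]; rw [add_mul 1]; omega
  | forTo v u p ih =>
    obtain ⟨C, d, h⟩ := ih
    refine ⟨6 + C, d + 1, fun B hB => ?_⟩
    have h1 := Nat.mul_le_mul_left B (h B hB)
    have h4 : 1 ≤ B ^ d := Nat.one_le_pow _ _ hB
    have h5 : B ≤ B ^ (d + 1) := by rw [pow_succ]; exact Nat.le_mul_of_pos_left _ h4
    simp only [cost, mul_add]
    calc 3 + (B * cost B p + B * 3) ≤ 3 * B + (B * (C * B ^ d) + B * 3) := by omega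
      _ = 6 * B + C * B ^ (d + 1) := by ring
      _ ≤ 6 * B ^ (d + 1) + C * B ^ (d + 1) := by omega
      _ = _ := by ring

/-- Induction along a counting loop; the arrays that the loop does not modify are constant. -/
theorem forTo_induction {v u : ℕ} {p : Prog} {σ : Mem} (P : ℕ → Mem → Prop)
    (h0 : P 0 (σ.setNat v 0 0 0))
    (hs : ∀ i < σ.nat u 0 0, ∀ τ, τ.nat v 0 0 = i →
      (∀ A, A ≠ v → A ∉ p.writes → τ.nat A = σ.nat A) →
      (∀ A ∉ p.realWrites, τ.real A = σ.real A) → P i τ →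
      P (i + 1) ((denote f p τ).setNat v 0 0 (i + 1))) :
    P (σ.nat u 0 0) (denote f (forTo v u p) σ) := by
  have : ∀ i ≤ σ.nat u 0 0, P i (loopState v (denote f p) σ i) := by
    intro i
    induction i with
    | zero => exact fun _ => h0
    | succ i ih =>
      exact fun hi => hs i hi _ (loopState_counter _ _ _ _)
        (fun A h1 h2 => loopState_nat_of_ne h1 (denote_nat_of_notMem h2) _ _)
        (fun A h2 => loopState_real (denote_real_of_notMem h2) _ _) (ih (by omega))
  exact this _ le_rfl

theorem row_denote {m : ℕ} {p : Prog} {A : ℕ} (hA : A ∉ p.writes) (σ : Mem) (i : ℕ) :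
    (denote f p σ).row m A i = σ.row m A i :=
  Mem.row_congr fun j _ => by rw [denote_nat_of_notMem hA]

/-- Writing a row of an array: entry `j` becomes `val j`. -/
theorem denote_fillRow {v u A : ℕ} {i e : NatExpr} {σ : Mem} (hvA : v ≠ A)
    {i₀ : ℕ} {val : ℕ → ℕ}
    (h : ∀ j < σ.nat u 0 0, ∀ τ : Mem, τ.nat v 0 0 = j →
      (∀ B, B ≠ v → B ≠ A → τ.nat B = σ.nat B) → τ.real = σ.real → τ.nat A i₀ j = σ.nat A i₀ j →
      i.eval τ = i₀ ∧ e.eval τ = val j) (i' j' : ℕ) :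
    (denote f (forTo v u (nat A i (.var v) e)) σ).nat A i' j' =
      if i' = i₀ ∧ j' < σ.nat u 0 0 then val j' else σ.nat A i' j' := by
  refine forTo_induction (f := f) (σ := σ) (v := v) (u := u) (p := nat A i (.var v) e)
    (fun k τ => τ.real = σ.real ∧
      ∀ i' j', τ.nat A i' j' = if i' = i₀ ∧ j' < k then val j' else σ.nat A i' j')
    ⟨rfl, fun i' j' => ?_⟩ ?_ |>.2 i' j'
  · rw [Mem.setNat_nat_of_ne _ hvA.symm]; simp
  · rintro k hk τ hv hfr - ⟨hre, hP⟩
    have h2 := h k hk τ hv (fun B h1 h2 => hfr B h1 (by simpa [writes] using h2)) hre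
      (by rw [hP, if_neg (by omega)])
    refine ⟨by rw [Mem.setNat_real, denote, Mem.setNat_real, hre], fun i' j' => ?_⟩
    rw [Mem.setNat_nat_of_ne _ hvA.symm, denote, Mem.setNat_nat, hP]
    simp only [NatExpr.eval, h2.1, h2.2, hv]
    by_cases h3 : i' = i₀ <;> by_cases h4 : j' = k <;> by_cases h5 : j' < k <;>
      simp [h3, h4, h5] <;> intro h6 <;> omega

end Prog

/-! ### The programs -/

-- The memory is addressed by numbers; these are the names used in the programs. Side conditions
-- list arrays by number, so that `decide`, `simp` and `omega` settle questions of membership.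
-- `aAdj`, `aFirst`, `aRevealed` and `aSecond` are the arrays of natural numbers for input and
-- output that the machine model prescribes, and `aZero` is a scalar that is never written. The
-- names from `aNX` to `aR` are scalars (entries `[0, 0]`): the parameters of the algorithm, and
-- the counters `aI`, `aJ`, `aQ`, `aS`, `aR`. Row `q` of `aTX` is the `q`-th candidate, with
-- recorded size `aSX[0, q]` and neighbourhood in row `q` of `aCov`, and `aCX` is the number of
-- candidates; `aTY`, `aSY`, `aCY` play these roles for the sets of second-stage nodes. Rows `s`
-- of `aReal` and `aSel` hold the nodes realized and selected in scenario `s`, and `aHist[0, k]`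
-- is the candidate chosen in round `k`. The last four names are arrays of real numbers, which are
-- numbered separately: the probabilities, the weights of the scenarios, an accumulator, and the
-- largest score so far.
notation "aAdj" => (1 : ℕ)
notation "aFirst" => (2 : ℕ)
notation "aRevealed" => (3 : ℕ)
notation "aSecond" => (4 : ℕ)
notation "aZero" => (5 : ℕ)
notation "aNX" => (10 : ℕ)
notation "aNY" => (11 : ℕ)
notation "aBase" => (12 : ℕ)
notation "aCap" => (13 : ℕ)
notation "aCost" => (14 : ℕ)
notation "aRounds" => (15 : ℕ)
notation "aUsed" => (16 : ℕ)
notation "aSamples" => (17 : ℕ)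
notation "aRows" => (18 : ℕ)
notation "aTmp" => (19 : ℕ)
notation "aI" => (20 : ℕ)
notation "aJ" => (21 : ℕ)
notation "aQ" => (22 : ℕ)
notation "aS" => (23 : ℕ)
notation "aR" => (24 : ℕ)
notation "aTX" => (30 : ℕ)
notation "aSX" => (31 : ℕ)
notation "aCX" => (32 : ℕ)
notation "aTY" => (33 : ℕ)
notation "aSY" => (34 : ℕ)
notation "aCY" => (35 : ℕ)
notation "aOld" => (36 : ℕ)
notation "aCov" => (37 : ℕ)
notation "aReal" => (40 : ℕ)
notation "aSel" => (41 : ℕ)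
notation "aBest" => (42 : ℕ)
notation "aCand" => (43 : ℕ)
notation "aViol" => (44 : ℕ)
notation "aCur" => (45 : ℕ)
notation "aArgmax" => (46 : ℕ)
notation "aHist" => (47 : ℕ)
notation "aProb" => (0 : ℕ)
notation "aWt" => (1 : ℕ)
notation "aAcc" => (2 : ℕ)
notation "aMaxScore" => (3 : ℕ)

/-- The set found by scanning the sets `t 0, …, t (c - 1)`: starting with `A`, the current set is
replaced with `A ∪ t i` whenever `i` is admissible and this is an improvement. -/
noncomputable def improve {n : ℕ} (f : Finset (Fin n) → ℝ) (t : ℕ → Finset (Fin n)) (ok : ℕ → Prop)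
    [DecidablePred ok] (A : Finset (Fin n)) : ℕ → Finset (Fin n)
  | 0 => A
  | c + 1 =>
    if ok c ∧ f (improve f t ok A c) < f (A ∪ t c) then A ∪ t c else improve f t ok A c

/-- The tables that the programs consult: an enumeration `tY i`, `i < cY`, of sets of second-stage
nodes, with upper bounds `sY i` on their sizes; candidates `q < cX` for sets of first-stage nodes,
with upper bounds `sX q` on their sizes and neighbourhoods `cov q`; and the cost of a round. -/
structure Tables (n : ℕ) where
  tY : ℕ → Finset (Fin n)
  sY : ℕ → ℕ
  cY : ℕ
  cov : ℕ → Finset (Fin n)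
  sX : ℕ → ℕ
  cX : ℕ
  cost : ℕ

namespace Tables

variable {n : ℕ}

/-- The tables stored in the memory. -/
def ofMem (n : ℕ) (σ : Mem) : Tables n where
  tY := σ.row n aTY
  sY := σ.nat aSY 0
  cY := σ.nat aCY 0 0
  cov := σ.row n aCov
  sX := σ.nat aSX 0
  cX := σ.nat aCX 0 0
  cost := σ.nat aCost 0 0

theorem ofMem_congr {σ τ : Mem} (h : ∀ A ∈ [31, 32, 33, 34, 35, 37, 14], τ.nat A = σ.nat A) :
    ofMem n τ = ofMem n σ := by
  have hrow : ∀ A ∈ [31, 32, 33, 34, 35, 37, 14], τ.row n A = σ.row n A := fun A hA => by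
    ext i : 1
    exact Mem.row_congr fun j _ => by rw [h A hA]
  simp only [ofMem, h 31 (by simp), h 32 (by simp), h 34 (by simp), h 35 (by simp), h 14 (by simp),
    hrow 33 (by simp), hrow 37 (by simp)]

open Classical in
/-- The set of second-stage nodes after a round with candidate `q`, if the nodes of `R` are realized
and those of `A` have been selected before: the best union of `A` with a set in the table that
consists of realized neighbours and that is not too large. -/
noncomputable def step (T : Tables n) (f : Finset (Fin n) → ℝ) (q : ℕ) (R A : Finset (Fin n)) :
    Finset (Fin n) :=
  improve f T.tY (fun i => T.tY i ⊆ R ∩ T.cov q ∧ T.sY i + T.sX q ≤ T.cost) A T.cY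

/-- The set of second-stage nodes after `k` rounds with the candidates `h 0, …, h (k - 1)`. -/
noncomputable def sim (T : Tables n) (f : Finset (Fin n) → ℝ) (h : ℕ → ℕ) (R : Finset (Fin n)) :
    ℕ → Finset (Fin n)
  | 0 => ∅
  | k + 1 => T.step f (h k) R (sim T f h R k)

theorem sim_congr (T : Tables n) (f : Finset (Fin n) → ℝ) {h h' : ℕ → ℕ} (R : Finset (Fin n))
    {k : ℕ} (hh : ∀ i < k, h i = h' i) : T.sim f h R k = T.sim f h' R k := by
  induction k with
  | zero => rfl
  | succ k ih => rw [sim, sim, hh k (by omega), ih fun i hi => hh i (by omega)]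

end Tables

namespace Prog

/-- Sequential composition. -/
infixr:60 " ;; " => Prog.seq

/-- `A[i, j] := e` for `j` below the scalar `u`; the expression may refer to `j` as the scalar
`v`. -/
abbrev fillRow (v u A : ℕ) (i e : NatExpr) : Prog := forTo v u (nat A i (.var v) e)

/-- Scans all sets in the table `tY` that fit into the realized set in the row of `R` named by the
scalar `s` and into the neighbourhood of the candidate `cur`, and that respect the cost of a round,
for the one whose union with the row of `A` named by the scalar `s` has the largest value. That
union is stored in row `0` of `best`. -/
def bestOf (R A s : ℕ) : Prog :=
  fillRow aI aNY aBest (.lit 0) (.read A (.var s) (.var aI)) ;;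
  forTo aJ aCY
    (nat aViol (.lit 0) (.lit 0) (.lit 0) ;;
    forTo aI aNY
      (ite (.and (.natLe (.lit 1) (.read aTY (.var aJ) (.var aI)))
          (.not (.and (.natLe (.lit 1) (.read R (.var s) (.var aI)))
            (.natLe (.lit 1) (.read aCov (.var aCur) (.var aI))))))
        (nat aViol (.lit 0) (.lit 0) (.lit 1)) skip) ;;
    fillRow aI aNY aCand (.lit 0)
      (.plus (.read A (.var s) (.var aI)) (.read aTY (.var aJ) (.var aI))) ;;
    ite (.and (.and (.natLe (.var aViol) (.lit 0))
        (.natLe (.plus (.read aSY (.lit 0) (.var aJ)) (.read aSX (.lit 0) (.var aCur)))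
          (.var aCost)))
        (.not (.realLe (.oracle aCand (.lit 0)) (.oracle aBest (.lit 0)))))
      (fillRow aI aNY aBest (.lit 0) (.read aCand (.lit 0) (.var aI))) skip)

variable {n : ℕ} {f : Finset (Fin n) → ℝ}

open Classical in
/-- The program `bestOf` computes `Tables.step` in the scenario named by the scalar `s`. -/
theorem row_bestOf {R A s : ℕ} {σ : Mem} (hn : σ.nat aNY 0 0 = n)
    (hR : R ∉ [20, 21, 42, 43, 44]) (hA : A ∉ [20, 21, 42, 43, 44])
    (hs : s ∉ [20, 21, 42, 43, 44]) :
    (denote f (bestOf R A s) σ).row n aBest 0 =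
      (Tables.ofMem n σ).step f (σ.nat aCur 0 0) (σ.row n R (σ.nat s 0 0))
        (σ.row n A (σ.nat s 0 0)) := by
  let Fits : ℕ → Prop := fun i =>
    σ.row n aTY i ⊆ σ.row n R (σ.nat s 0 0) ∩ σ.row n aCov (σ.nat aCur 0 0) ∧
      σ.nat aSY 0 i + σ.nat aSX 0 (σ.nat aCur 0 0) ≤ σ.nat aCost 0 0
  change _ = improve f (σ.row n aTY) Fits (σ.row n A (σ.nat s 0 0)) (σ.nat aCY 0 0)
  simp only [List.mem_cons, List.not_mem_nil, or_false, not_or] at hR hA hs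
  rw [bestOf, denote]
  set σ₁ := denote f (fillRow aI aNY aBest (.lit 0) (.read A (.var s) (.var aI))) σ
    with hσ₁
  have fr₁ : ∀ B, B ∉ [20, 42] → σ₁.nat B = σ.nat B := fun B hB => denote_nat_of_notMem hB _
  have b₁ : σ₁.row n aBest 0 = σ.row n A (σ.nat s 0 0) := by
    refine Mem.row_congr fun k hk => ?_
    rw [hσ₁, denote_fillRow (by decide) (i₀ := 0) (val := fun k => σ.nat A (σ.nat s 0 0) k)]
    · simp [hn, hk]
    · intro k _ τ hv hfr _ _
      simp [NatExpr.eval, hv, hfr A (by omega) (by omega), hfr s (by omega) (by omega)]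
  rw [show σ.nat aCY 0 0 = σ₁.nat aCY 0 0 by rw [fr₁ _ (by decide)]]
  refine forTo_induction (f := f) (fun k τ => τ.row n aBest 0 =
    improve f (σ.row n aTY) Fits (σ.row n A (σ.nat s 0 0)) k) ?_ ?_
  · rw [improve, ← b₁]
    exact Mem.row_congr fun k _ => by rw [Mem.setNat_nat_of_ne _ (by decide)]
  intro k hk τ hv hfr _ hP
  have fr : ∀ B, B ∉ [20, 21, 42, 43, 44] → τ.nat B = σ.nat B := by
    intro B hB
    simp only [List.mem_cons, List.not_mem_nil, or_false, not_or] at hB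
    rw [hfr B (by simp; omega) (by simp [writes]; omega), fr₁ B (by simp; omega)]
  rw [improve, ← hP]
  have hrow : ∀ (τ : Mem) v, (τ.setNat aJ 0 0 v).row n aBest 0 = τ.row n aBest 0 :=
    fun τ v => Mem.row_congr fun k _ => by rw [Mem.setNat_nat_of_ne _ (by decide)]
  rw [hrow, denote_seq, denote_seq, denote_seq]
  set τ₁ := denote f (nat aViol (.lit 0) (.lit 0) (.lit 0)) τ with hτ₁
  have g₁ : ∀ B, B ≠ 44 → τ₁.nat B = τ.nat B := fun B hB =>
    denote_nat_of_notMem (by simpa [writes] using hB) _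
  set τ₂ := denote f (forTo aI aNY
      (ite (.and (.natLe (.lit 1) (.read aTY (.var aJ) (.var aI)))
          (.not (.and (.natLe (.lit 1) (.read R (.var s) (.var aI)))
            (.natLe (.lit 1) (.read aCov (.var aCur) (.var aI))))))
        (nat aViol (.lit 0) (.lit 0) (.lit 1)) skip)) τ₁ with hτ₂
  have g₂ : ∀ B, B ∉ [20, 44] → τ₂.nat B = τ₁.nat B := fun B hB =>
    denote_nat_of_notMem (by simpa [writes] using hB) _
  have v₂ : τ₂.nat aViol 0 0 = 0 ↔ σ.row n aTY k ⊆
      σ.row n R (σ.nat s 0 0) ∩ σ.row n aCov (σ.nat aCur 0 0) := by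
    have hN : τ₁.nat aNY 0 0 = n := by rw [g₁ _ (by decide), fr _ (by decide), hn]
    have key : τ₂.nat aViol 0 0 = 0 ↔ ∀ y < τ₁.nat aNY 0 0, σ.nat aTY k y ≠ 0 →
        σ.nat R (σ.nat s 0 0) y ≠ 0 ∧ σ.nat aCov (σ.nat aCur 0 0) y ≠ 0 := by
      refine forTo_induction (f := f) (fun m υ => υ.nat aViol 0 0 = 0 ↔ ∀ y < m,
        σ.nat aTY k y ≠ 0 →
        σ.nat R (σ.nat s 0 0) y ≠ 0 ∧ σ.nat aCov (σ.nat aCur 0 0) y ≠ 0) ?_ ?_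
      · rw [Mem.setNat_nat_of_ne _ (by decide), hτ₁]
        simp [denote, NatExpr.eval, Mem.setNat_nat_self]
      · intro m hm υ hv' hfr' _ hP'
        have e : ∀ B, B ∉ [20, 21, 42, 43, 44] → υ.nat B = σ.nat B := fun B hB => by
          simp only [List.mem_cons, List.not_mem_nil, or_false, not_or] at hB
          rw [hfr' B (by simp; omega) (by simp [writes]; omega), g₁ B (by omega),
            fr B (by simp; omega)]
        have ej : υ.nat aJ 0 0 = k := by
          rw [hfr' _ (by decide) (by simp [writes]), g₁ _ (by decide), hv]
        rw [Mem.setNat_nat_of_ne _ (by decide), denote]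
        simp only [TestExpr.Holds, NatExpr.eval, hv', ej, e R (by simp; omega),
          e s (by simp; omega), e aTY (by decide), e aCov (by decide), e aCur (by decide)]
        have hsplit : (∀ y < m + 1, σ.nat aTY k y ≠ 0 →
            σ.nat R (σ.nat s 0 0) y ≠ 0 ∧ σ.nat aCov (σ.nat aCur 0 0) y ≠ 0) ↔
            (∀ y < m, σ.nat aTY k y ≠ 0 →
            σ.nat R (σ.nat s 0 0) y ≠ 0 ∧ σ.nat aCov (σ.nat aCur 0 0) y ≠ 0) ∧
            (σ.nat aTY k m ≠ 0 →
            σ.nat R (σ.nat s 0 0) m ≠ 0 ∧ σ.nat aCov (σ.nat aCur 0 0) m ≠ 0) := by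
          constructor
          · exact fun h => ⟨fun y hy => h y (by omega), h m (by omega)⟩
          · rintro ⟨h1, h2⟩ y hy
            rcases Nat.lt_succ_iff_lt_or_eq.1 hy with h | rfl
            · exact h1 y h
            · exact h2
        rw [hsplit, ← hP']
        split_ifs with hif
        · simp only [denote, NatExpr.eval, Mem.setNat_nat_self, one_ne_zero, false_iff]
          rintro ⟨-, h2⟩
          have := h2 (by omega)
          omega
        · simp only [denote]
          constructor
          · exact fun h => ⟨h, fun h3 => by omega⟩
          · exact fun h => h.1
    rw [key, hN]
    constructor
    · intro h y hy
      have := h y y.2 (Mem.mem_row.1 hy)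
      exact Finset.mem_inter.2 ⟨Mem.mem_row.2 this.1, Mem.mem_row.2 this.2⟩
    · intro h y hy h1
      have := Finset.mem_inter.1 (h ((Mem.mem_row (j := ⟨y, hy⟩)).2 h1))
      exact ⟨Mem.mem_row.1 this.1, Mem.mem_row.1 this.2⟩
  set τ₃ := denote f (fillRow aI aNY aCand (.lit 0)
      (.plus (.read A (.var s) (.var aI)) (.read aTY (.var aJ) (.var aI)))) τ₂ with hτ₃
  have g₃ : ∀ B, B ∉ [20, 43] → τ₃.nat B = τ₂.nat B := fun B hB =>
    denote_nat_of_notMem (by simpa [writes] using hB) _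
  have e₂ : ∀ B, B ∉ [20, 44] → τ₂.nat B = τ.nat B := fun B hB => by
    rw [g₂ B hB, g₁ B (by simp at hB; omega)]
  have e₃ : ∀ B, B ∉ [20, 43, 44] → τ₃.nat B = τ.nat B := fun B hB => by
    simp only [List.mem_cons, List.not_mem_nil, or_false, not_or] at hB
    rw [g₃ B (by simp; omega), e₂ B (by simp; omega)]
  have f₂ : ∀ B, B ∉ [20, 21, 42, 43, 44] → τ₂.nat B = σ.nat B := fun B hB => by
    have hB' := hB
    simp only [List.mem_cons, List.not_mem_nil, or_false, not_or] at hB'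
    rw [e₂ B (by simp; omega), fr B hB]
  have f₃ : ∀ B, B ∉ [20, 21, 42, 43, 44] → τ₃.nat B = σ.nat B := fun B hB => by
    have hB' := hB
    simp only [List.mem_cons, List.not_mem_nil, or_false, not_or] at hB'
    rw [e₃ B (by simp; omega), fr B hB]
  have c₃ : τ₃.row n aCand 0 = σ.row n A (σ.nat s 0 0) ∪ σ.row n aTY k := by
    ext y
    rw [Mem.mem_row, hτ₃, denote_fillRow (by decide) (i₀ := 0)
      (val := fun y => σ.nat A (σ.nat s 0 0) y + σ.nat aTY k y)]
    · rw [f₂ aNY (by decide), hn, Finset.mem_union, Mem.mem_row, Mem.mem_row]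
      simp only [y.2, and_self, if_true]
      omega
    · intro y _ υ hv' hfr' _ _
      have e : ∀ B, B ∉ [20, 21, 42, 43, 44] → υ.nat B = σ.nat B := fun B hB => by
        have hB' := hB
        simp only [List.mem_cons, List.not_mem_nil, or_false, not_or] at hB'
        rw [hfr' B (by simp; omega) (by simp; omega), f₂ B hB]
      have ej : υ.nat aJ 0 0 = k := by
        rw [hfr' _ (by decide) (by decide), e₂ _ (by decide), hv]
      simp [NatExpr.eval, hv', ej, e A (by simp; omega), e s (by simp; omega),
        e aTY (by decide)]
  have b₃ : τ₃.row n aBest 0 = τ.row n aBest 0 :=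
    Mem.row_congr fun y _ => by rw [e₃ _ (by decide)]
  have v₃ : τ₃.nat aViol 0 0 = τ₂.nat aViol 0 0 := by rw [g₃ _ (by decide)]
  have ej : τ₃.nat aJ 0 0 = k := by rw [e₃ _ (by decide), hv]
  have hcond : (TestExpr.and (.and (.natLe (.var aViol) (.lit 0))
        (.natLe (.plus (.read aSY (.lit 0) (.var aJ)) (.read aSX (.lit 0) (.var aCur)))
          (.var aCost)))
        (.not (.realLe (.oracle aCand (.lit 0)) (.oracle aBest (.lit 0))))).Holds f τ₃ ↔
      (Fits k ∧ f (τ.row n aBest 0) < f (σ.row n A (σ.nat s 0 0) ∪ σ.row n aTY k)) := by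
    simp only [TestExpr.Holds, NatExpr.eval, RealExpr.eval, c₃, b₃, v₃, ej, not_le, Fits, ← v₂,
      f₃ aSY (by decide), f₃ aSX (by decide), f₃ aCur (by decide),
      f₃ aCost (by decide), Nat.le_zero]
  rw [denote_ite hcond]
  split_ifs with h1
  · rw [← c₃]
    refine Mem.row_congr fun y hy => ?_
    rw [denote_fillRow (by decide) (i₀ := 0) (val := fun y => τ₃.nat aCand 0 y)]
    · rw [f₃ aNY (by decide), hn]; simp [hy]
    · intro y _ υ hv' hfr' _ _
      simp [NatExpr.eval, hv', hfr' aCand (by decide) (by decide)]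
  · exact b₃

end Prog

/-! ### Choosing a candidate -/

namespace Prog

variable {n : ℕ} {f : Finset (Fin n) → ℝ}

/-- Copies the set found by `bestOf` to the row of `A` named by the scalar `s`. -/
def store (A s : ℕ) : Prog := fillRow aI aNY A (.var s) (.read aBest (.lit 0) (.var aI))

/-- Row `s` of `A` receives the result of `bestOf`; the other rows are unchanged. -/
theorem row_store {A s : ℕ} {σ : Mem} (hn : σ.nat aNY 0 0 = n) (hA : A ∉ [20, 42])
    (hs : s ∉ [20]) (hsA : s ≠ A) (i : ℕ) :
    (denote f (store A s) σ).row n A i =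
      if i = σ.nat s 0 0 then σ.row n aBest 0 else σ.row n A i := by
  simp only [List.mem_cons, List.not_mem_nil, or_false, not_or] at hA hs
  have key := denote_fillRow (f := f) (v := aI) (u := aNY) (A := A) (i := .var s)
    (e := .read aBest (.lit 0) (.var aI)) (σ := σ) (by omega) (i₀ := σ.nat s 0 0)
    (val := fun k => σ.nat aBest 0 k) (by
      intro k _ τ hv hfr _ _
      simp [NatExpr.eval, hv, hfr s (by omega) (by omega), hfr 42 (by omega) (by omega)])
  split_ifs with h
  · refine Mem.row_congr fun k hk => ?_
    rw [store, key, hn, if_pos ⟨h, hk⟩]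
  · refine Mem.row_congr fun k hk => ?_
    rw [store, key, if_neg (by tauto)]

/-- Computes the score of the candidate `cur`: the weighted total value, over all scenarios, of the
sets that it leads to. -/
def score : Prog :=
  real aAcc (.lit 0) (.lit 0) (.ofNat (.lit 0)) ;;
  forTo aS aRows
    (bestOf aReal aSel aS ;;
    real aAcc (.lit 0) (.lit 0) (.plus (.read aAcc (.lit 0) (.lit 0))
      (.times (.read aWt (.lit 0) (.var aS)) (.oracle aBest (.lit 0)))))

/-- The score of the candidate `q` in the state `σ`. -/
noncomputable def scoreOf (f : Finset (Fin n) → ℝ) (σ : Mem) (q : ℕ) : ℝ :=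
  ∑ s ∈ Finset.range (σ.nat aRows 0 0), σ.real aWt 0 s *
    f ((Tables.ofMem n σ).step f q (σ.row n aReal s) (σ.row n aSel s))

theorem scoreOf_congr {σ τ : Mem} (q : ℕ)
    (h : ∀ A ∈ [31, 32, 33, 34, 35, 37, 14, 18, 40, 41], τ.nat A = σ.nat A)
    (hr : τ.real aWt = σ.real aWt) : scoreOf f τ q = scoreOf f σ q := by
  have hrow : ∀ A ∈ [31, 32, 33, 34, 35, 37, 14, 18, 40, 41], ∀ i, τ.row n A i = σ.row n A i :=
    fun A hA i => Mem.row_congr fun j _ => by rw [h A hA]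
  rw [scoreOf, scoreOf, Tables.ofMem_congr (σ := σ) (τ := τ) fun A hA => h A (by
    simp only [List.mem_cons, List.not_mem_nil, or_false] at hA ⊢; omega), h 18 (by simp), hr]
  simp only [hrow 40 (by simp), hrow 41 (by simp)]

/-- The program `score` computes the score of the candidate named by the scalar `cur`. -/
theorem real_score {σ : Mem} (hn : σ.nat aNY 0 0 = n) :
    (denote f score σ).real aAcc 0 0 = scoreOf f σ (σ.nat aCur 0 0) := by
  rw [score, denote_seq]
  set σ₁ := denote f (real aAcc (.lit 0) (.lit 0) (.ofNat (.lit 0))) σ with hσ₁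
  have hnat : σ₁.nat = σ.nat := rfl
  have hre : ∀ A, A ≠ 2 → σ₁.real A = σ.real A := fun A hA =>
    denote_real_of_notMem (by simpa [realWrites] using hA) _
  rw [scoreOf, ← hnat]
  refine forTo_induction (f := f) (fun k τ => τ.real aAcc 0 0 =
    ∑ s ∈ Finset.range k, σ.real aWt 0 s * f ((Tables.ofMem n σ).step f (σ.nat aCur 0 0)
      (σ.row n aReal s) (σ.row n aSel s))) ?_ ?_
  · simp [hσ₁, denote, NatExpr.eval, RealExpr.eval, Mem.setReal_real]
  intro k hk τ hv hfr hfr' hP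
  have fr : ∀ A, A ∉ [20, 21, 23, 42, 43, 44] → τ.nat A = σ.nat A := fun A hA => by
    rw [← hnat]
    refine hfr A (by simp at hA; omega) ?_
    simp [writes, bestOf] at hA ⊢; omega
  have frw : ∀ A, A ∉ [20, 21, 23, 42, 43, 44] → ∀ i, τ.row n A i = σ.row n A i := fun A hA i =>
    Mem.row_congr fun j _ => by rw [fr A hA]
  have fr' : τ.real aWt = σ.real aWt := by
    rw [hfr' aWt (by decide), hre _ (by decide)]
  rw [Finset.sum_range_succ, ← hP, denote_seq, Mem.setNat_real]
  set τ₁ := denote f (bestOf aReal aSel aS) τ with hτ₁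
  have b₁ : τ₁.row n aBest 0 = (Tables.ofMem n σ).step f (σ.nat aCur 0 0)
      (σ.row n aReal k) (σ.row n aSel k) := by
    rw [hτ₁, row_bestOf (by rw [fr _ (by decide), hn]) (by decide) (by decide) (by decide),
      hv, frw _ (by decide), frw _ (by decide), fr aCur (by decide),
      Tables.ofMem_congr fun A hA => fr A (by simp at hA ⊢; omega)]
  have r₁ : ∀ A, τ₁.real A = τ.real A := fun A => denote_real_of_notMem (by decide +revert) _
  have s₁ : τ₁.nat aS 0 0 = k := by
    rw [hτ₁, denote_nat_of_notMem (by decide), hv]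
  simp [denote, RealExpr.eval, NatExpr.eval, Mem.setReal_real, b₁, r₁, s₁, fr']

/-- Determines the best candidate whose size is at most the cost of a round. -/
def pick : Prog :=
  real aMaxScore (.lit 0) (.lit 0) (.minus (.ofNat (.lit 0)) (.ofNat (.lit 1))) ;;
  nat aArgmax (.lit 0) (.lit 0) (.lit 0) ;;
  forTo aQ aCX
    (ite (.natLe (.read aSX (.lit 0) (.var aQ)) (.var aCost))
      (nat aCur (.lit 0) (.lit 0) (.var aQ) ;;
      score ;;
      ite (.realLe (.read aAcc (.lit 0) (.lit 0)) (.read aMaxScore (.lit 0) (.lit 0))) skip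
        (real aMaxScore (.lit 0) (.lit 0) (.read aAcc (.lit 0) (.lit 0)) ;;
        nat aArgmax (.lit 0) (.lit 0) (.var aQ)))
      skip)

/-- The candidate `q` is the best one in the state `σ`. -/
def IsBest (f : Finset (Fin n) → ℝ) (σ : Mem) (q : ℕ) : Prop :=
  q < (Tables.ofMem n σ).cX ∧ (Tables.ofMem n σ).sX q ≤ (Tables.ofMem n σ).cost ∧
    ∀ q' < (Tables.ofMem n σ).cX, (Tables.ofMem n σ).sX q' ≤ (Tables.ofMem n σ).cost →
      scoreOf f σ q' ≤ scoreOf f σ q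

/-- The candidate in row `0` has recorded size `0` and a nonnegative score. So the initial value
`-1` of the maximum is overwritten, and the result is an affordable candidate. -/
theorem isBest_pick {σ : Mem} (hn : σ.nat aNY 0 0 = n) (h0 : 0 < σ.nat aCX 0 0)
    (hs : σ.nat aSX 0 0 = 0) (hf : ∀ q, 0 ≤ scoreOf f σ q) :
    IsBest f σ ((denote f pick σ).nat aArgmax 0 0) := by
  rw [pick, denote_seq, denote_seq]
  set σ₁ := denote f (nat aArgmax (.lit 0) (.lit 0) (.lit 0)) (denote f (real aMaxScore (.lit 0)
    (.lit 0) (.minus (.ofNat (.lit 0)) (.ofNat (.lit 1)))) σ) with hσ₁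
  have hnat : ∀ A, A ≠ 46 → σ₁.nat A = σ.nat A := fun A hA =>
    denote_nat_of_notMem (by simpa [writes] using hA) _
  have hre : ∀ A, A ≠ 3 → σ₁.real A = σ.real A := fun A hA =>
    denote_real_of_notMem (p := real _ _ _ _) (by simpa [realWrites] using hA) _
  have key := forTo_induction (f := f) (σ := σ₁) (v := aQ) (u := aCX)
    (p := (ite (.natLe (.read aSX (.lit 0) (.var aQ)) (.var aCost))
      (nat aCur (.lit 0) (.lit 0) (.var aQ) ;;
      score ;;
      ite (.realLe (.read aAcc (.lit 0) (.lit 0)) (.read aMaxScore (.lit 0) (.lit 0))) skip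
        (real aMaxScore (.lit 0) (.lit 0) (.read aAcc (.lit 0) (.lit 0)) ;;
        nat aArgmax (.lit 0) (.lit 0) (.var aQ)))
      skip))
    (fun k τ => (k = 0 ∧ τ.real aMaxScore 0 0 = -1) ∨ (τ.nat aArgmax 0 0 < k ∧
      σ.nat aSX 0 (τ.nat aArgmax 0 0) ≤ σ.nat aCost 0 0 ∧
      τ.real aMaxScore 0 0 = scoreOf f σ (τ.nat aArgmax 0 0) ∧
      ∀ q < k, σ.nat aSX 0 q ≤ σ.nat aCost 0 0 → scoreOf f σ q ≤ τ.real aMaxScore 0 0)) ?_ ?_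
  · rw [hnat _ (by decide)] at key
    rcases key with ⟨h, -⟩ | ⟨h1, h2, h3, h4⟩
    · omega
    · exact ⟨h1, h2, fun q hq hq' => (h4 q hq hq').trans h3.le⟩
  · left
    simp [hσ₁, denote, NatExpr.eval, RealExpr.eval, Mem.setReal_real]
  intro k hk τ hv hfr hfr' hP
  have fr : ∀ A, A ∉ [20, 21, 22, 23, 42, 43, 44, 45, 46] → τ.nat A = σ.nat A := fun A hA => by
    rw [hfr A (by simp at hA; omega) (by simp [writes, bestOf, score] at hA ⊢; omega),
      hnat _ (by simp at hA; omega)]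
  have fr' : τ.real aWt = σ.real aWt := by
    rw [hfr' aWt (by decide), hre _ (by decide)]
  have hTest : (TestExpr.natLe (.read aSX (.lit 0) (.var aQ)) (.var aCost)).Holds f τ ↔
      σ.nat aSX 0 k ≤ σ.nat aCost 0 0 := by
    simp only [TestExpr.Holds, NatExpr.eval, hv, fr aSX (by decide), fr aCost (by decide)]
  rw [denote_ite hTest, Mem.setNat_nat_of_ne _ (by decide), Mem.setNat_real]
  split_ifs with hle
  · rw [denote_seq, denote_seq]
    set τ₁ := denote f (nat aCur (.lit 0) (.lit 0) (.var aQ)) τ with hτ₁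
    have c₁ : τ₁.nat aCur 0 0 = k := by
      simp [hτ₁, denote, NatExpr.eval, Mem.setNat_nat_self, hv]
    have g₁ : ∀ A, A ≠ 45 → τ₁.nat A = τ.nat A := fun A hA =>
      denote_nat_of_notMem (by simpa [writes] using hA) _
    set τ₂ := denote f score τ₁ with hτ₂
    have a₂ : τ₂.real aAcc 0 0 = scoreOf f σ k := by
      rw [hτ₂, real_score (by rw [g₁ _ (by decide), fr _ (by decide), hn]), c₁]
      refine scoreOf_congr k (fun A hA => ?_) fr'
      simp only [List.mem_cons, List.not_mem_nil, or_false] at hA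
      rw [g₁ _ (by omega), fr A (by simp; omega)]
    have m₂ : τ₂.real aMaxScore = τ.real aMaxScore := by
      rw [hτ₂, denote_real_of_notMem (by decide)]; rfl
    have n₂ : τ₂.nat aArgmax = τ.nat aArgmax := by
      rw [hτ₂, denote_nat_of_notMem (by decide), g₁ _ (by decide)]
    have q₂ : τ₂.nat aQ 0 0 = k := by
      rw [hτ₂, denote_nat_of_notMem (by decide), g₁ _ (by decide), hv]
    have hTest₂ : (TestExpr.realLe (.read aAcc (.lit 0) (.lit 0))
        (.read aMaxScore (.lit 0) (.lit 0))).Holds f τ₂ ↔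
        scoreOf f σ k ≤ τ.real aMaxScore 0 0 := by
      simp only [TestExpr.Holds, NatExpr.eval, RealExpr.eval, a₂, m₂]
    rw [denote_ite hTest₂]
    split_ifs with hsc
    · right
      simp only [denote]
      rw [m₂, n₂]
      rcases hP with ⟨rfl, h⟩ | ⟨h1, h2, h3, h4⟩
      · have := hf 0; linarith
      · refine ⟨by omega, h2, h3, fun q hq hq' => ?_⟩
        rcases Nat.lt_succ_iff_lt_or_eq.1 hq with h | rfl
        · exact h4 q h hq'
        · exact hsc
    · right
      have e1 : (denote f (real aMaxScore (.lit 0) (.lit 0) (.read aAcc (.lit 0) (.lit 0)) ;;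
        nat aArgmax (.lit 0) (.lit 0) (.var aQ)) τ₂).nat aArgmax 0 0 = k := by
        simp [denote, NatExpr.eval, Mem.setNat_nat_self, q₂]
      have e2 : (denote f (real aMaxScore (.lit 0) (.lit 0) (.read aAcc (.lit 0) (.lit 0)) ;;
        nat aArgmax (.lit 0) (.lit 0) (.var aQ)) τ₂).real aMaxScore 0 0 = scoreOf f σ k := by
        simp [denote, NatExpr.eval, RealExpr.eval, Mem.setReal_real, a₂]
      rw [e1, e2]
      refine ⟨by omega, hle, rfl, fun q hq hq' => ?_⟩
      rcases Nat.lt_succ_iff_lt_or_eq.1 hq with h | rfl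
      · rcases hP with ⟨rfl, -⟩ | ⟨-, -, -, h4⟩
        · omega
        · exact (h4 q h hq').trans (not_le.1 hsc).le
      · exact le_rfl
  · simp only [denote]
    rcases hP with ⟨rfl, h⟩ | ⟨h1, h2, h3, h4⟩
    · exact absurd (by rw [hs]; exact Nat.zero_le _) hle
    · refine .inr ⟨by omega, h2, h3, fun q hq hq' => ?_⟩
      rcases Nat.lt_succ_iff_lt_or_eq.1 hq with h | rfl
      · exact h4 q h hq'
      · exact absurd hq' hle

end Prog

/-! ### The rounds of the two stages -/

namespace Prog

variable {n : ℕ} {f : Finset (Fin n) → ℝ}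

/-- One round: the best candidate is recorded, its nodes are added to the first stage, and the sets
selected in the scenarios are updated. -/
def round : Prog :=
  pick ;;
  nat aHist (.lit 0) (.var aR) (.var aArgmax) ;;
  nat aCur (.lit 0) (.lit 0) (.var aArgmax) ;;
  fillRow aI aNX aFirst (.lit 0)
    (.plus (.read aFirst (.lit 0) (.var aI)) (.read aTX (.var aCur) (.var aI))) ;;
  forTo aS aRows (bestOf aReal aSel aS ;; store aSel aS)

/-- The rounds of the first stage. -/
def plan : Prog := forTo aR aRounds round

/-- The rounds of the second stage. -/
def respond : Prog :=
  forTo aR aRounds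
    (nat aCur (.lit 0) (.lit 0) (.read aHist (.lit 0) (.var aR)) ;;
    bestOf aRevealed aSecond aZero ;;
    store aSecond aZero)

/-- After a round, every scenario holds the set that `Tables.step` selects there. -/
theorem row_updateAll {σ : Mem} (hn : σ.nat aNY 0 0 = n) {s : ℕ} (hs : s < σ.nat aRows 0 0) :
    (denote f (forTo aS aRows (bestOf aReal aSel aS ;; store aSel aS)) σ).row n aSel s =
      (Tables.ofMem n σ).step f (σ.nat aCur 0 0) (σ.row n aReal s) (σ.row n aSel s) := by
  have key : ∀ s, (denote f (forTo aS aRows (bestOf aReal aSel aS ;; store aSel aS)) σ).row n aSel s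
      = if s < σ.nat aRows 0 0 then
        (Tables.ofMem n σ).step f (σ.nat aCur 0 0) (σ.row n aReal s) (σ.row n aSel s) else
        σ.row n aSel s := by
    refine forTo_induction (f := f) (fun k τ => ∀ s, τ.row n aSel s = if s < k then
        (Tables.ofMem n σ).step f (σ.nat aCur 0 0) (σ.row n aReal s) (σ.row n aSel s) else
        σ.row n aSel s) ?_ ?_
    · intro s
      rw [if_neg (by omega)]
      exact Mem.row_congr fun y _ => by rw [Mem.setNat_nat_of_ne _ (by decide)]
    intro k hk τ hv hfr _ hP s
    have fr : ∀ A, A ∉ [20, 21, 23, 41, 42, 43, 44] → τ.nat A = σ.nat A := fun A hA =>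
      hfr A (by simp at hA; omega) (by simp [writes, bestOf, store] at hA ⊢; omega)
    have frw : ∀ A, A ∉ [20, 21, 23, 41, 42, 43, 44] → ∀ i, τ.row n A i = σ.row n A i :=
      fun A hA i => Mem.row_congr fun j _ => by rw [fr A hA]
    have hset : ∀ (τ : Mem) v, (τ.setNat aS 0 0 v).row n aSel s = τ.row n aSel s :=
      fun τ v => Mem.row_congr fun k _ => by rw [Mem.setNat_nat_of_ne _ (by decide)]
    have hn' : τ.nat aNY 0 0 = n := by rw [fr _ (by decide), hn]
    rw [hset, denote_seq, row_store (by rw [denote_nat_of_notMem (by decide), hn']) (by decide)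
      (by decide) (by decide), row_bestOf hn' (by decide) (by decide) (by decide),
      denote_nat_of_notMem (by decide), hv, row_denote (by decide), hP, hP, frw _ (by decide),
      fr aCur (by decide), Tables.ofMem_congr fun A hA => fr A (by simp at hA ⊢; omega)]
    split_ifs <;> first | omega | (subst_vars; rfl)
  rw [key, if_pos hs]

/-- The union of the candidates `h 0, …, h (k - 1)` in the table of sets of first-stage nodes. -/
def unionTX (m : ℕ) (σ : Mem) (h : ℕ → ℕ) (k : ℕ) : Finset (Fin m) :=
  (Finset.range k).biUnion fun i => σ.row m aTX (h i)

/-- The first stage consists of the candidates recorded in the history, and in every round the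
recorded candidate maximizes the weighted value of the sets selected after the round, given the
previous rounds. -/
theorem plan_spec {m : ℕ} {σ : Mem} (hm : σ.nat aNX 0 0 = m) (hn : σ.nat aNY 0 0 = n)
    (h0 : 0 < σ.nat aCX 0 0) (hs : σ.nat aSX 0 0 = 0)
    (hf : ∀ A, 0 ≤ f A) (hw : ∀ s, 0 ≤ σ.real aWt 0 s)
    (hsel : ∀ s, σ.row n aSel s = ∅) (hfirst : σ.row m aFirst 0 = ∅) {h : ℕ → ℕ}
    (hh : h = (denote f plan σ).nat aHist 0) :
    (denote f plan σ).row m aFirst 0 = unionTX m σ h (σ.nat aRounds 0 0) ∧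
    ∀ k < σ.nat aRounds 0 0, h k < (Tables.ofMem n σ).cX ∧
      (Tables.ofMem n σ).sX (h k) ≤ (Tables.ofMem n σ).cost ∧
      ∀ q < (Tables.ofMem n σ).cX, (Tables.ofMem n σ).sX q ≤ (Tables.ofMem n σ).cost →
        ∑ s ∈ Finset.range (σ.nat aRows 0 0), σ.real aWt 0 s * f ((Tables.ofMem n σ).step f q
          (σ.row n aReal s) ((Tables.ofMem n σ).sim f h (σ.row n aReal s) k)) ≤
        ∑ s ∈ Finset.range (σ.nat aRows 0 0), σ.real aWt 0 s * f ((Tables.ofMem n σ).sim f h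
          (σ.row n aReal s) (k + 1)) := by
  subst hh
  set T := Tables.ofMem n σ with hT
  let P : ℕ → Mem → Prop := fun K τ =>
    τ.row m aFirst 0 = unionTX m σ (τ.nat aHist 0) K ∧
    (∀ s < σ.nat aRows 0 0, τ.row n aSel s = T.sim f (τ.nat aHist 0) (σ.row n aReal s) K) ∧
    ∀ k < K, τ.nat aHist 0 k < T.cX ∧ T.sX (τ.nat aHist 0 k) ≤ T.cost ∧
      ∀ q < T.cX, T.sX q ≤ T.cost →
        ∑ s ∈ Finset.range (σ.nat aRows 0 0), σ.real aWt 0 s *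
          f (T.step f q (σ.row n aReal s) (T.sim f (τ.nat aHist 0) (σ.row n aReal s) k)) ≤
        ∑ s ∈ Finset.range (σ.nat aRows 0 0), σ.real aWt 0 s *
          f (T.sim f (τ.nat aHist 0) (σ.row n aReal s) (k + 1))
  have key : P (σ.nat aRounds 0 0) (denote f plan σ) := by
    refine forTo_induction (f := f) P ?_ ?_
    · refine ⟨?_, fun s _ => ?_, fun k hk => absurd hk (by omega)⟩
      · rw [unionTX, Finset.range_zero, Finset.biUnion_empty, ← hfirst]
        exact Mem.row_congr fun y _ => by rw [Mem.setNat_nat_of_ne _ (by decide)]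
      · rw [Tables.sim, ← hsel s]
        exact Mem.row_congr fun y _ => by rw [Mem.setNat_nat_of_ne _ (by decide)]
    intro K hK τ hv hfr hfr' hP
    obtain ⟨hP1, hP2, hP3⟩ := hP
    have fr : ∀ A, A ∉ [2, 20, 21, 22, 23, 24, 41, 42, 43, 44, 45, 46, 47] →
        τ.nat A = σ.nat A := fun A hA =>
      hfr A (by simp at hA; omega)
        (by simp [round, pick, score, writes, bestOf, store] at hA ⊢; omega)
    have frw : ∀ m A, A ∉ [2, 20, 21, 22, 23, 24, 41, 42, 43, 44, 45, 46, 47] →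
        ∀ i, τ.row m A i = σ.row m A i := fun m A hA i => Mem.row_congr fun j _ => by rw [fr A hA]
    have fr' : τ.real aWt = σ.real aWt := hfr' aWt (by decide)
    have hTτ : Tables.ofMem n τ = T := Tables.ofMem_congr fun A hA => fr A (by simp at hA ⊢; omega)
    have hscore : ∀ q, scoreOf f τ q = ∑ s ∈ Finset.range (σ.nat aRows 0 0), σ.real aWt 0 s *
          f (T.step f q (σ.row n aReal s) (T.sim f (τ.nat aHist 0) (σ.row n aReal s) K)) := by
      intro q
      rw [scoreOf, hTτ, fr aRows (by decide), fr']
      refine Finset.sum_congr rfl fun s hs => ?_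
      rw [hP2 s (Finset.mem_range.1 hs), frw _ _ (by decide)]
    have hbest := isBest_pick (f := f) (σ := τ) (by rw [fr _ (by decide), hn])
      (by rwa [fr _ (by decide)]) (by rwa [fr _ (by decide)]) (fun q => Finset.sum_nonneg fun s _ =>
        mul_nonneg (by rw [fr']; exact hw s) (hf _))
    rw [IsBest, hTτ] at hbest
    simp only [hscore] at hbest
    rw [round, denote_seq, denote_seq, denote_seq, denote_seq]
    set τ₁ := denote f pick τ with hτ₁
    set q₀ := τ₁.nat aArgmax 0 0 with hq₀
    have g₁ : ∀ A, A ∉ [20, 21, 22, 23, 42, 43, 44, 45, 46] → τ₁.nat A = τ.nat A := fun A hA =>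
      denote_nat_of_notMem (by simp [pick, score, writes, bestOf] at hA ⊢; omega) _
    set τ₂ := denote f (nat aHist (.lit 0) (.var aR) (.var aArgmax)) τ₁ with hτ₂
    have g₂ : ∀ A, A ≠ 47 → τ₂.nat A = τ₁.nat A := fun A hA =>
      denote_nat_of_notMem (by simpa [writes] using hA) _
    have h₂ : ∀ k, τ₂.nat aHist 0 k = if k = K then q₀ else τ.nat aHist 0 k := by
      intro k
      have : τ₁.nat aR 0 0 = K := by rw [g₁ _ (by decide), hv]
      rw [hτ₂, denote, Mem.setNat_nat]
      simp only [NatExpr.eval, this, ← hq₀, true_and]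
      rw [g₁ _ (by decide)]
    set τ₃ := denote f (nat aCur (.lit 0) (.lit 0) (.var aArgmax)) τ₂ with hτ₃
    have g₃ : ∀ A, A ≠ 45 → τ₃.nat A = τ₂.nat A := fun A hA =>
      denote_nat_of_notMem (by simpa [writes] using hA) _
    have c₃ : τ₃.nat aCur 0 0 = q₀ := by
      rw [hτ₃, denote]
      simp only [NatExpr.eval, Mem.setNat_nat_self]
      rw [g₂ _ (by decide)]
    set τ₄ := denote f (fillRow aI aNX aFirst (.lit 0)
      (.plus (.read aFirst (.lit 0) (.var aI)) (.read aTX (.var aCur) (.var aI)))) τ₃ with hτ₄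
    have g₄ : ∀ A, A ∉ [2, 20] → τ₄.nat A = τ₃.nat A := fun A hA =>
      denote_nat_of_notMem (by simp [writes] at hA ⊢; omega) _
    have e₃ : ∀ A, A ∉ [20, 21, 22, 23, 42, 43, 44, 45, 46, 47] → τ₃.nat A = τ.nat A := by
      intro A hA
      rw [g₃ _ (by simp at hA; omega), g₂ _ (by simp at hA; omega), g₁ _ (by simp at hA ⊢; omega)]
    have e₄ : ∀ A, A ∉ [2, 20, 21, 22, 23, 42, 43, 44, 45, 46, 47] → τ₄.nat A = τ.nat A := by
      intro A hA
      rw [g₄ _ (by simp at hA ⊢; omega), e₃ _ (by simp at hA ⊢; omega)]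
    have f₄ : τ₄.row m aFirst 0 = τ.row m aFirst 0 ∪ σ.row m aTX q₀ := by
      ext x
      rw [hτ₄, Mem.mem_row, denote_fillRow (by decide) (i₀ := 0)
        (val := fun x => τ.nat aFirst 0 x + σ.nat aTX q₀ x)]
      · rw [e₃ aNX (by decide), fr aNX (by decide), hm, Finset.mem_union, Mem.mem_row, Mem.mem_row]
        simp only [x.2, and_self, if_true]
        omega
      · intro j _ υ hv' hfr' _ hA
        have e : ∀ B, B ≠ 20 → B ≠ 2 → υ.nat B = τ₃.nat B := hfr'
        rw [e₃ aFirst (by decide)] at hA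
        simp only [NatExpr.eval, hv', hA, e aTX (by decide) (by decide), e aCur (by decide)
          (by decide), c₃, e₃ aTX (by decide), fr aTX (by decide), and_self]
    have s₄ : ∀ s, τ₄.row n aSel s = τ.row n aSel s := fun s =>
      Mem.row_congr fun j _ => by rw [e₄ _ (by decide)]
    have cur₄ : τ₄.nat aCur 0 0 = q₀ := by rw [g₄ _ (by decide), c₃]
    set τ₅ := denote f (forTo aS aRows (bestOf aReal aSel aS ;; store aSel aS)) τ₄ with hτ₅
    have h₅ : ∀ k, (τ₅.setNat aR 0 0 (K + 1)).nat aHist 0 k =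
        if k = K then q₀ else τ.nat aHist 0 k := fun k => by
      rw [Mem.setNat_nat_of_ne _ (by decide), hτ₅, denote_nat_of_notMem (by decide),
        g₄ _ (by decide), g₃ _ (by decide), h₂]
    have hT₄ : Tables.ofMem n τ₄ = T := by
      rw [← hTτ]; exact Tables.ofMem_congr fun A hA => e₄ A (by simp at hA ⊢; omega)
    have hsim : ∀ R k, k ≤ K → T.sim f ((τ₅.setNat aR 0 0 (K + 1)).nat aHist 0) R k =
        T.sim f (τ.nat aHist 0) R k := fun R k hk =>
      T.sim_congr f R fun i hi => by rw [h₅, if_neg (by omega)]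
    have hsim' : ∀ R, T.sim f ((τ₅.setNat aR 0 0 (K + 1)).nat aHist 0) R (K + 1) =
        T.step f q₀ R (T.sim f (τ.nat aHist 0) R K) := fun R => by
      rw [Tables.sim, hsim R K le_rfl, h₅, if_pos rfl]
    refine ⟨?_, fun s hs => ?_, fun k hk => ?_⟩
    · rw [unionTX, Finset.range_add_one, Finset.biUnion_insert, h₅, if_pos rfl]
      have : (Finset.range K).biUnion (fun i => σ.row m aTX
          ((τ₅.setNat aR 0 0 (K + 1)).nat aHist 0 i)) = τ.row m aFirst 0 := by
        rw [hP1, unionTX]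
        refine Finset.biUnion_congr rfl fun i hi => ?_
        rw [h₅, if_neg (by have := Finset.mem_range.1 hi; omega)]
      rw [this, Finset.union_comm, ← f₄]
      refine Mem.row_congr fun j _ => ?_
      rw [Mem.setNat_nat_of_ne _ (by decide), hτ₅, denote_nat_of_notMem (by decide)]
    · rw [hsim']
      have : (τ₅.setNat aR 0 0 (K + 1)).row n aSel s = τ₅.row n aSel s :=
        Mem.row_congr fun j _ => by rw [Mem.setNat_nat_of_ne _ (by decide)]
      rw [this, hτ₅, row_updateAll (by rw [e₄ _ (by decide), fr _ (by decide), hn])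
        (by rwa [e₄ _ (by decide), fr _ (by decide)]), hT₄, cur₄, s₄, hP2 s hs]
      congr 1
      exact Mem.row_congr fun j _ => by rw [e₄ _ (by decide), fr _ (by decide)]
    · rcases Nat.lt_succ_iff_lt_or_eq.1 hk with hk | rfl
      · simp only [hsim _ k hk.le, hsim _ (k + 1) hk]
        rw [h₅, if_neg (by omega)]
        exact hP3 k hk
      · simp only [hsim', hsim _ k le_rfl]
        rw [h₅, if_pos rfl]
        exact hbest
  exact ⟨key.1, key.2.2⟩

/-- The second stage replays the recorded candidates in the revealed scenario, in the same way as
the plan simulated it. -/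
theorem respond_spec {σ : Mem} (hn : σ.nat aNY 0 0 = n) (hz : σ.nat aZero 0 0 = 0)
    (hsec : σ.row n aSecond 0 = ∅) :
    (denote f respond σ).row n aSecond 0 = (Tables.ofMem n σ).sim f (σ.nat aHist 0)
      (σ.row n aRevealed 0) (σ.nat aRounds 0 0) := by
  refine forTo_induction (f := f) (fun k τ => τ.row n aSecond 0 =
    (Tables.ofMem n σ).sim f (σ.nat aHist 0) (σ.row n aRevealed 0) k) ?_ ?_
  · rw [Tables.sim, ← hsec]
    exact Mem.row_congr fun y _ => by rw [Mem.setNat_nat_of_ne _ (by decide)]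
  intro k hk τ hv hfr _ hP
  have fr : ∀ A, A ∉ [4, 20, 21, 24, 42, 43, 44, 45] → τ.nat A = σ.nat A := fun A hA =>
    hfr A (by simp at hA; omega) (by simp [writes, bestOf, store] at hA ⊢; omega)
  have hset : ∀ (τ : Mem) v, (τ.setNat aR 0 0 v).row n aSecond 0 = τ.row n aSecond 0 :=
    fun τ v => Mem.row_congr fun k _ => by rw [Mem.setNat_nat_of_ne _ (by decide)]
  rw [hset, denote_seq, denote_seq]
  set τ₁ := denote f (nat aCur (.lit 0) (.lit 0) (.read aHist (.lit 0) (.var aR))) τ with hτ₁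
  have g₁ : ∀ A, A ≠ 45 → τ₁.nat A = τ.nat A := fun A hA =>
    denote_nat_of_notMem (by simpa [writes] using hA) _
  have e₁ : ∀ A, A ∉ [4, 20, 21, 24, 42, 43, 44, 45] → τ₁.nat A = σ.nat A := fun A hA => by
    rw [g₁ _ (by simp at hA; omega), fr A hA]
  have c₁ : τ₁.nat aCur 0 0 = σ.nat aHist 0 k := by
    simp [hτ₁, denote, NatExpr.eval, Mem.setNat_nat_self, hv, fr aHist (by decide)]
  have hn' : τ₁.nat aNY 0 0 = n := by rw [e₁ _ (by decide), hn]
  have hz' : τ₁.nat aZero 0 0 = 0 := by rw [e₁ _ (by decide), hz]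
  rw [row_store (by rw [denote_nat_of_notMem (by decide), hn']) (by decide) (by decide) (by decide),
    denote_nat_of_notMem (by decide), hz', if_pos rfl,
    row_bestOf hn' (by decide) (by decide) (by decide), c₁, hz', Tables.sim, ← hP,
    Tables.ofMem_congr fun A hA => e₁ A (by simp at hA ⊢; omega)]
  congr 1
  · exact Mem.row_congr fun j _ => by rw [e₁ _ (by decide)]

end Prog

/-! ### Tables of small sets -/

namespace Prog

variable {n : ℕ} {f : Finset (Fin n) → ℝ}

/-- Appends the set in row `q` of the table `t`, with the element `j` added, to the table `t` of
subsets of a set with `u` elements; the array `s` holds the sizes and the scalar `c` the length of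
the table. -/
def append (t s c u : ℕ) : Prog :=
  fillRow aI u t (.var c) (.read t (.var aQ) (.var aI)) ;;
  nat t (.var c) (.var aJ) (.lit 1) ;;
  nat s (.lit 0) (.var c) (.plus (.read s (.lit 0) (.var aQ)) (.lit 1)) ;;
  nat c (.lit 0) (.lit 0) (.plus (.var c) (.lit 1))

/-- Appends all sets that arise from a set in the table by adding an element. -/
def grow (t s c u : ℕ) : Prog :=
  nat aOld (.lit 0) (.lit 0) (.var c) ;;
  forTo aQ aOld (forTo aJ u (append t s c u))

/-- Appends `p` to itself, `k` times in total. -/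
def rep (p : Prog) : ℕ → Prog
  | 0 => skip
  | k + 1 => rep p k ;; p

/-- A table of all sets of at most `k` elements. -/
def table (t s c u k : ℕ) : Prog :=
  nat c (.lit 0) (.lit 0) (.lit 1) ;; rep (grow t s c u) k

/-- The effect of `append`: the new set is stored in the row after the last one. -/
theorem append_spec {t s c u : ℕ} (hd : [20, 21, 22, 36, t, s, c, u].Nodup) {σ : Mem} {N k : ℕ}
    {y : Fin N} (hN : σ.nat u 0 0 = N) (hk : σ.nat aQ 0 0 = k) (hy : σ.nat aJ 0 0 = y)
    (hkc : k ≠ σ.nat c 0 0) {τ : Mem} (hτ : τ = denote f (append t s c u) σ) :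
    τ.nat c 0 0 = σ.nat c 0 0 + 1 ∧
    (∀ i, τ.row N t i =
      if i = σ.nat c 0 0 then insert y (σ.row N t k) else σ.row N t i) ∧
    (∀ i, τ.nat s 0 i = if i = σ.nat c 0 0 then σ.nat s 0 k + 1 else σ.nat s 0 i) := by
  simp only [List.nodup_cons, List.mem_cons, List.not_mem_nil, or_false, not_or] at hd
  set σ₁ := denote f (fillRow aI u t (.var c) (.read t (.var aQ) (.var aI))) σ with hσ₁
  have g₁ : ∀ A, A ≠ 20 → A ≠ t → σ₁.nat A = σ.nat A := fun A h1 h2 =>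
    denote_nat_of_notMem (by simp [writes, h1, h2]) _
  have key : ∀ i' j', σ₁.nat t i' j' = if i' = σ.nat c 0 0 ∧ j' < σ.nat u 0 0 then σ.nat t k j'
      else σ.nat t i' j' := by
    -- row `k` is read while row `c ≠ k` is written, so the invariant has to cover all rows
    refine (forTo_induction (f := f) (v := aI) (u := u) (σ := σ)
      (p := nat t (.var c) (.var aI) (.read t (.var aQ) (.var aI)))
      (fun m τ => ∀ i' j', τ.nat t i' j' = if i' = σ.nat c 0 0 ∧ j' < m then σ.nat t k j'
      else σ.nat t i' j') ?_ ?_)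
    · intro i' j'
      rw [Mem.setNat_nat_of_ne _ (by omega), if_neg (by omega)]
    · intro m hm τ hv hfr _ hP i' j'
      have ec : τ.nat c = σ.nat c := hfr c (by omega) (by simp [writes]; omega)
      have eq : τ.nat aQ = σ.nat aQ := hfr aQ (by omega) (by simp [writes]; omega)
      rw [Mem.setNat_nat_of_ne _ (by omega), denote, Mem.setNat_nat]
      simp only [NatExpr.eval, ec, eq, hv, hk, hP, hkc, false_and, if_false]
      by_cases h3 : i' = σ.nat c 0 0 <;> by_cases h4 : j' = m <;> by_cases h5 : j' < m <;>
        simp [h3, h4, h5] <;> intro h6 <;> omega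
  have c₁ : σ₁.nat c 0 0 = σ.nat c 0 0 := by rw [g₁ c (by omega) (by omega)]
  have j₁ : σ₁.nat aJ 0 0 = y := by rw [g₁ aJ (by omega) (by omega), hy]
  have q₁ : σ₁.nat aQ 0 0 = k := by rw [g₁ aQ (by omega) (by omega), hk]
  have s₁ : σ₁.nat s = σ.nat s := g₁ s (by omega) (by omega)
  rw [append, denote_seq, denote_seq, denote_seq, ← hσ₁] at hτ
  have hts : t ≠ s := by omega
  have htc : t ≠ c := by omega
  have hsc : s ≠ c := by omega
  have hqt : 22 ≠ t := by omega
  have hct : c ≠ t := by omega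
  have hcs : c ≠ s := by omega
  have hst : s ≠ t := by omega
  have hτt : ∀ i j, τ.nat t i j = if i = σ.nat c 0 0 ∧ j = y then 1 else σ₁.nat t i j := by
    intro i j
    rw [hτ]
    simp only [denote, NatExpr.eval, Mem.setNat_nat, c₁, j₁, hts, htc, false_and, if_false,
      true_and]
  have hτs : ∀ i, τ.nat s 0 i = if i = σ.nat c 0 0 then σ.nat s 0 k + 1 else σ.nat s 0 i := by
    intro i
    rw [hτ]
    simp only [denote, NatExpr.eval, Mem.setNat_nat, c₁, q₁, hsc, hst, hqt, hcs, hct, false_and,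
      if_false, true_and, s₁]
  have hτc : τ.nat c 0 0 = σ.nat c 0 0 + 1 := by
    rw [hτ]
    simp [denote, NatExpr.eval, Mem.setNat_nat, c₁, hct, hcs]
  refine ⟨hτc, fun i => ?_, hτs⟩
  ext z
  rw [Mem.mem_row, hτt]
  by_cases h3 : i = σ.nat c 0 0
  · rw [if_pos h3, Finset.mem_insert, Mem.mem_row, key, h3, hN]
    by_cases h4 : z = y
    · simp [h4]
    · have : ¬ (z : ℕ) = y := fun h => h4 (Fin.ext h)
      simp [h4, this]
  · rw [if_neg h3, if_neg (by tauto), key, if_neg (by tauto), Mem.mem_row]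

/-- The table consists of sets whose sizes are at most those recorded, and contains all sets of at
most `k` elements, with their sizes. -/
structure IsTable (σ : Mem) (t s c N k : ℕ) : Prop where
  pos : 0 < σ.nat c 0 0
  size_zero : σ.nat s 0 0 = 0
  card_le : ∀ q < σ.nat c 0 0, (σ.row N t q).card ≤ σ.nat s 0 q
  exists_row : ∀ T : Finset (Fin N), T.card ≤ k → ∃ q < σ.nat c 0 0, σ.row N t q = T ∧
    σ.nat s 0 q = T.card
  length_eq : σ.nat c 0 0 = (N + 1) ^ k

/-- If the table has `c₀` rows, then the set in row `q` with the element `y` added is stored in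
row `c₀ + (q * N + y)`. All sets of at most `k + 1` elements occur, since a nonempty one arises
from a set of at most `k` elements. -/
theorem grow_spec {t s c u : ℕ} (hd : [20, 21, 22, 36, t, s, c, u].Nodup) {σ : Mem} {N k : ℕ}
    (hN : σ.nat u 0 0 = N) (h : IsTable σ t s c N k) :
    IsTable (denote f (grow t s c u) σ) t s c N (k + 1) := by
  have hd' := hd
  simp only [List.nodup_cons, List.mem_cons, List.not_mem_nil, or_false, not_or] at hd
  set c₀ := σ.nat c 0 0 with hc₀
  set σ₁ := denote f (nat aOld (.lit 0) (.lit 0) (.var c)) σ with hσ₁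
  have g₁ : ∀ A, A ≠ 36 → σ₁.nat A = σ.nat A := fun A hA =>
    denote_nat_of_notMem (by simpa [writes] using hA) _
  have o₁ : σ₁.nat aOld 0 0 = c₀ := by
    simp [hσ₁, denote, NatExpr.eval, Mem.setNat_nat, hc₀]
  have r₁ : ∀ i, σ₁.row N t i = σ.row N t i := fun i =>
    Mem.row_congr fun j _ => by rw [g₁ t (by omega)]
  -- the invariant after `m` sets have been appended
  let P : ℕ → Mem → Prop := fun m τ => τ.nat c 0 0 = c₀ + m ∧
    (∀ i < c₀, τ.row N t i = σ.row N t i ∧ τ.nat s 0 i = σ.nat s 0 i) ∧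
    ∀ a, ∀ y : Fin N, a * N + y < m → τ.row N t (c₀ + (a * N + y)) = insert y (σ.row N t a) ∧
      τ.nat s 0 (c₀ + (a * N + y)) = σ.nat s 0 a + 1
  have P_set : ∀ {m τ} v x, (v = 21 ∨ v = 22) → P m τ → P m (τ.setNat v 0 0 x) := by
    rintro m τ v x hv ⟨h1, h2, h3⟩
    have e : ∀ A, A ≠ v → (τ.setNat v 0 0 x).nat A = τ.nat A := fun A hA =>
      Mem.setNat_nat_of_ne _ hA _ _ _
    have er : ∀ i, (τ.setNat v 0 0 x).row N t i = τ.row N t i := fun i =>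
      Mem.row_congr fun j _ => by rw [e t (by omega)]
    refine ⟨by rw [e c (by omega), h1], fun i hi => ?_, fun a y hay => ?_⟩
    · rw [er, e s (by omega)]; exact h2 i hi
    · rw [er, e s (by omega)]; exact h3 a y hay
  have key : P (c₀ * N) (denote f (forTo aQ aOld (forTo aJ u (append t s c u))) σ₁) := by
    have := forTo_induction (f := f) (σ := σ₁) (v := aQ) (u := aOld)
      (p := forTo aJ u (append t s c u)) (fun a τ => P (a * N) τ) ?_ ?_
    · rwa [o₁] at this
    · refine P_set _ _ (.inr rfl) ?_
      rw [zero_mul]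
      refine ⟨by rw [g₁ c (by omega), add_zero], fun i _ => ?_, fun a y h => absurd h (by omega)⟩
      rw [r₁, g₁ s (by omega)]; exact ⟨rfl, rfl⟩
    intro a ha τ hv hfr _ hP
    rw [o₁] at ha
    have hu : τ.nat u 0 0 = N := by
      rw [hfr u (by omega) (by simp [writes, append]; omega), g₁ u (by omega), hN]
    refine P_set _ _ (.inr rfl) ?_
    have := forTo_induction (f := f) (σ := τ) (v := aJ) (u := u)
      (p := append t s c u) (fun b τ => P (a * N + b) τ) ?_ ?_
    · rw [hu] at this
      rwa [Nat.succ_mul]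
    · exact P_set _ _ (.inl rfl) hP
    intro b hb υ hv' hfr' _ hP'
    rw [hu] at hb
    refine P_set _ _ (.inl rfl) ?_
    obtain ⟨h1, h2, h3⟩ := hP'
    have hq : υ.nat aQ 0 0 = a := by
      rw [hfr' aQ (by omega) (by simp [writes, append]; omega), hv]
    have hu' : υ.nat u 0 0 = N := by
      rw [hfr' u (by omega) (by simp [writes, append]; omega), hu]
    obtain ⟨e1, e2, e3⟩ := append_spec (f := f) hd' (y := ⟨b, hb⟩) hu' hq hv'
      (by rw [h1]; omega) rfl
    refine ⟨by rw [e1, h1]; ring, fun i hi => ?_, fun a' y hay => ?_⟩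
    · rw [e2, e3, h1, if_neg (by omega), if_neg (by omega)]; exact h2 i hi
    · rw [e2, e3, h1]
      rcases Nat.lt_succ_iff_lt_or_eq.1 (show a' * N + y < a * N + b + 1 from hay) with hlt | heq
      · rw [if_neg (by omega), if_neg (by omega)]; exact h3 a' y hlt
      · have hy := y.2
        have haa : a' = a := by
          have h1 : (a' * N + y) / N = a' := by
            rw [mul_comm, Nat.mul_add_div (by omega), Nat.div_eq_of_lt hy, add_zero]
          have h2 : (a * N + b) / N = a := by
            rw [mul_comm, Nat.mul_add_div (by omega), Nat.div_eq_of_lt hb, add_zero]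
          rw [← h1, heq, h2]
        subst haa
        have hyb : y = ⟨b, hb⟩ := Fin.ext (by simpa using heq)
        rw [heq, if_pos rfl, if_pos rfl, (h2 a' ha).1, (h2 a' ha).2, hyb]
        exact ⟨rfl, rfl⟩
  obtain ⟨k1, k2, k3⟩ := key
  rw [grow, denote_seq, ← hσ₁]
  set τ := denote f (forTo aQ aOld (forTo aJ u (append t s c u))) σ₁
  have hlen : τ.nat c 0 0 = c₀ + c₀ * N := k1
  have hdecomp : ∀ q, c₀ ≤ q → q < c₀ + c₀ * N → ∃ a < c₀, ∃ y : Fin N, q = c₀ + (a * N + y) ∧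
      a * N + y < c₀ * N := by
    intro q h1 h2
    have hN0 : 0 < N := by
      rcases Nat.eq_zero_or_pos N with h | h
      · subst h; omega
      · exact h
    refine ⟨(q - c₀) / N, ?_, ⟨(q - c₀) % N, Nat.mod_lt _ hN0⟩, ?_, ?_⟩
    · rw [Nat.div_lt_iff_lt_mul hN0]; omega
    · have := Nat.div_add_mod' (q - c₀) N
      simp only; omega
    · have := Nat.div_add_mod' (q - c₀) N
      simp only; omega
  refine ⟨by rw [hlen]; have := h.pos; omega, by rw [(k2 0 h.pos).2]; exact h.size_zero,
    fun q hq => ?_, fun T hT => ?_, ?_⟩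
  · rw [hlen] at hq
    by_cases hq' : q < c₀
    · rw [(k2 q hq').1, (k2 q hq').2]; exact h.card_le q hq'
    · obtain ⟨a, ha, y, rfl, hay⟩ := hdecomp q (by omega) hq
      rw [(k3 a y hay).1, (k3 a y hay).2]
      exact (Finset.card_insert_le _ _).trans (Nat.succ_le_succ (h.card_le a ha))
  · by_cases hTk : T.card ≤ k
    · obtain ⟨q, hq, h1, h2⟩ := h.exists_row T hTk
      refine ⟨q, by omega, ?_, ?_⟩
      · rw [(k2 q hq).1, h1]
      · rw [(k2 q hq).2, h2]
    · obtain ⟨y, hy⟩ : T.Nonempty := Finset.card_pos.1 (by omega)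
      have hce := Finset.card_erase_of_mem hy
      obtain ⟨q, hq, h1, h2⟩ := h.exists_row (T.erase y) (by omega)
      have hlt : q * N + y < c₀ * N := by
        calc q * N + y < q * N + N := by have := y.2; omega
          _ = (q + 1) * N := by ring
          _ ≤ c₀ * N := Nat.mul_le_mul_right _ hq
      refine ⟨c₀ + (q * N + y), by omega, ?_, ?_⟩
      · rw [(k3 q y hlt).1, h1, Finset.insert_erase hy]
      · rw [(k3 q y hlt).2, h2]; omega
  · rw [hlen, show c₀ = (N + 1) ^ k from h.length_eq]; ring

theorem writes_rep_subset (p : Prog) (k : ℕ) : (rep p k).writes ⊆ p.writes := by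
  induction k with
  | zero => simp [rep, writes]
  | succ k ih => simp [rep, writes, ih]

theorem realWrites_rep_subset (p : Prog) (k : ℕ) : (rep p k).realWrites ⊆ p.realWrites := by
  induction k with
  | zero => simp [rep, realWrites]
  | succ k ih => simp [rep, realWrites, ih]

theorem table_spec {t s c u : ℕ} (hd : [20, 21, 22, 36, t, s, c, u].Nodup) {σ : Mem} {N : ℕ}
    (hN : σ.nat u 0 0 = N) (ht : ∀ i j, σ.nat t i j = 0) (hs : ∀ i j, σ.nat s i j = 0) (k : ℕ) :
    IsTable (denote f (table t s c u k) σ) t s c N k := by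
  have hd' := hd
  simp only [List.nodup_cons, List.mem_cons, List.not_mem_nil, or_false, not_or] at hd
  rw [table, denote_seq]
  set σ₁ := denote f (nat c (.lit 0) (.lit 0) (.lit 1)) σ with hσ₁
  have g₁ : ∀ A, A ≠ c → σ₁.nat A = σ.nat A := fun A hA =>
    denote_nat_of_notMem (by simpa [writes] using hA) _
  have c₁ : σ₁.nat c 0 0 = 1 := by simp [hσ₁, denote, NatExpr.eval, Mem.setNat_nat]
  induction k with
  | zero =>
    have hrow : σ₁.row N t 0 = ∅ := by
      ext y; simp [Mem.mem_row, g₁ t (by omega), ht]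
    have hs0 : σ₁.nat s 0 0 = 0 := by rw [g₁ s (by omega), hs]
    refine ⟨by simp [rep, denote, c₁], by simp [rep, denote, hs0], fun q hq => ?_,
      fun T hT => ⟨0, ?_⟩, by simp [rep, denote, c₁]⟩
    · simp only [rep, denote, c₁] at hq ⊢
      obtain rfl : q = 0 := by omega
      simp [hrow]
    · simp only [rep, denote, c₁]
      have : T = ∅ := Finset.card_eq_zero.1 (by omega)
      exact ⟨by omega, by rw [hrow, this], by rw [hs0, this, Finset.card_empty]⟩
  | succ k ih =>
    rw [rep, denote_seq]
    refine grow_spec hd' ?_ ih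
    rw [denote_nat_of_notMem fun h => ?_, g₁ u (by omega), hN]
    have := writes_rep_subset _ _ h
    simp [grow, append, writes] at this
    omega

end Prog

/-! ### Parameters, neighbourhoods and scenarios -/

namespace Prog

variable {n : ℕ} {f : Finset (Fin n) → ℝ}

/-- Reads the sizes of the instance and computes the parameters: `base` is a number of the order of
the size of the input; `cap` is the budget, truncated to the number of all nodes; `cost` is the cost
of a round, which is the whole budget if that is at most `k₀`, and `l₀` otherwise; `rounds` is the
quotient of `cap` and `cost`. -/
def init (c₀ k₀ l₀ : ℕ) : Prog :=
  nat aNX (.lit 0) (.lit 0) (.read 0 (.lit 0) (.lit 0)) ;;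
  nat aNY (.lit 0) (.lit 0) (.read 0 (.lit 0) (.lit 1)) ;;
  nat aBase (.lit 0) (.lit 0) (.plus (.plus (.plus (.var aNX) (.var aNY))
    (.read 0 (.lit 0) (.lit 3))) (.lit c₀)) ;;
  nat aCap (.lit 0) (.lit 0) (.minus (.plus (.var aNX) (.var aNY))
    (.minus (.plus (.var aNX) (.var aNY)) (.read 0 (.lit 0) (.lit 2)))) ;;
  ite (.and (.natLe (.lit 1) (.var aCap)) (.natLe (.var aCap) (.lit k₀)))
    (nat aCost (.lit 0) (.lit 0) (.var aCap)) (nat aCost (.lit 0) (.lit 0) (.lit l₀)) ;;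
  forTo aI aCap
    (ite (.natLe (.plus (.var aUsed) (.var aCost)) (.var aCap))
      (nat aUsed (.lit 0) (.lit 0) (.plus (.var aUsed) (.var aCost)) ;;
      nat aRounds (.lit 0) (.lit 0) (.plus (.var aRounds) (.lit 1))) skip)

/-- The cost of a round if the budget is `c`. -/
def roundCost (k₀ l₀ c : ℕ) : ℕ := if 1 ≤ c ∧ c ≤ k₀ then c else l₀

theorem roundCost_pos {k₀ l₀ : ℕ} (hl : 1 ≤ l₀) (c : ℕ) : 1 ≤ roundCost k₀ l₀ c := by
  rw [roundCost]; split_ifs with h <;> omega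

/-- The parameters computed by `init`. Division is not an operation of the machine; the number of
rounds is found by adding up the cost of a round as long as the budget permits. -/
theorem init_spec {c₀ k₀ l₀ : ℕ} (hl : 1 ≤ l₀) {σ : Mem} (hu : σ.nat aUsed 0 0 = 0)
    (hr : σ.nat aRounds 0 0 = 0) {τ : Mem} (hτ : τ = denote f (init c₀ k₀ l₀) σ) {x y b r : ℕ}
    (hx : σ.nat 0 0 0 = x) (hy : σ.nat 0 0 1 = y) (hb : σ.nat 0 0 2 = b) (hr' : σ.nat 0 0 3 = r) :
    τ.nat aNX 0 0 = x ∧ τ.nat aNY 0 0 = y ∧ τ.nat aBase 0 0 = x + y + r + c₀ ∧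
    τ.nat aCap 0 0 = min b (x + y) ∧ τ.nat aCost 0 0 = roundCost k₀ l₀ (min b (x + y)) ∧
    τ.nat aRounds 0 0 = min b (x + y) / roundCost k₀ l₀ (min b (x + y)) := by
  set C := min b (x + y) with hC
  set L := roundCost k₀ l₀ C with hL
  have hL1 : 1 ≤ L := roundCost_pos hl C
  rw [init, denote_seq, denote_seq, denote_seq, denote_seq, denote_seq] at hτ
  set σ₁ := denote f (nat aCap (.lit 0) (.lit 0) (.minus (.plus (.var aNX) (.var aNY))
    (.minus (.plus (.var aNX) (.var aNY)) (.read 0 (.lit 0) (.lit 2)))))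
    (denote f (nat aBase (.lit 0) (.lit 0) (.plus (.plus (.plus (.var aNX) (.var aNY))
    (.read 0 (.lit 0) (.lit 3))) (.lit c₀)))
    (denote f (nat aNY (.lit 0) (.lit 0) (.read 0 (.lit 0) (.lit 1)))
    (denote f (nat aNX (.lit 0) (.lit 0) (.read 0 (.lit 0) (.lit 0))) σ))) with hσ₁
  have a₁ : σ₁.nat aNX 0 0 = x ∧ σ₁.nat aNY 0 0 = y ∧ σ₁.nat aBase 0 0 = x + y + r + c₀ ∧
      σ₁.nat aCap 0 0 = C ∧ σ₁.nat aUsed 0 0 = 0 ∧ σ₁.nat aRounds 0 0 = 0 := by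
    simp only [hσ₁, denote, NatExpr.eval, Mem.setNat_nat]
    simp [hx, hy, hb, hr', hu, hr]
    omega
  obtain ⟨x₁, y₁, b₁, c₁, u₁, r₁⟩ := a₁
  set σ₂ := denote f (ite (.and (.natLe (.lit 1) (.var aCap)) (.natLe (.var aCap) (.lit k₀)))
    (nat aCost (.lit 0) (.lit 0) (.var aCap)) (nat aCost (.lit 0) (.lit 0) (.lit l₀))) σ₁ with hσ₂
  have g₂ : ∀ A, A ≠ 14 → σ₂.nat A = σ₁.nat A := fun A hA =>
    denote_nat_of_notMem (by simpa [writes] using hA) _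
  have l₂ : σ₂.nat aCost 0 0 = L := by
    rw [hσ₂, denote_ite (P := 1 ≤ C ∧ C ≤ k₀) (by simp [TestExpr.Holds, NatExpr.eval, c₁])]
    rw [hL, roundCost]
    split_ifs <;> simp [denote, NatExpr.eval, Mem.setNat_nat, c₁]
  have c₂ : σ₂.nat aCap 0 0 = C := by rw [g₂ _ (by decide), c₁]
  have key : (τ.nat aUsed 0 0 = τ.nat aRounds 0 0 * L ∧ τ.nat aRounds 0 0 * L ≤ C) ∧
      (τ.nat aUsed 0 0 + L ≤ C → C ≤ τ.nat aRounds 0 0) := by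
    have := forTo_induction (f := f) (σ := σ₂) (v := aI) (u := aCap)
      (p := ite (.natLe (.plus (.var aUsed) (.var aCost)) (.var aCap))
      (nat aUsed (.lit 0) (.lit 0) (.plus (.var aUsed) (.var aCost)) ;;
      nat aRounds (.lit 0) (.lit 0) (.plus (.var aRounds) (.lit 1))) skip)
      (fun k τ => (τ.nat aUsed 0 0 = τ.nat aRounds 0 0 * L ∧ τ.nat aRounds 0 0 * L ≤ C) ∧
      (τ.nat aUsed 0 0 + L ≤ C → k ≤ τ.nat aRounds 0 0)) ?_ ?_
    · rw [c₂, ← hτ] at this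
      exact this
    · rw [Mem.setNat_nat_of_ne _ (by decide), Mem.setNat_nat_of_ne _ (by decide), g₂ _ (by decide),
        g₂ _ (by decide), u₁, r₁]
      simp
    intro k hk υ hv hfr _ ⟨⟨h1, h2⟩, h3⟩
    have eL : υ.nat aCost 0 0 = L := by rw [hfr _ (by decide) (by simp [writes]), l₂]
    have eC : υ.nat aCap 0 0 = C := by rw [hfr _ (by decide) (by simp [writes]), c₂]
    rw [Mem.setNat_nat_of_ne _ (by decide), Mem.setNat_nat_of_ne _ (by decide),
      denote_ite (P := υ.nat aUsed 0 0 + L ≤ C) (by simp [TestExpr.Holds, NatExpr.eval, eL, eC])]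
    split_ifs with hif
    · have e1 : (denote f (nat aUsed (.lit 0) (.lit 0) (.plus (.var aUsed) (.var aCost)) ;;
        nat aRounds (.lit 0) (.lit 0) (.plus (.var aRounds) (.lit 1))) υ).nat aUsed 0 0 =
          υ.nat aUsed 0 0 + L := by
        simp [denote, NatExpr.eval, Mem.setNat_nat, eL]
      have e2 : (denote f (nat aUsed (.lit 0) (.lit 0) (.plus (.var aUsed) (.var aCost)) ;;
        nat aRounds (.lit 0) (.lit 0) (.plus (.var aRounds) (.lit 1))) υ).nat aRounds 0 0 =
          υ.nat aRounds 0 0 + 1 := by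
        simp [denote, NatExpr.eval, Mem.setNat_nat]
      rw [e1, e2]
      have := h3 hif
      refine ⟨⟨by rw [h1]; ring, by rw [add_mul, one_mul, ← h1]; exact hif⟩, fun _ => by omega⟩
    · exact ⟨⟨h1, h2⟩, fun h => absurd h hif⟩
  have gτ : ∀ A, A ∉ [20, 16, 15] → τ.nat A = σ₂.nat A := fun A hA => by
    rw [hτ]
    exact denote_nat_of_notMem (by simp [writes] at hA ⊢; omega) _
  refine ⟨?_, ?_, ?_, ?_, ?_, ?_⟩
  · rw [gτ _ (by decide), g₂ _ (by decide), x₁]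
  · rw [gτ _ (by decide), g₂ _ (by decide), y₁]
  · rw [gτ _ (by decide), g₂ _ (by decide), b₁]
  · rw [gτ _ (by decide), c₂]
  · rw [gτ _ (by decide), l₂]
  · obtain ⟨⟨h1, h2⟩, h3⟩ := key
    refine ((Nat.div_eq_iff hL1).2 ⟨h2, ?_⟩).symm
    by_contra hcon
    have h4 : τ.nat aUsed 0 0 + L ≤ C := by rw [h1]; rw [Nat.add_comm] at hcon; omega
    have h5 := h3 h4
    have h6 : τ.nat aRounds 0 0 * 1 ≤ τ.nat aRounds 0 0 * L := Nat.mul_le_mul_left _ hL1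
    omega

/-- Multiplies `samples` by `base`. -/
def mulBase : Prog :=
  nat aTmp (.lit 0) (.lit 0) (.lit 0) ;;
  forTo aI aBase (nat aTmp (.lit 0) (.lit 0) (.plus (.var aTmp) (.var aSamples))) ;;
  nat aSamples (.lit 0) (.lit 0) (.var aTmp)

/-- Sets `samples` to the power of `base` with exponent `e`. -/
def power (e : ℕ) : Prog := nat aSamples (.lit 0) (.lit 0) (.lit 1) ;; rep mulBase e

theorem power_spec (e : ℕ) (σ : Mem) :
    (denote f (power e) σ).nat aSamples 0 0 = (σ.nat aBase 0 0) ^ e := by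
  rw [power, denote_seq]
  set σ₁ := denote f (nat aSamples (.lit 0) (.lit 0) (.lit 1)) σ with hσ₁
  have b₁ : σ₁.nat aBase = σ.nat aBase := denote_nat_of_notMem (by decide) _
  induction e with
  | zero => simp [rep, denote, hσ₁, NatExpr.eval, Mem.setNat_nat]
  | succ e ih =>
    set σ₂ := denote f (rep mulBase e) σ₁ with hσ₂
    have b₂ : σ₂.nat aBase 0 0 = σ.nat aBase 0 0 := by
      rw [hσ₂, denote_nat_of_notMem fun h => ?_, b₁]
      exact absurd (writes_rep_subset _ _ h) (by decide)
    set σ₃ := denote f (nat aTmp (.lit 0) (.lit 0) (.lit 0)) σ₂ with hσ₃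
    have g₃ : ∀ A, A ≠ 19 → σ₃.nat A = σ₂.nat A := fun A hA =>
      denote_nat_of_notMem (by simpa [writes] using hA) _
    have key : (denote f (forTo aI aBase
        (nat aTmp (.lit 0) (.lit 0) (.plus (.var aTmp) (.var aSamples)))) σ₃).nat aTmp 0 0 =
        σ₃.nat aBase 0 0 * σ₂.nat aSamples 0 0 := by
      refine forTo_induction (f := f) (fun k τ => τ.nat aTmp 0 0 = k * σ₂.nat aSamples 0 0) ?_ ?_
      · rw [Mem.setNat_nat_of_ne _ (by decide)]
        simp [hσ₃, denote, NatExpr.eval, Mem.setNat_nat]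
      · intro k _ τ _ hfr _ hP
        have : τ.nat aSamples 0 0 = σ₂.nat aSamples 0 0 := by
          rw [hfr _ (by decide) (by decide), g₃ _ (by decide)]
        rw [Mem.setNat_nat_of_ne _ (by decide)]
        simp only [denote, NatExpr.eval, Mem.setNat_nat, this, hP]
        simp; ring
    rw [show denote f (rep mulBase (e + 1)) σ₁ = denote f (nat aSamples (.lit 0) (.lit 0)
      (.var aTmp)) (denote f (forTo aI aBase
        (nat aTmp (.lit 0) (.lit 0) (.plus (.var aTmp) (.var aSamples)))) σ₃) from rfl,
      denote, Mem.setNat_nat, if_pos ⟨rfl, rfl, rfl⟩]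
    simp only [NatExpr.eval, NatExpr.var]
    rw [key, g₃ _ (by decide), b₂, ih, pow_succ, mul_comm]

/-- Computes the neighbourhoods of the candidates. -/
def cover : Prog :=
  forTo aQ aCX (forTo aJ aNX
    (ite (.natLe (.lit 1) (.read aTX (.var aQ) (.var aJ)))
      (fillRow aI aNY aCov (.var aQ)
        (.plus (.read aCov (.var aQ) (.var aI)) (.read aAdj (.var aJ) (.var aI)))) skip))

/-- Row `q` of `cov` becomes the union of the rows of the adjacency matrix over candidate `q`. -/
theorem cover_spec {σ : Mem} (hn : σ.nat aNY 0 0 = n) {m : ℕ} (hm : σ.nat aNX 0 0 = m)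
    (hc : ∀ i j, σ.nat aCov i j = 0) {q : ℕ} (hq : q < σ.nat aCX 0 0) :
    (denote f cover σ).row n aCov q = (σ.row m aTX q).biUnion fun x => σ.row n aAdj x := by
  have hset : ∀ (τ : Mem) v x, v ≠ 37 → ∀ i, (τ.setNat v 0 0 x).row n aCov i = τ.row n aCov i :=
    fun τ v x hv i => Mem.row_congr fun k _ => by rw [Mem.setNat_nat_of_ne _ (Ne.symm hv)]
  have key : ∀ q (y : Fin n), y ∈ (denote f cover σ).row n aCov q ↔ q < σ.nat aCX 0 0 ∧
      ∃ x < m, σ.nat aTX q x ≠ 0 ∧ σ.nat aAdj x y ≠ 0 := by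
    refine forTo_induction (f := f) (fun k τ => ∀ q (y : Fin n), y ∈ τ.row n aCov q ↔ q < k ∧
      ∃ x < m, σ.nat aTX q x ≠ 0 ∧ σ.nat aAdj x y ≠ 0) ?_ ?_
    · intro q y
      rw [hset _ _ _ (by decide), Mem.mem_row, hc]
      simp
    intro k hk τ hv hfr _ hP q y
    have hm' : τ.nat aNX 0 0 = m := by rw [hfr _ (by decide) (by decide), hm]
    rw [hset _ _ _ (by decide)]
    have inner : ∀ q (y : Fin n), y ∈ (denote f (forTo aJ aNX
      (ite (.natLe (.lit 1) (.read aTX (.var aQ) (.var aJ)))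
      (fillRow aI aNY aCov (.var aQ)
        (.plus (.read aCov (.var aQ) (.var aI)) (.read aAdj (.var aJ) (.var aI)))) skip)) τ).row n
        aCov q ↔ y ∈ τ.row n aCov q ∨ q = k ∧ ∃ x < τ.nat aNX 0 0, σ.nat aTX q x ≠ 0 ∧
          σ.nat aAdj x y ≠ 0 := by
      refine forTo_induction (f := f) (fun l υ => ∀ q (y : Fin n), y ∈ υ.row n aCov q ↔
        y ∈ τ.row n aCov q ∨ q = k ∧ ∃ x < l, σ.nat aTX q x ≠ 0 ∧ σ.nat aAdj x y ≠ 0) ?_ ?_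
      · intro q y
        rw [hset _ _ _ (by decide)]
        simp
      intro l hl υ hv' hfr' _ hP' q y
      have e : ∀ A, A ∉ [20, 21, 22, 37] → υ.nat A = σ.nat A := fun A hA => by
        simp only [List.mem_cons, List.not_mem_nil, or_false, not_or] at hA
        rw [hfr' A (by omega) (by simp [writes]; omega),
          hfr A (by omega) (by simp [writes]; omega)]
      have eq : υ.nat aQ 0 0 = k := by rw [hfr' _ (by decide) (by decide), hv]
      have hsplit : (∃ x < l + 1, σ.nat aTX q x ≠ 0 ∧ σ.nat aAdj x y ≠ 0) ↔
          (∃ x < l, σ.nat aTX q x ≠ 0 ∧ σ.nat aAdj x y ≠ 0) ∨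
          (σ.nat aTX q l ≠ 0 ∧ σ.nat aAdj l y ≠ 0) := by
        constructor
        · rintro ⟨x, hx, h⟩
          rcases Nat.lt_succ_iff_lt_or_eq.1 hx with h' | rfl
          · exact .inl ⟨x, h', h⟩
          · exact .inr h
        · rintro (⟨x, hx, h⟩ | h)
          · exact ⟨x, by omega, h⟩
          · exact ⟨l, by omega, h⟩
      rw [hset _ _ _ (by decide), hsplit, denote_ite (P := σ.nat aTX k l ≠ 0) (by
        simp only [TestExpr.Holds, NatExpr.eval, eq, hv', e aTX (by decide)]; omega)]
      split_ifs with hif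
      · rw [Mem.mem_row, denote_fillRow (by decide) (i₀ := k)
          (val := fun y => υ.nat aCov k y + σ.nat aAdj l y)]
        · rw [e aNY (by decide), hn]
          by_cases hqk : q = k
          · subst hqk
            have h1 := hP' q y
            rw [Mem.mem_row] at h1
            simp only [true_and, y.2, and_self, if_true]
            rw [show (υ.nat aCov q y + σ.nat aAdj l y ≠ 0) ↔
              (υ.nat aCov q y ≠ 0 ∨ σ.nat aAdj l y ≠ 0) by omega, h1]
            simp only [true_and, or_assoc, hif, ne_eq, not_false_eq_true]
          · rw [if_neg (by tauto), ← Mem.mem_row, hP']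
            tauto
        · intro j _ ω hv'' hfr'' _ hA
          have eω : ω.nat aQ 0 0 = k := by rw [hfr'' _ (by decide) (by decide), eq]
          have eω' : ω.nat aJ 0 0 = l := by rw [hfr'' _ (by decide) (by decide), hv']
          simp only [NatExpr.eval, eω, eω', hv'', hA, hfr'' aAdj (by decide) (by decide),
            e aAdj (by decide), and_self]
      · rw [show denote f skip υ = υ from rfl, hP']
        constructor
        · exact Or.imp_right fun h => ⟨h.1, .inl h.2⟩
        · rintro (h | ⟨rfl, h | h⟩)
          · exact .inl h
          · exact .inr ⟨rfl, h⟩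
          · exact absurd h.1 hif
    rw [inner, hP, hm']
    constructor
    · rintro (⟨h1, h2⟩ | ⟨rfl, h2⟩)
      · exact ⟨by omega, h2⟩
      · exact ⟨by omega, h2⟩
    · rintro ⟨h1, h2⟩
      rcases Nat.lt_succ_iff_lt_or_eq.1 h1 with h | rfl
      · exact .inl ⟨h, h2⟩
      · exact .inr ⟨rfl, h2⟩
  ext y
  rw [key, Finset.mem_biUnion]
  constructor
  · rintro ⟨-, x, hx, h1, h2⟩
    exact ⟨⟨x, hx⟩, Mem.mem_row.2 h1, Mem.mem_row.2 h2⟩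
  · rintro ⟨x, h1, h2⟩
    exact ⟨hq, x, x.2, Mem.mem_row.1 h1, Mem.mem_row.1 h2⟩

/-- The test whether the node with index `i` is not rare: its probability is at least the inverse
of the square of `base`. -/
def commonTest : TestExpr :=
  .realLe (.ofNat (.lit 1)) (.times (.times (.read aProb (.lit 0) (.var aI)) (.ofNat (.var aBase)))
    (.ofNat (.var aBase)))

/-- The scenarios: `samples` random ones of equal weight, and for every rare node the one in which
exactly this node is realized, weighted with its probability. -/
def scenarios : Prog :=
  forTo aS aSamples (real aWt (.lit 0) (.var aS) (.divide (.ofNat (.lit 1))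
    (.ofNat (.var aSamples)))) ;;
  forTo aI aNY
    (nat aReal (.plus (.var aSamples) (.var aI)) (.var aI) (.lit 1) ;;
    ite commonTest skip
      (real aWt (.lit 0) (.plus (.var aSamples) (.var aI)) (.read aProb (.lit 0) (.var aI))))

/-- The weights of all scenarios, and the nodes of the scenarios that belong to rare nodes. -/
theorem scenarios_spec {σ : Mem} (hn : σ.nat aNY 0 0 = n) (hw : ∀ i j, σ.real aWt i j = 0)
    (hr : ∀ i j, σ.nat aReal i j = 0) {τ : Mem} (hτ : τ = denote f scenarios σ) {N M : ℕ}
    (hN : σ.nat aSamples 0 0 = N) (hM : σ.nat aBase 0 0 = M) :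
    (∀ s < N, τ.real aWt 0 s = 1 / N) ∧ (∀ y < n, τ.real aWt 0 (N + y) =
      if 1 ≤ σ.real aProb 0 y * M * M then 0 else σ.real aProb 0 y) ∧
    (∀ s, N + n ≤ s → τ.real aWt 0 s = 0) ∧ (∀ y : Fin n, τ.row n aReal (N + y) = {y}) ∧
    ∀ s < N, ∀ j, τ.nat aReal s j = 0 := by
  rw [scenarios, denote_seq] at hτ
  set σ₁ := denote f (forTo aS aSamples (real aWt (.lit 0) (.var aS) (.divide (.ofNat (.lit 1))
    (.ofNat (.var aSamples))))) σ with hσ₁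
  have w₁ : ∀ s, σ₁.real aWt 0 s = if s < σ.nat aSamples 0 0 then 1 / (N : ℝ) else 0 := by
    refine forTo_induction (f := f) (fun k τ => ∀ s, τ.real aWt 0 s =
      if s < k then 1 / (N : ℝ) else 0) ?_ ?_
    · intro s
      simp [hw]
    intro k hk τ hv hfr _ hP s
    have : τ.nat aSamples 0 0 = N := by rw [hfr _ (by decide) (by decide), hN]
    rw [Mem.setNat_real, denote, Mem.setReal_real]
    simp only [NatExpr.eval, RealExpr.eval, hv, this, hP, true_and]
    by_cases h1 : s = k
    · simp [h1]
    · by_cases h2 : s < k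
      · simp [h1, h2, show s < k + 1 by omega]
      · simp [h1, h2, show ¬ s < k + 1 by omega]
  rw [hN] at w₁
  have g₁ : ∀ A, A ≠ 23 → σ₁.nat A = σ.nat A := fun A hA =>
    denote_nat_of_notMem (by simpa [writes] using hA) _
  have p₁ : σ₁.real aProb = σ.real aProb := denote_real_of_notMem (by decide) _
  have key : (∀ s, τ.real aWt 0 s = if N ≤ s ∧ s < N + σ₁.nat aNY 0 0 then
      (if 1 ≤ σ.real aProb 0 (s - N) * M * M then 0 else σ.real aProb 0 (s - N))
      else σ₁.real aWt 0 s) ∧ ∀ i j, τ.nat aReal i j =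
        if i = N + j ∧ j < σ₁.nat aNY 0 0 then 1 else 0 := by
    rw [hτ]
    refine forTo_induction (f := f) (fun k τ => (∀ s, τ.real aWt 0 s = if N ≤ s ∧ s < N + k then
      (if 1 ≤ σ.real aProb 0 (s - N) * M * M then 0 else σ.real aProb 0 (s - N))
      else σ₁.real aWt 0 s) ∧ ∀ i j, τ.nat aReal i j = if i = N + j ∧ j < k then 1 else 0) ?_ ?_
    · refine ⟨fun s => ?_, fun i j => ?_⟩
      · rw [if_neg (by omega), Mem.setNat_real]
      · rw [if_neg (by omega), Mem.setNat_nat_of_ne _ (by decide), g₁ _ (by decide), hr]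
    intro k hk υ hv hfr hfr' hP
    have eN : υ.nat aSamples 0 0 = N := by
      rw [hfr _ (by decide) (by simp [writes]), g₁ _ (by decide), hN]
    have eM : υ.nat aBase 0 0 = M := by
      rw [hfr _ (by decide) (by simp [writes]), g₁ _ (by decide), hM]
    have eP : υ.real aProb = σ.real aProb := by rw [hfr' _ (by simp [realWrites]), p₁]
    rw [denote_seq]
    set υ₁ := denote f (nat aReal (.plus (.var aSamples) (.var aI)) (.var aI) (.lit 1)) υ with hυ₁
    have gυ : ∀ A, A ≠ 40 → υ₁.nat A = υ.nat A := fun A hA =>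
      denote_nat_of_notMem (by simpa [writes] using hA) _
    have rυ : υ₁.real = υ.real := rfl
    have tυ : commonTest.Holds f υ₁ ↔ 1 ≤ σ.real aProb 0 k * M * M := by
      simp only [commonTest, TestExpr.Holds, NatExpr.eval, RealExpr.eval, gυ aI (by decide),
        gυ aBase (by decide), hv, eM, rυ, eP, Nat.cast_one]
    refine ⟨fun s => ?_, fun i j => ?_⟩
    · rw [Mem.setNat_real, denote_ite tυ]
      by_cases h1 : s = N + k
      · subst h1
        rw [if_pos (show N ≤ N + k ∧ N + k < N + (k + 1) by omega), Nat.add_sub_cancel_left]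
        split_ifs with h2
        · rw [show denote f skip υ₁ = υ₁ from rfl, rυ, hP.1,
            if_neg (show ¬ (N ≤ N + k ∧ N + k < N + k) by omega), w₁,
            if_neg (show ¬ N + k < N by omega)]
        · simp [denote, Mem.setReal_real, NatExpr.eval, RealExpr.eval, gυ aI (by decide),
            gυ aSamples (by decide), hv, eN, rυ, eP]
      · have : ∀ P : Prop, ∀ [Decidable P], (if P then denote f skip υ₁ else
            denote f (real aWt (.lit 0) (.plus (.var aSamples) (.var aI))
              (.read aProb (.lit 0) (.var aI))) υ₁).real aWt 0 s = υ.real aWt 0 s := by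
          intro P _
          split_ifs
          · rfl
          · simp [denote, Mem.setReal_real, NatExpr.eval, gυ aI (by decide),
              gυ aSamples (by decide), hv, eN, rυ, h1]
        rw [this, hP.1]
        by_cases h2 : N ≤ s ∧ s < N + k
        · rw [if_pos h2, if_pos (show N ≤ s ∧ s < N + (k + 1) by omega)]
        · rw [if_neg h2, if_neg (show ¬ (N ≤ s ∧ s < N + (k + 1)) by omega)]
    · rw [Mem.setNat_nat_of_ne _ (by decide), denote_nat_of_notMem (by simp [writes]), hυ₁, denote,
        Mem.setNat_nat]
      simp only [NatExpr.eval, eN, hv, true_and, hP.2]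
      by_cases h1 : j = k
      · by_cases h2 : i = N + k <;> simp [h1, h2]
      · by_cases h2 : j < k
        · simp [h1, h2, show j < k + 1 by omega]
        · simp [h1, h2, show ¬ j < k + 1 by omega]
  rw [g₁ aNY (by decide), hn] at key
  refine ⟨fun s hs => ?_, fun y hy => ?_, fun s hs => ?_, fun y => ?_, fun s hs j => ?_⟩
  · rw [key.1, if_neg (by omega), w₁, if_pos hs]
  · rw [key.1, if_pos (by omega), Nat.add_sub_cancel_left]
  · rw [key.1, if_neg (by omega), w₁, if_neg (by omega)]
  · ext z
    rw [Mem.mem_row, key.2, Finset.mem_singleton]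
    constructor
    · intro h
      by_contra hne
      exact h (if_neg fun h' => hne (Fin.ext (by omega)))
    · rintro rfl
      simp
  · rw [key.2, if_neg (by omega)]

end Prog

/-! ### The memory after the setup -/

namespace Prog

/-- Everything in the first stage that precedes the sampling. -/
def setup (c₀ k₀ l₀ : ℕ) : Prog :=
  init c₀ k₀ l₀ ;; power 11 ;;
  nat aRows (.lit 0) (.lit 0) (.plus (.var aSamples) (.var aNY)) ;;
  table aTX aSX aCX aNX k₀ ;; table aTY aSY aCY aNY k₀ ;; cover ;; scenarios

/-- The memory after the setup, and after the sampling. -/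
structure Ready (c₀ k₀ l₀ : ℕ) (I : SeedingInstance) (r : ℕ) (σ : Mem) : Prop where
  numX : σ.nat aNX 0 0 = I.numX
  numY : σ.nat aNY 0 0 = I.numY
  base : σ.nat aBase 0 0 = I.numX + I.numY + r + c₀
  cost : σ.nat aCost 0 0 = roundCost k₀ l₀ (min I.budget (I.numX + I.numY))
  rounds : σ.nat aRounds 0 0 = min I.budget (I.numX + I.numY) /
    roundCost k₀ l₀ (min I.budget (I.numX + I.numY))
  samples : σ.nat aSamples 0 0 = (I.numX + I.numY + r + c₀) ^ 11
  rows : σ.nat aRows 0 0 = (I.numX + I.numY + r + c₀) ^ 11 + I.numY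
  tableX : IsTable σ aTX aSX aCX I.numX k₀
  tableY : IsTable σ aTY aSY aCY I.numY k₀
  cov : ∀ q < σ.nat aCX 0 0, σ.row I.numY aCov q = I.nbrs (σ.row I.numX aTX q)
  wt_sample : ∀ s < (I.numX + I.numY + r + c₀) ^ 11,
    σ.real aWt 0 s = 1 / ((I.numX + I.numY + r + c₀) ^ 11 : ℕ)
  wt_node : ∀ y : Fin I.numY, σ.real aWt 0 ((I.numX + I.numY + r + c₀) ^ 11 + y) =
    if 1 ≤ I.prob y * (I.numX + I.numY + r + c₀ : ℕ) * (I.numX + I.numY + r + c₀ : ℕ) then 0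
    else I.prob y
  wt_nonneg : ∀ s, 0 ≤ σ.real aWt 0 s
  row_node : ∀ y : Fin I.numY,
    σ.row I.numY aReal ((I.numX + I.numY + r + c₀) ^ 11 + y) = {y}
  prob : ∀ y : Fin I.numY, σ.real aProb 0 y = I.prob y
  first : ∀ i j, σ.nat aFirst i j = 0
  second : ∀ i j, σ.nat aSecond i j = 0
  zero : ∀ i j, σ.nat aZero i j = 0
  sel : ∀ i j, σ.nat aSel i j = 0

variable {n : ℕ} {f : Finset (Fin n) → ℝ}

theorem IsTable.congr {σ τ : Mem} {t s c N k : ℕ} (h : IsTable σ t s c N k)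
    (ht : τ.nat t = σ.nat t) (hs : τ.nat s = σ.nat s) (hc : τ.nat c = σ.nat c) :
    IsTable τ t s c N k := by
  have hrow : ∀ q, τ.row N t q = σ.row N t q := fun q => Mem.row_congr fun j _ => by rw [ht]
  refine ⟨by rw [hc]; exact h.pos, by rw [hs]; exact h.size_zero, ?_, ?_, by
    rw [hc]; exact h.length_eq⟩
  · simp only [hc, hs, hrow]; exact h.card_le
  · simp only [hc, hs, hrow]; exact h.exists_row

theorem notMem_writes_table {t s c u k A : ℕ} (h : A ∉ [20, 21, 22, 36, t, s, c]) :
    A ∉ (table t s c u k).writes := by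
  simp only [List.mem_cons, List.not_mem_nil, or_false, not_or] at h
  simp only [table, writes, List.mem_append, List.mem_singleton, not_or]
  refine ⟨by omega, fun h' => ?_⟩
  have := writes_rep_subset _ _ h'
  simp [grow, append, writes] at this
  omega

theorem notMem_writes_power {e A : ℕ} (h : A ∉ [17, 19, 20]) : A ∉ (power e).writes := by
  simp only [List.mem_cons, List.not_mem_nil, or_false, not_or] at h
  simp only [power, writes, List.mem_append, List.mem_singleton, not_or]
  refine ⟨by omega, fun h' => ?_⟩
  have := writes_rep_subset _ _ h'
  simp [mulBase, writes] at this
  omega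

theorem realWrites_rep {p : Prog} (hp : p.realWrites = []) (k : ℕ) : (rep p k).realWrites = [] :=
  List.subset_nil.1 (hp ▸ realWrites_rep_subset _ _)

theorem realWrites_power (e : ℕ) : (power e).realWrites = [] := by
  rw [power, realWrites, realWrites, realWrites_rep (p := mulBase) rfl, List.append_nil]

theorem realWrites_table (t s c u k : ℕ) : (table t s c u k).realWrites = [] := by
  rw [table, realWrites, realWrites, realWrites_rep (p := grow t s c u) rfl, List.append_nil]

theorem notMem_realWrites_setup {c₀ k₀ l₀ A : ℕ} (h : A ≠ 1) :
    A ∉ (setup c₀ k₀ l₀).realWrites := by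
  simp only [setup, realWrites, init, realWrites_power, realWrites_table, cover, scenarios,
    List.mem_append, not_or]
  simp [h]

theorem weight_nonneg {w : ℕ → ℝ} {N n : ℕ} (h₁ : ∀ s < N, w s = 1 / (N : ℕ))
    (h₂ : ∀ y < n, 0 ≤ w (N + y)) (h₃ : ∀ s, N + n ≤ s → w s = 0) (s : ℕ) : 0 ≤ w s := by
  rcases lt_or_ge s N with h | h
  · rw [h₁ s h]; positivity
  · rcases lt_or_ge s (N + n) with h' | h'
    · have := h₂ (s - N) (by omega)
      rwa [Nat.add_sub_cancel' h] at this
    · rw [h₃ s h']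

/-- The setup establishes everything that the rounds rely on, and leaves the rows that the sampling
will fill empty. -/
theorem ready_setup {c₀ k₀ l₀ : ℕ} (hl : 1 ≤ l₀) (I : SeedingInstance) (r : ℕ) :
    Ready c₀ k₀ l₀ I r (denote I.f (setup c₀ k₀ l₀) (I.input r)) ∧
    ∀ s < (I.numX + I.numY + r + c₀) ^ 11, ∀ j,
      (denote I.f (setup c₀ k₀ l₀) (I.input r)).nat aReal s j = 0 := by
  set σ := I.input r with hσ
  have z : ∀ A, 2 ≤ A → ∀ i j, σ.nat A i j = 0 := by
    intro A hA i j
    match A, hA with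
    | A + 2, _ => rfl
  have zr : ∀ A, 1 ≤ A → ∀ i j, σ.real A i j = 0 := by
    intro A hA i j
    simp only [hσ, SeedingInstance.input]
    rw [dif_neg (by omega)]
  set τ := denote I.f (setup c₀ k₀ l₀) σ with hτ
  have real : ∀ A, A ≠ 1 → τ.real A = σ.real A := fun A hA =>
    denote_real_of_notMem (notMem_realWrites_setup hA) _
  rw [setup, denote_seq, denote_seq, denote_seq, denote_seq, denote_seq, denote_seq] at hτ
  set σ₁ := denote I.f (init c₀ k₀ l₀) σ with hσ₁
  set σ₂ := denote I.f (power 11) σ₁ with hσ₂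
  set σ₃ := denote I.f (nat aRows (.lit 0) (.lit 0) (.plus (.var aSamples) (.var aNY))) σ₂ with hσ₃
  set σ₄ := denote I.f (table aTX aSX aCX aNX k₀) σ₃ with hσ₄
  set σ₅ := denote I.f (table aTY aSY aCY aNY k₀) σ₄ with hσ₅
  set σ₆ := denote I.f cover σ₅ with hσ₆
  have g₁ : ∀ A, A ∉ [10, 11, 12, 13, 14, 20, 16, 15] → σ₁.nat A = σ.nat A := fun A hA =>
    denote_nat_of_notMem (by simp [init, writes] at hA ⊢; omega) _
  have g₂ : ∀ A, A ∉ [17, 19, 20] → σ₂.nat A = σ₁.nat A := fun A hA =>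
    denote_nat_of_notMem (notMem_writes_power hA) _
  have g₃ : ∀ A, A ≠ 18 → σ₃.nat A = σ₂.nat A := fun A hA =>
    denote_nat_of_notMem (by simpa [writes] using hA) _
  have g₄ : ∀ A, A ∉ [20, 21, 22, 36, 30, 31, 32] → σ₄.nat A = σ₃.nat A := fun A hA =>
    denote_nat_of_notMem (notMem_writes_table hA) _
  have g₅ : ∀ A, A ∉ [20, 21, 22, 36, 33, 34, 35] → σ₅.nat A = σ₄.nat A := fun A hA =>
    denote_nat_of_notMem (notMem_writes_table hA) _
  have g₆ : ∀ A, A ∉ [20, 21, 22, 37] → σ₆.nat A = σ₅.nat A := fun A hA =>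
    denote_nat_of_notMem (by simp [cover, writes] at hA ⊢; omega) _
  have g₇ : ∀ A, A ∉ [20, 23, 40] → τ.nat A = σ₆.nat A := fun A hA => by
    rw [hτ]; exact denote_nat_of_notMem (by simp [scenarios, writes] at hA ⊢; omega) _
  have e₇ : ∀ A, A ∉ [20, 21, 22, 23, 36, 40, 37, 30, 31, 32, 33, 34, 35] →
      τ.nat A = σ₃.nat A := fun A hA => by
    simp at hA
    rw [g₇ _ (by simp; omega), g₆ _ (by simp; omega), g₅ _ (by simp; omega), g₄ _ (by simp; omega)]
  have e₃ : ∀ A, A ∉ [17, 18, 19, 20] → σ₃.nat A = σ₁.nat A := fun A hA => by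
    simp at hA
    rw [g₃ _ (by simp; omega), g₂ _ (by simp; omega)]
  have low : ∀ A, A < 10 → τ.nat A = σ.nat A := fun A hA => by
    rw [e₇ _ (by simp; omega), e₃ _ (by simp; omega), g₁ _ (by simp; omega)]
  obtain ⟨x₁, y₁, b₁, -, l₁, r₁⟩ := init_spec (f := I.f) (c₀ := c₀) (k₀ := k₀) hl
    (z _ (by decide) 0 0) (z _ (by decide) 0 0) hσ₁ (x := I.numX) (y := I.numY) (b := I.budget)
    (r := r) rfl rfl rfl rfl
  have s₂ : σ₂.nat aSamples 0 0 = (I.numX + I.numY + r + c₀) ^ 11 := by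
    rw [hσ₂, power_spec, b₁]
  have y₂ : σ₂.nat aNY 0 0 = I.numY := by rw [g₂ _ (by decide), y₁]
  have r₃ : σ₃.nat aRows 0 0 = (I.numX + I.numY + r + c₀) ^ 11 + I.numY := by
    rw [hσ₃, denote]
    simp only [NatExpr.eval, Mem.setNat_nat_self, s₂, y₂]
  have z₃ : ∀ A, 19 < A → A ≠ 20 → ∀ i j, σ₃.nat A i j = 0 := fun A hA hA' i j => by
    rw [e₃ _ (by simp; omega), g₁ _ (by simp; omega), z _ (by omega)]
  have t₄ : IsTable σ₄ aTX aSX aCX I.numX k₀ :=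
    table_spec (by decide) (by rw [e₃ _ (by decide), x₁]) (z₃ _ (by decide) (by decide))
      (z₃ _ (by decide) (by decide)) k₀
  have t₅ : IsTable σ₅ aTY aSY aCY I.numY k₀ :=
    table_spec (by decide) (by rw [g₄ _ (by decide), e₃ _ (by decide), y₁])
      (fun i j => by rw [g₄ _ (by decide), z₃ _ (by decide) (by decide)])
      (fun i j => by rw [g₄ _ (by decide), z₃ _ (by decide) (by decide)]) k₀
  have c₆ : ∀ q < σ₅.nat aCX 0 0, σ₆.row I.numY aCov q = I.nbrs (σ₅.row I.numX aTX q) := by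
    intro q hq
    rw [hσ₆, cover_spec (m := I.numX) (by rw [g₅ _ (by decide), g₄ _ (by decide),
      e₃ _ (by decide), y₁]) (by rw [g₅ _ (by decide), g₄ _ (by decide), e₃ _ (by decide), x₁])
      (fun i j => by rw [g₅ _ (by decide), g₄ _ (by decide), z₃ _ (by decide) (by decide)]) hq,
      SeedingInstance.nbrs]
    refine Finset.biUnion_congr rfl fun x _ => ?_
    ext y
    rw [Mem.mem_row, g₅ _ (by decide), g₄ _ (by decide), e₃ _ (by decide), g₁ _ (by decide)]
    simp [hσ, SeedingInstance.input]
  have real₆ : ∀ A, σ₆.real A = σ.real A := by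
    intro A
    have h₁ : σ₁.real A = σ.real A := denote_real_of_notMem (by simp [init, realWrites]) _
    have h₂ : σ₂.real A = σ₁.real A := denote_real_of_notMem (by
      rw [realWrites_power]; exact List.not_mem_nil) _
    have h₃ : σ₃.real A = σ₂.real A := denote_real_of_notMem (by simp [realWrites]) _
    have h₄ : σ₄.real A = σ₃.real A := denote_real_of_notMem (by
      rw [realWrites_table]; exact List.not_mem_nil) _
    have h₅ : σ₅.real A = σ₄.real A := denote_real_of_notMem (by
      rw [realWrites_table]; exact List.not_mem_nil) _
    have h₆ : σ₆.real A = σ₅.real A := denote_real_of_notMem (by simp [cover, realWrites]) _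
    rw [h₆, h₅, h₄, h₃, h₂, h₁]
  have n₆ : ∀ A, A ∉ [20, 21, 22, 23, 36, 40, 37, 30, 31, 32, 33, 34, 35] →
      σ₆.nat A = σ₃.nat A := fun A hA => by
    simp at hA
    rw [g₆ _ (by simp; omega), g₅ _ (by simp; omega), g₄ _ (by simp; omega)]
  obtain ⟨w₁, w₂, w₃, w₄, w₅⟩ := scenarios_spec (f := I.f) (σ := σ₆)
    (by rw [n₆ _ (by decide), e₃ _ (by decide), y₁])
    (fun i j => by rw [real₆, zr _ (by decide)])
    (fun i j => by rw [g₆ _ (by decide), g₅ _ (by decide), g₄ _ (by decide),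
      z₃ _ (by decide) (by decide)]) hτ
    (by rw [n₆ _ (by decide), g₃ _ (by decide), s₂])
    (by rw [n₆ _ (by decide), e₃ _ (by decide), b₁])
  have prob : ∀ y : Fin I.numY, σ.real aProb 0 y = I.prob y := fun y => by
    simp [hσ, SeedingInstance.input]
  have w₂' : ∀ y : Fin I.numY, τ.real aWt 0 ((I.numX + I.numY + r + c₀) ^ 11 + y) =
      if 1 ≤ I.prob y * (I.numX + I.numY + r + c₀ : ℕ) * (I.numX + I.numY + r + c₀ : ℕ) then 0
      else I.prob y := fun y => by rw [w₂ y y.2, real₆, prob]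
  refine ⟨⟨?_, ?_, ?_, ?_, ?_, ?_, ?_, ?_, ?_, ?_, w₁, w₂', fun s => ?_, w₄, fun y => ?_, ?_, ?_,
    ?_, ?_⟩, w₅⟩
  · rw [e₇ _ (by decide), e₃ _ (by decide), x₁]
  · rw [e₇ _ (by decide), e₃ _ (by decide), y₁]
  · rw [e₇ _ (by decide), e₃ _ (by decide), b₁]
  · rw [e₇ _ (by decide), e₃ _ (by decide), l₁]
  · rw [e₇ _ (by decide), e₃ _ (by decide), r₁]
  · rw [e₇ _ (by decide), g₃ _ (by decide), s₂]
  · rw [e₇ _ (by decide), r₃]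
  · exact t₄.congr (by rw [g₇ _ (by decide), g₆ _ (by decide), g₅ _ (by decide)])
      (by rw [g₇ _ (by decide), g₆ _ (by decide), g₅ _ (by decide)])
      (by rw [g₇ _ (by decide), g₆ _ (by decide), g₅ _ (by decide)])
  · exact t₅.congr (by rw [g₇ _ (by decide), g₆ _ (by decide)])
      (by rw [g₇ _ (by decide), g₆ _ (by decide)]) (by rw [g₇ _ (by decide), g₆ _ (by decide)])
  · intro q hq
    rw [g₇ _ (by decide), g₆ _ (by decide)] at hq
    have h1 : τ.row I.numY aCov q = σ₆.row I.numY aCov q :=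
      Mem.row_congr fun j _ => by rw [g₇ _ (by decide)]
    have h2 : τ.row I.numX aTX q = σ₅.row I.numX aTX q :=
      Mem.row_congr fun j _ => by rw [g₇ _ (by decide), g₆ _ (by decide)]
    rw [h1, h2, c₆ q hq]
  · refine weight_nonneg w₁ (fun y hy => ?_) w₃ s
    rw [w₂' ⟨y, hy⟩]
    split_ifs
    · exact le_rfl
    · exact I.prob_nonneg _
  · rw [real _ (by decide), prob]
  · intro i j; rw [low _ (by decide), z _ (by decide)]
  · intro i j; rw [low _ (by decide), z _ (by decide)]
  · intro i j; rw [low _ (by decide), z _ (by decide)]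
  · intro i j
    rw [e₇ _ (by decide), z₃ _ (by decide) (by decide)]

end Prog

/-! ### Running times -/

namespace Prog

variable {n : ℕ} {f : Finset (Fin n) → ℝ}

theorem wf_rep {p : Prog} (hp : p.WF) (k : ℕ) : (rep p k).WF := by
  induction k with
  | zero => trivial
  | succ k ih => exact ⟨ih, hp⟩

theorem wf_table {t s c u : ℕ} (hd : [20, 21, 22, 36, t, s, c, u].Nodup) (k : ℕ) :
    (table t s c u k).WF := by
  simp only [List.nodup_cons, List.mem_cons, List.not_mem_nil, or_false, not_or] at hd
  refine ⟨trivial, wf_rep ?_ k⟩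
  simp only [grow, append, WF, writes, List.mem_append, List.mem_cons, List.not_mem_nil, or_false,
    not_or, and_true, true_and]
  omega

theorem wf_setup (c₀ k₀ l₀ : ℕ) : (setup c₀ k₀ l₀).WF := by
  refine ⟨by simp [init, WF, writes], ⟨trivial, wf_rep (by simp [mulBase, WF, writes]) 11⟩, trivial,
    wf_table (by decide) k₀, wf_table (by decide) k₀, by simp [cover, WF, writes],
    by simp [scenarios, WF, writes]⟩

theorem wf_plan : plan.WF := by
  simp [plan, round, pick, score, bestOf, store, WF, writes]

theorem wf_respond : respond.WF := by
  simp [respond, bestOf, store, WF, writes]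

theorem time_seq_le {p q : Prog} {σ : Mem} {B : ℕ} (hp : time f p σ ≤ cost B p)
    (hq : time f q (denote f p σ) ≤ cost B q) : time f (p ;; q) σ ≤ cost B (p ;; q) := by
  simp only [time, cost]; omega

/-- The loops in `table` are bounded by the growing length of the table, which is
`(N + 1) ^ j` after `j` repetitions; `time_le_cost` applies to each repetition separately. -/
theorem time_table_le {t s c u : ℕ} (hd : [20, 21, 22, 36, t, s, c, u].Nodup) {σ : Mem} {N : ℕ}
    (hN : σ.nat u 0 0 = N) (ht : ∀ i j, σ.nat t i j = 0) (hs : ∀ i j, σ.nat s i j = 0) {B : ℕ}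
    (hNB : N ≤ B) (k : ℕ) (hB : (N + 1) ^ k ≤ B) :
    time f (table t s c u k) σ ≤ cost B (table t s c u k) := by
  induction k with
  | zero => exact le_rfl
  | succ k ih =>
    have hk : (N + 1) ^ k ≤ B := (Nat.pow_le_pow_right (by omega) (by omega)).trans hB
    have h1 := ih hk
    have h2 : time f (grow t s c u) (denote f (table t s c u k) σ) ≤ cost B (grow t s c u) := by
      have hT := table_spec (f := f) hd hN ht hs k
      have hu : (denote f (table t s c u k) σ).nat u 0 0 = N := by
        rw [denote_nat_of_notMem (notMem_writes_table ?_), hN]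
        simp only [List.nodup_cons, List.mem_cons, List.not_mem_nil, or_false, not_or] at hd ⊢
        grind
      set τ := denote f (table t s c u k) σ
      simp only [List.nodup_cons, List.mem_cons, List.not_mem_nil, or_false, not_or] at hd
      refine time_seq_le le_rfl (time_le_cost ?_ fun v hv => ?_)
      · simp only [append, WF, writes, List.mem_append, List.mem_cons, List.not_mem_nil, or_false,
          not_or, and_true]
        grind
      · have hv' : v = 36 ∨ v = u := by
          simp only [append, bounds, List.mem_cons, List.not_mem_nil, or_false, List.append_nil]
            at hv
          omega
        refine ⟨?_, ?_⟩
        · change v ∉ [22, 21, 20, t, t, s, c]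
          simp only [List.mem_cons, List.not_mem_nil, or_false, not_or]
          grind
        · rcases hv' with rfl | rfl
          · simp only [denote, NatExpr.eval, Mem.setNat_nat_self]
            rw [hT.length_eq]; exact hk
          · rw [denote_nat_of_notMem (by simp only [writes, List.mem_singleton]; grind), hu]
            exact hNB
    have e1 : time f (table t s c u (k + 1)) σ = time f (table t s c u k) σ + 1 +
        time f (grow t s c u) (denote f (table t s c u k) σ) := by
      simp only [table, rep, time, denote]; omega
    have e2 : cost B (table t s c u (k + 1)) = cost B (table t s c u k) + 1 +
        cost B (grow t s c u) := by
      simp only [table, rep, cost]; omega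
    omega

/-- The setup takes polynomial time, if `B` bounds the parameters and the lengths of the tables. -/
theorem time_setup_le {c₀ k₀ l₀ : ℕ} (hl : 1 ≤ l₀) (I : SeedingInstance) (r : ℕ) {B : ℕ}
    (hB : (I.numX + I.numY + r + c₀) ^ 11 + I.numX + I.numY ≤ B)
    (hB' : I.numX + I.numY + r + c₀ ≤ B)
    (hX : (I.numX + 1) ^ k₀ ≤ B) (hY : (I.numY + 1) ^ k₀ ≤ B) :
    time I.f (setup c₀ k₀ l₀) (I.input r) ≤ cost B (setup c₀ k₀ l₀) := by
  set σ := I.input r with hσ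
  have z : ∀ A, 2 ≤ A → ∀ i j, σ.nat A i j = 0 := by
    intro A hA i j
    match A, hA with
    | A + 2, _ => rfl
  set σ₁ := denote I.f (init c₀ k₀ l₀) σ with hσ₁
  set σ₂ := denote I.f (power 11) σ₁ with hσ₂
  set σ₃ := denote I.f (nat aRows (.lit 0) (.lit 0) (.plus (.var aSamples) (.var aNY))) σ₂ with hσ₃
  set σ₄ := denote I.f (table aTX aSX aCX aNX k₀) σ₃ with hσ₄
  set σ₅ := denote I.f (table aTY aSY aCY aNY k₀) σ₄ with hσ₅
  set σ₆ := denote I.f cover σ₅ with hσ₆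
  have g₁ : ∀ A, A ∉ [10, 11, 12, 13, 14, 20, 16, 15] → σ₁.nat A = σ.nat A := fun A hA =>
    denote_nat_of_notMem (by simp [init, writes] at hA ⊢; omega) _
  have g₂ : ∀ A, A ∉ [17, 19, 20] → σ₂.nat A = σ₁.nat A := fun A hA =>
    denote_nat_of_notMem (notMem_writes_power hA) _
  have g₃ : ∀ A, A ≠ 18 → σ₃.nat A = σ₂.nat A := fun A hA =>
    denote_nat_of_notMem (by simpa [writes] using hA) _
  have g₄ : ∀ A, A ∉ [20, 21, 22, 36, 30, 31, 32] → σ₄.nat A = σ₃.nat A := fun A hA =>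
    denote_nat_of_notMem (notMem_writes_table hA) _
  have g₅ : ∀ A, A ∉ [20, 21, 22, 36, 33, 34, 35] → σ₅.nat A = σ₄.nat A := fun A hA =>
    denote_nat_of_notMem (notMem_writes_table hA) _
  have g₆ : ∀ A, A ∉ [20, 21, 22, 37] → σ₆.nat A = σ₅.nat A := fun A hA =>
    denote_nat_of_notMem (by simp [cover, writes] at hA ⊢; omega) _
  have e₃ : ∀ A, A ∉ [17, 18, 19, 20] → σ₃.nat A = σ₁.nat A := fun A hA => by
    simp at hA
    rw [g₃ _ (by simp; omega), g₂ _ (by simp; omega)]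
  have z₃ : ∀ A, 19 < A → A ≠ 20 → ∀ i j, σ₃.nat A i j = 0 := fun A hA hA' i j => by
    rw [e₃ _ (by simp; omega), g₁ _ (by simp; omega), z _ (by omega)]
  obtain ⟨x₁, y₁, b₁, c₁, -, -⟩ := init_spec (f := I.f) (c₀ := c₀) (k₀ := k₀) hl
    (z _ (by decide) 0 0) (z _ (by decide) 0 0) hσ₁ (x := I.numX) (y := I.numY) (b := I.budget)
    (r := r) rfl rfl rfl rfl
  have s₂ : σ₂.nat aSamples 0 0 = (I.numX + I.numY + r + c₀) ^ 11 := by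
    rw [hσ₂, power_spec, b₁]
  have hNX : I.numX ≤ B := by omega
  have hNY : I.numY ≤ B := by omega
  refine time_seq_le ?_ (time_seq_le ?_ (time_seq_le le_rfl (time_seq_le ?_ (time_seq_le ?_
    (time_seq_le ?_ ?_)))))
  · refine time_seq_le le_rfl (time_seq_le le_rfl (time_seq_le le_rfl (time_seq_le le_rfl
      (time_seq_le (time_le_cost (by trivial) (by simp [bounds])) (time_le_cost
      (by simp [WF, writes]) fun u hu => ?_)))))
    obtain rfl : u = 13 := by simpa [bounds] using hu
    refine ⟨by simp [writes], ?_⟩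
    have : σ₁.nat aCap 0 0 ≤ B := by rw [c₁]; omega
    rw [hσ₁, init, denote_seq, denote_seq, denote_seq, denote_seq, denote_seq,
      denote_nat_of_notMem (p := forTo _ _ _) (by simp [writes])] at this
    exact this
  · refine time_le_cost (p := power 11) ⟨trivial, wf_rep (by simp [mulBase, WF, writes]) 11⟩
      fun u hu => ?_
    have hb : ∀ k, ∀ u ∈ (rep mulBase k).bounds, u = 12 := by
      intro k
      induction k with
      | zero => simp [rep, bounds]
      | succ k ih =>
        intro u hu
        simp only [rep, bounds, List.mem_append] at hu
        rcases hu with hu | hu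
        · exact ih u hu
        · simpa [mulBase, bounds] using hu
    obtain rfl := hb 11 u (by simpa [power, bounds] using hu)
    exact ⟨notMem_writes_power (by decide), by rw [b₁]; exact hB'⟩
  · exact time_table_le (by decide) (by rw [e₃ _ (by decide), x₁]) (z₃ _ (by decide) (by decide))
      (z₃ _ (by decide) (by decide)) hNX k₀ hX
  · exact time_table_le (by decide) (by rw [g₄ _ (by decide), e₃ _ (by decide), y₁])
      (fun i j => by rw [g₄ _ (by decide), z₃ _ (by decide) (by decide)])
      (fun i j => by rw [g₄ _ (by decide), z₃ _ (by decide) (by decide)]) hNY k₀ hY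
  · refine time_le_cost (by simp [cover, WF, writes]) fun u hu => ?_
    have hu' : u = 32 ∨ u = 10 ∨ u = 11 := by simpa [cover, bounds] using hu
    refine ⟨by simp [cover, writes]; omega, ?_⟩
    have t₄ : IsTable σ₄ aTX aSX aCX I.numX k₀ :=
      table_spec (by decide) (by rw [e₃ _ (by decide), x₁]) (z₃ _ (by decide) (by decide))
        (z₃ _ (by decide) (by decide)) k₀
    change σ₅.nat u 0 0 ≤ B
    rcases hu' with rfl | rfl | rfl
    · rw [g₅ _ (by decide), t₄.length_eq]; exact hX
    · rw [g₅ _ (by decide), g₄ _ (by decide), e₃ _ (by decide), x₁]; exact hNX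
    · rw [g₅ _ (by decide), g₄ _ (by decide), e₃ _ (by decide), y₁]; exact hNY
  · refine time_le_cost (by simp [scenarios, WF, writes]) fun u hu => ?_
    have hu' : u = 17 ∨ u = 11 := by simpa [scenarios, bounds] using hu
    refine ⟨by simp [scenarios, writes]; omega, ?_⟩
    change σ₆.nat u 0 0 ≤ B
    rcases hu' with rfl | rfl
    · rw [g₆ _ (by decide), g₅ _ (by decide), g₄ _ (by decide), g₃ _ (by decide), s₂]; omega
    · rw [g₆ _ (by decide), g₅ _ (by decide), g₄ _ (by decide), e₃ _ (by decide), y₁]; exact hNY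

end Prog

/-! ### Sampling -/

section Expectation

variable {α β : Type*}

/-- The expectation of a nonnegative function. -/
noncomputable def PMF.mean (D : PMF α) (h : α → ℝ≥0∞) : ℝ≥0∞ := ∑' a, D a * h a

theorem PMF.mean_pure (a : α) (h : α → ℝ≥0∞) : (PMF.pure a).mean h = h a := by
  rw [PMF.mean, tsum_eq_single a fun b hb => by simp [PMF.pure_apply, hb]]
  simp

theorem PMF.mean_bind (D : PMF α) (K : α → PMF β) (h : β → ℝ≥0∞) :
    (D.bind K).mean h = D.mean fun a => (K a).mean h := by
  simp only [PMF.mean, PMF.bind_apply, ← ENNReal.tsum_mul_right, ← ENNReal.tsum_mul_left]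
  rw [ENNReal.tsum_comm]
  simp only [mul_assoc]

theorem PMF.mean_congr {D : PMF α} {h h' : α → ℝ≥0∞} (H : ∀ a ∈ D.support, h a = h' a) :
    D.mean h = D.mean h' := by
  refine tsum_congr fun a => ?_
  by_cases ha : a ∈ D.support
  · rw [H a ha]
  · rw [(D.apply_eq_zero_iff a).2 ha, zero_mul, zero_mul]

theorem PMF.mean_mul_left (D : PMF α) (c : ℝ≥0∞) (h : α → ℝ≥0∞) :
    (D.mean fun a => c * h a) = c * D.mean h := by
  simp only [PMF.mean, ← ENNReal.tsum_mul_left]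
  exact tsum_congr fun a => by ring

theorem PMF.bind_congr_support {D : PMF α} {K K' : α → PMF β} (H : ∀ a ∈ D.support, K a = K' a) :
    D.bind K = D.bind K' := by
  ext b
  rw [PMF.bind_apply, PMF.bind_apply]
  refine tsum_congr fun a => ?_
  by_cases ha : a ∈ D.support
  · rw [H a ha]
  · rw [(D.apply_eq_zero_iff a).2 ha, zero_mul, zero_mul]

end Expectation

/-- Running `c` from the memory `σ` takes exactly `t` steps and leaves a random memory with the
distribution `D`, whatever commands remain to be executed afterwards. -/
def Runs {n : ℕ} (f : Finset (Fin n) → ℝ) (c : Cmd) (σ : Mem) (t : ℕ) (D : PMF Mem) : Prop :=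
  ∀ (K : List Cmd) (s : ℕ), runFor f (t + s) (c :: K, σ) = D.bind fun τ => runFor f s (K, τ)

section Runs

variable {n : ℕ} {f : Finset (Fin n) → ℝ}

theorem Steps.runs {c : Cmd} {σ τ : Mem} {t : ℕ} (h : Steps f c σ τ t) :
    Runs f c σ t (PMF.pure τ) := by
  intro K s
  rw [h, PMF.pure_bind]

theorem Runs.flip (A : ℕ) (i j : NatExpr) (q : RealExpr) (σ : Mem) :
    Runs f (.flip A i j q) σ 1 ((coin (q.eval f σ)).map fun b =>
      σ.setNat A (i.eval σ) (j.eval σ) (if b = true then 1 else 0)) := by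
  intro K s
  rw [add_comm, runFor_succ, step, PMF.bind_map, PMF.bind_map]
  rfl

theorem Runs.seq {c d : Cmd} {σ : Mem} {t u : ℕ} {D : PMF Mem} {E : Mem → PMF Mem}
    (hc : Runs f c σ t D) (hd : ∀ τ ∈ D.support, Runs f d τ u (E τ)) :
    Runs f (.seq c d) σ (1 + t + u) (D.bind E) := by
  intro K s
  rw [show 1 + t + u + s = (t + (u + s)) + 1 by ring, runFor_succ, step, PMF.pure_bind, hc,
    PMF.bind_bind]
  exact PMF.bind_congr_support fun τ hτ => hd τ hτ K s

theorem Runs.branch_pos {b : TestExpr} {c d : Cmd} {σ : Mem} {t : ℕ} {D : PMF Mem}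
    (hb : b.Holds f σ) (hc : Runs f c σ t D) : Runs f (.branch b c d) σ (1 + t) D := by
  intro K s
  rw [show 1 + t + s = (t + s) + 1 by ring, runFor_succ, step, PMF.pure_bind, if_pos hb, hc]

theorem Runs.branch_neg {b : TestExpr} {c d : Cmd} {σ : Mem} {t : ℕ} {D : PMF Mem}
    (hb : ¬ b.Holds f σ) (hd : Runs f d σ t D) : Runs f (.branch b c d) σ (1 + t) D := by
  intro K s
  rw [show 1 + t + s = (t + s) + 1 by ring, runFor_succ, step, PMF.pure_bind, if_neg hb, hd]

theorem Runs.loop_pos {b : TestExpr} {c : Cmd} {σ : Mem} {t u : ℕ} {D : PMF Mem}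
    {E : Mem → PMF Mem} (hb : b.Holds f σ) (hc : Runs f c σ t D)
    (hl : ∀ τ ∈ D.support, Runs f (.loop b c) τ u (E τ)) :
    Runs f (.loop b c) σ (1 + t + u) (D.bind E) := by
  intro K s
  rw [show 1 + t + u + s = (t + (u + s)) + 1 by ring, runFor_succ, step, PMF.pure_bind, if_pos hb,
    hc, PMF.bind_bind]
  exact PMF.bind_congr_support fun τ hτ => hl τ hτ K s

/-- A counting loop with a body that may use random bits. -/
def Cmd.count (v u : ℕ) (c : Cmd) : Cmd :=
  .seq (.setNat v (.lit 0) (.lit 0) (.lit 0))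
    (.loop (.natLe (.plus (.var v) (.lit 1)) (.var u))
      (.seq c (.setNat v (.lit 0) (.lit 0) (.plus (.var v) (.lit 1)))))

/-- The distribution of the memory after `k` further iterations of a counting loop, of which `i` are
completed. -/
noncomputable def countDist (v : ℕ) (κ : Mem → PMF Mem) : ℕ → ℕ → Mem → PMF Mem
  | 0, _, τ => PMF.pure τ
  | k + 1, i, τ => (κ τ).bind fun υ => countDist v κ k (i + 1) (υ.setNat v 0 0 (i + 1))

/-- A property of the memory that is established anew by each iteration holds in the end. -/
theorem countDist_support {v : ℕ} {κ : Mem → PMF Mem} (Inv : ℕ → Mem → Prop) {N : ℕ}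
    (hκ : ∀ i < N, ∀ τ, Inv i τ → ∀ υ ∈ (κ τ).support, Inv (i + 1) (υ.setNat v 0 0 (i + 1))) :
    ∀ k i τ, i + k = N → Inv i τ → ∀ υ ∈ (countDist v κ k i τ).support, Inv N υ := by
  intro k
  induction k with
  | zero =>
    intro i τ hi hτ υ hυ
    obtain rfl : υ = τ := by simpa [countDist] using hυ
    obtain rfl : i = N := by omega
    exact hτ
  | succ k ih =>
    intro i τ hi hτ υ hυ
    rw [countDist, PMF.mem_support_bind_iff] at hυ
    obtain ⟨ω, hω, hυ⟩ := hυ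
    exact ih (i + 1) _ (by omega) (hκ i (by omega) τ hτ ω hω) υ hυ

/-- A counting loop whose body takes `T` steps, the same for all outcomes of the random bits. The
invariant ensures that the body respects the counter and the bound. -/
theorem Runs.count {v u : ℕ} {c : Cmd} {κ : Mem → PMF Mem} {N T : ℕ} (Inv : ℕ → Mem → Prop)
    (hv : ∀ i τ, Inv i τ → τ.nat v 0 0 = i ∧ τ.nat u 0 0 = N)
    (hκ : ∀ i < N, ∀ τ, Inv i τ → Runs f c τ T (κ τ) ∧ ∀ υ ∈ (κ τ).support,
      υ.nat v 0 0 = i ∧ Inv (i + 1) (υ.setNat v 0 0 (i + 1)))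
    {σ : Mem} (h0 : Inv 0 (σ.setNat v 0 0 0)) :
    Runs f (.count v u c) σ (3 + N * (T + 3)) (countDist v κ N 0 (σ.setNat v 0 0 0)) := by
  have key : ∀ k i τ, i + k = N → Inv i τ → Runs f
      (.loop (.natLe (.plus (.var v) (.lit 1)) (.var u))
        (.seq c (.setNat v (.lit 0) (.lit 0) (.plus (.var v) (.lit 1)))))
      τ (1 + k * (T + 3)) (countDist v κ k i τ) := by
    intro k
    induction k with
    | zero =>
      intro i τ hi hτ
      obtain ⟨h1, h2⟩ := hv i τ hτ
      simpa [countDist] using (Steps.loop_neg (f := f) (by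
        simp only [TestExpr.Holds, NatExpr.eval, h1, h2]; omega)).runs
    | succ k ih =>
      intro i τ hi hτ
      obtain ⟨h1, h2⟩ := hv i τ hτ
      obtain ⟨h3, h4⟩ := hκ i (by omega) τ hτ
      have h5 : Runs f (.seq c (.setNat v (.lit 0) (.lit 0) (.plus (.var v) (.lit 1)))) τ
          (1 + T + 1) ((κ τ).bind fun υ => PMF.pure (υ.setNat v 0 0 (i + 1))) := by
        refine h3.seq fun υ hυ => ?_
        have := (Steps.setNat (f := f) v (.lit 0) (.lit 0) (.plus (.var v) (.lit 1)) υ).runs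
        simpa only [NatExpr.eval, (h4 υ hυ).1] using this
      have h6 := Runs.loop_pos (f := f) (b := .natLe (.plus (.var v) (.lit 1)) (.var u))
        (by simp only [TestExpr.Holds, NatExpr.eval, h1, h2]; omega) h5
        (u := 1 + k * (T + 3)) (E := countDist v κ k (i + 1)) (by
          intro ω hω
          rw [PMF.mem_support_bind_iff] at hω
          obtain ⟨υ, hυ, hω⟩ := hω
          obtain rfl : ω = υ.setNat v 0 0 (i + 1) := by simpa using hω
          exact ih (i + 1) _ (by omega) (h4 υ hυ).2)
      rw [PMF.bind_bind] at h6
      simp only [PMF.pure_bind] at h6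
      rw [countDist]
      convert! h6 using 1
      ring
  have h7 := Runs.seq (f := f) (Steps.setNat v (.lit 0) (.lit 0) (.lit 0) σ).runs
    (u := 1 + N * (T + 3)) (E := countDist v κ N 0) (by
      intro τ hτ
      obtain rfl : τ = σ.setNat v 0 0 0 := by simpa [NatExpr.eval] using hτ
      exact key N 0 _ (by omega) h0)
  rw [PMF.pure_bind] at h7
  simp only [NatExpr.eval] at h7
  rw [Cmd.count]
  convert! h7 using 1
  ring

theorem mean_coin_map (q : ℝ) (hq : q ∈ Set.Icc (0 : ℝ) 1) (g : Bool → Mem) (h : Mem → ℝ≥0∞) :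
    ((coin q).map g).mean h =
      ENNReal.ofReal (1 - q) * h (g false) + ENNReal.ofReal q * h (g true) := by
  rw [← PMF.bind_pure_comp, PMF.mean_bind]
  simp only [Function.comp, PMF.mean_pure]
  have h1 : min 1 (ENNReal.ofReal q) = ENNReal.ofReal q :=
    min_eq_right (by rw [← ENNReal.ofReal_one]; exact ENNReal.ofReal_le_ofReal hq.2)
  rw [PMF.mean, tsum_bool]
  simp [coin, h1, ENNReal.ofReal_sub _ hq.1]

end Runs

/-- The sum of `H` over the subsets of `s`, weighted with products of `p` over the elements and of
`q` over the other elements of `s`. -/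
def prodSum {ι S : Type*} [DecidableEq ι] [CommSemiring S] (p q : ι → S) (s : Finset ι)
    (H : Finset ι → S) : S :=
  ∑ R ∈ s.powerset, (∏ y ∈ R, p y) * (∏ y ∈ s \ R, q y) * H R

theorem prodSum_empty {ι S : Type*} [DecidableEq ι] [CommSemiring S] (p q : ι → S)
    (H : Finset ι → S) : prodSum p q ∅ H = H ∅ := by simp [prodSum]

theorem prodSum_insert {ι S : Type*} [DecidableEq ι] [CommSemiring S] (p q : ι → S) {s : Finset ι}
    {y : ι} (hy : y ∉ s) (H : Finset ι → S) : prodSum p q (insert y s) H =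
      q y * prodSum p q s H + p y * prodSum p q s (fun R => H (insert y R)) := by
  rw [prodSum, Finset.sum_powerset_insert hy, prodSum, prodSum, Finset.mul_sum, Finset.mul_sum]
  congr 1
  · refine Finset.sum_congr rfl fun R hR => ?_
    have hyR : y ∉ R := fun h => hy (Finset.mem_powerset.1 hR h)
    rw [Finset.insert_sdiff_of_notMem _ hyR, Finset.prod_insert (by simp [hy])]
    ring
  · refine Finset.sum_congr rfl fun R hR => ?_
    have hyR : y ∉ R := fun h => hy (Finset.mem_powerset.1 hR h)
    rw [Finset.insert_sdiff_insert, Finset.sdiff_insert_of_notMem hy,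
      Finset.prod_insert hyR]
    ring

theorem prodSum_congr {ι S : Type*} [DecidableEq ι] [CommSemiring S] {p q p' q' : ι → S}
    {s : Finset ι} {H H' : Finset ι → S} (hp : ∀ y ∈ s, p y = p' y) (hq : ∀ y ∈ s, q y = q' y)
    (hH : ∀ R ⊆ s, H R = H' R) : prodSum p q s H = prodSum p' q' s H' := by
  refine Finset.sum_congr rfl fun R hR => ?_
  have hR := Finset.mem_powerset.1 hR
  rw [hH R hR, Finset.prod_congr rfl fun y hy => hp y (hR hy),
    Finset.prod_congr rfl fun y hy => hq y (Finset.sdiff_subset hy)]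

theorem ofReal_prodSum {ι : Type*} [DecidableEq ι] {p q : ι → ℝ} {s : Finset ι}
    {H : Finset ι → ℝ} (hp : ∀ y, 0 ≤ p y) (hq : ∀ y, 0 ≤ q y) (hH : ∀ R, 0 ≤ H R) :
    ENNReal.ofReal (prodSum p q s H) = prodSum (fun y => ENNReal.ofReal (p y))
      (fun y => ENNReal.ofReal (q y)) s fun R => ENNReal.ofReal (H R) := by
  rw [prodSum, ENNReal.ofReal_sum_of_nonneg fun R _ => mul_nonneg (mul_nonneg
    (Finset.prod_nonneg fun y _ => hp y) (Finset.prod_nonneg fun y _ => hq y)) (hH R)]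
  refine Finset.sum_congr rfl fun R _ => ?_
  rw [ENNReal.ofReal_mul (mul_nonneg (Finset.prod_nonneg fun y _ => hp y)
    (Finset.prod_nonneg fun y _ => hq y)), ENNReal.ofReal_mul (Finset.prod_nonneg fun y _ => hp y),
    ENNReal.ofReal_prod_of_nonneg fun y _ => hp y, ENNReal.ofReal_prod_of_nonneg fun y _ => hq y]

/-- Draws one bit of a sample. Rare nodes are never sampled. -/
def sampleBit : Cmd :=
  .branch Prog.commonTest (.flip aReal (.var aS) (.var aI) (.read aProb (.lit 0) (.var aI)))
    (.setNat aReal (.var aS) (.var aI) (.lit 0))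

/-- Draws the random scenarios. -/
def sample : Cmd := .count aS aSamples (.count aI aNY sampleBit)

/-- The probability of a node, replaced with zero if the node is rare, that is, if its probability
is less than the inverse of the square of `M`. -/
noncomputable def SeedingInstance.commonProb (I : SeedingInstance) (M : ℕ) (y : Fin I.numY) : ℝ :=
  if 1 ≤ I.prob y * M * M then I.prob y else 0

theorem SeedingInstance.commonProb_mem (I : SeedingInstance) (M : ℕ) (y : Fin I.numY) :
    I.commonProb M y ∈ Set.Icc (0 : ℝ) 1 := by
  rw [commonProb]
  split_ifs
  · exact ⟨I.prob_nonneg y, I.prob_le_one y⟩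
  · exact ⟨le_rfl, zero_le_one⟩

/-! ### Independence of the samples -/

theorem coin_zero : coin 0 = PMF.pure false := by
  ext b
  cases b <;> simp [coin]

namespace Sampling

variable (I : SeedingInstance) (M N : ℕ) (σ₀ : Mem)

/-- The distribution of the memory after a bit has been drawn. -/
noncomputable def bitDist (τ : Mem) : PMF Mem :=
  (coin (if h : τ.nat aI 0 0 < I.numY then I.commonProb M ⟨τ.nat aI 0 0, h⟩ else 0)).map fun b =>
    τ.setNat aReal (τ.nat aS 0 0) (τ.nat aI 0 0) (if b = true then 1 else 0)

/-- The distribution of the memory after a scenario has been drawn. -/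
noncomputable def rowDist (τ : Mem) : PMF Mem :=
  countDist aI (bitDist I M) I.numY 0 (τ.setNat aI 0 0 0)

/-- The memory differs from `σ₀` only in the sampled scenarios and the counters. -/
structure Same (τ : Mem) : Prop where
  nat : ∀ A, A ≠ 20 → A ≠ 23 → A ≠ 40 → τ.nat A = σ₀.nat A
  real : τ.real = σ₀.real
  rest : ∀ s, N ≤ s → ∀ j, τ.nat aReal s j = σ₀.nat aReal s j

/-- The invariant while the `i`-th scenario is drawn; `ρ` is the memory before. -/
structure RowInv (i : ℕ) (ρ : Mem) (y : ℕ) (τ : Mem) : Prop where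
  same : Same N σ₀ τ
  row_index : τ.nat aS 0 0 = i
  col_index : τ.nat aI 0 0 = y
  other : ∀ s, s ≠ i → ∀ j, τ.nat aReal s j = ρ.nat aReal s j
  zero : ∀ j, y ≤ j → τ.nat aReal i j = 0

/-- The invariant after `i` scenarios have been drawn. -/
structure Inv (i : ℕ) (τ : Mem) : Prop where
  same : Same N σ₀ τ
  row_index : τ.nat aS 0 0 = i
  zero : ∀ s, i ≤ s → s < N → ∀ j, τ.nat aReal s j = 0

variable {I M N σ₀} {f : Finset (Fin I.numY) → ℝ}

theorem Same.setNat {τ : Mem} (h : Same N σ₀ τ) {A : ℕ} (hA : A = 20 ∨ A = 23) (i j v : ℕ) :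
    Same N σ₀ (τ.setNat A i j v) := by
  refine ⟨fun B h1 h2 h3 => ?_, h.real, fun s hs k => ?_⟩
  · rw [Mem.setNat_nat_of_ne _ (by omega), h.nat B h1 h2 h3]
  · rw [Mem.setNat_nat_of_ne _ (by omega), h.rest s hs]

theorem RowInv.bit {i y : ℕ} {ρ τ : Mem} (h : RowInv N σ₀ i ρ y τ) (hi : i < N) (v : ℕ) :
    (τ.setNat aReal i y v).nat aI 0 0 = y ∧
    RowInv N σ₀ i ρ (y + 1) ((τ.setNat aReal i y v).setNat aI 0 0 (y + 1)) := by
  refine ⟨by rw [Mem.setNat_nat_of_ne _ (by decide), h.col_index],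
    Same.setNat (τ := τ.setNat aReal i y v) ⟨fun A h1 h2 h3 => ?_,
    h.same.real, fun s hs j => ?_⟩ (.inl rfl) _ _ _, ?_, Mem.setNat_nat_self _ _ _ _ _,
    fun s hs j => ?_, fun j hj => ?_⟩
  · rw [Mem.setNat_nat_of_ne _ h3, h.same.nat A h1 h2 h3]
  · rw [Mem.setNat_nat, if_neg (by omega), h.same.rest s hs]
  · rw [Mem.setNat_nat_of_ne _ (by decide), Mem.setNat_nat_of_ne _ (by decide), h.row_index]
  · rw [Mem.setNat_nat_of_ne _ (by decide), Mem.setNat_nat, if_neg (by omega), h.other s hs]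
  · rw [Mem.setNat_nat_of_ne _ (by decide), Mem.setNat_nat, if_neg (by omega),
      h.zero j (by omega)]

theorem RowInv.bitDist {i y : ℕ} {ρ τ : Mem} (h : RowInv N σ₀ i ρ y τ) (hi : i < N) :
    ∀ υ ∈ (bitDist I M τ).support, υ.nat aI 0 0 = y ∧
      RowInv N σ₀ i ρ (y + 1) (υ.setNat aI 0 0 (y + 1)) := by
  intro υ hυ
  rw [Sampling.bitDist, PMF.support_map, Set.mem_image] at hυ
  obtain ⟨b, -, rfl⟩ := hυ
  rw [h.row_index, h.col_index]
  exact h.bit hi _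

theorem runs_sampleBit (hM : σ₀.nat aBase 0 0 = M)
    (hp : ∀ y : Fin I.numY, σ₀.real aProb 0 y = I.prob y) {i y : ℕ} {ρ τ : Mem}
    (h : RowInv N σ₀ i ρ y τ) (hy : y < I.numY) :
    Runs f sampleBit τ 2 (Sampling.bitDist I M τ) := by
  have hM' : τ.nat aBase 0 0 = M := by
    rw [h.same.nat _ (by decide) (by decide) (by decide), hM]
  have hp' : τ.real aProb 0 y = I.prob ⟨y, hy⟩ := by rw [h.same.real, ← hp]
  have ht : Prog.commonTest.Holds f τ ↔ 1 ≤ I.prob ⟨y, hy⟩ * M * M := by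
    simp only [Prog.commonTest, TestExpr.Holds, NatExpr.eval, RealExpr.eval, h.col_index, hp', hM',
      Nat.cast_one]
  rw [Sampling.bitDist, h.col_index, h.row_index, dif_pos hy]
  by_cases hc : 1 ≤ I.prob ⟨y, hy⟩ * M * M
  · rw [SeedingInstance.commonProb, if_pos hc]
    have := Runs.flip (f := f) aReal (.var aS) (.var aI) (.read aProb (.lit 0) (.var aI)) τ
    simp only [NatExpr.eval, RealExpr.eval, h.col_index, h.row_index, hp'] at this
    exact this.branch_pos (ht.2 hc)
  · rw [SeedingInstance.commonProb, if_neg hc, coin_zero, PMF.pure_map]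
    have := (Steps.setNat (f := f) aReal (.var aS) (.var aI) (.lit 0) τ).runs
    simp only [NatExpr.eval, h.col_index, h.row_index] at this
    exact this.branch_neg fun h => hc (ht.1 h)

theorem Inv.rowInv {i : ℕ} {τ : Mem} (h : Inv N σ₀ i τ) (hi : i < N) :
    RowInv N σ₀ i τ 0 (τ.setNat aI 0 0 0) := by
  refine ⟨h.same.setNat (.inl rfl) _ _ _, ?_, Mem.setNat_nat_self _ _ _ _ _, fun s _ j => ?_,
    fun j _ => ?_⟩
  · rw [Mem.setNat_nat_of_ne _ (by decide), h.row_index]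
  · rw [Mem.setNat_nat_of_ne _ (by decide)]
  · rw [Mem.setNat_nat_of_ne _ (by decide), h.zero i le_rfl hi]

theorem Inv.rowDist {i : ℕ} {τ : Mem} (h : Inv N σ₀ i τ) (hi : i < N) :
    ∀ υ ∈ (rowDist I M τ).support, RowInv N σ₀ i τ I.numY υ :=
  countDist_support (RowInv N σ₀ i τ) (fun _ _ _ hω υ hυ => (hω.bitDist hi υ hυ).2) I.numY 0 _
    (by omega) (h.rowInv hi)

theorem Inv.next {i : ℕ} {τ υ : Mem} (h : Inv N σ₀ i τ) (hυ : RowInv N σ₀ i τ I.numY υ) :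
    Inv N σ₀ (i + 1) (υ.setNat aS 0 0 (i + 1)) := by
  refine ⟨hυ.same.setNat (.inr rfl) _ _ _, Mem.setNat_nat_self _ _ _ _ _, fun s hs hs' j => ?_⟩
  rw [Mem.setNat_nat_of_ne _ (by decide), hυ.other s (by omega), h.zero s (by omega) hs']

theorem runs_row (hM : σ₀.nat aBase 0 0 = M) (hn : σ₀.nat aNY 0 0 = I.numY)
    (hp : ∀ y : Fin I.numY, σ₀.real aProb 0 y = I.prob y) {i : ℕ} {τ : Mem}
    (h : Inv N σ₀ i τ) (hi : i < N) :
    Runs f (.count aI aNY sampleBit) τ (3 + I.numY * 5) (Sampling.rowDist I M τ) := by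
  refine Runs.count (RowInv N σ₀ i τ) (fun y υ hυ => ⟨hυ.col_index, ?_⟩) (fun y hy υ hυ =>
    ⟨runs_sampleBit hM hp hυ hy, hυ.bitDist hi⟩) (h.rowInv hi)
  rw [hυ.same.nat _ (by decide) (by decide) (by decide), hn]

theorem inv_zero (h0 : ∀ s < N, ∀ j, σ₀.nat aReal s j = 0) :
    Inv N σ₀ 0 (σ₀.setNat aS 0 0 0) := by
  refine ⟨Same.setNat ⟨fun _ _ _ _ => rfl, rfl, fun _ _ _ => rfl⟩ (.inr rfl) _ _ _,
    Mem.setNat_nat_self _ _ _ _ _, fun s _ hs j => ?_⟩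
  rw [Mem.setNat_nat_of_ne _ (by decide), h0 s hs]

theorem runs_sample (hM : σ₀.nat aBase 0 0 = M) (hn : σ₀.nat aNY 0 0 = I.numY)
    (hN : σ₀.nat aSamples 0 0 = N) (hp : ∀ y : Fin I.numY, σ₀.real aProb 0 y = I.prob y)
    (h0 : ∀ s < N, ∀ j, σ₀.nat aReal s j = 0) :
    Runs f sample σ₀ (3 + N * (3 + I.numY * 5 + 3))
      (countDist aS (Sampling.rowDist I M) N 0 (σ₀.setNat aS 0 0 0)) := by
  refine Runs.count (Inv N σ₀) (fun i υ hυ => ⟨hυ.row_index, ?_⟩) (fun i hi τ hτ =>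
    ⟨runs_row hM hn hp hτ hi, fun υ hυ => ?_⟩) (inv_zero h0)
  · rw [hυ.same.nat _ (by decide) (by decide) (by decide), hN]
  · exact ⟨(hτ.rowDist hi υ hυ).row_index, hτ.next (hτ.rowDist hi υ hυ)⟩

theorem same_of_mem_support (h0 : ∀ s < N, ∀ j, σ₀.nat aReal s j = 0) {υ : Mem}
    (hυ : υ ∈ (countDist aS (Sampling.rowDist I M) N 0 (σ₀.setNat aS 0 0 0)).support) :
    Same N σ₀ υ :=
  (countDist_support (Inv N σ₀) (fun _ hi _ hω υ hυ => hω.next (hω.rowDist hi υ hυ)) N 0 _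
    (by omega) (inv_zero h0) υ hυ).same

/-- The remaining bits of a scenario add an independent random set to its row. -/
theorem mean_bits {i : ℕ} (hi : i < N) {ρ : Mem} (H : Finset (Fin I.numY) → ℝ≥0∞) :
    ∀ k y τ, y + k = I.numY → RowInv N σ₀ i ρ y τ →
      (countDist aI (Sampling.bitDist I M) k y τ).mean (fun υ => H (υ.row I.numY aReal i)) =
      prodSum (fun z => ENNReal.ofReal (I.commonProb M z))
        (fun z => ENNReal.ofReal (1 - I.commonProb M z)) (Finset.univ.filter fun z => y ≤ z)
        fun R => H (τ.row I.numY aReal i ∪ R) := by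
  intro k
  induction k with
  | zero =>
    intro y τ hy _
    have : (Finset.univ.filter fun z : Fin I.numY => y ≤ z) = ∅ :=
      Finset.filter_eq_empty_iff.2 fun z _ => by have := z.2; omega
    rw [countDist, PMF.mean_pure, this, prodSum_empty, Finset.union_empty]
  | succ k ih =>
    intro y τ hy hτ
    have hy' : y < I.numY := by omega
    have hs : (Finset.univ.filter fun z : Fin I.numY => y ≤ z) =
        insert ⟨y, hy'⟩ (Finset.univ.filter fun z : Fin I.numY => y + 1 ≤ z) := by
      ext z
      simp only [Finset.mem_filter, Finset.mem_univ, true_and, Finset.mem_insert, Fin.ext_iff]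
      omega
    have hrow : ∀ v, ((τ.setNat aReal i y v).setNat aI 0 0 (y + 1)).row I.numY aReal i =
        if v = 0 then τ.row I.numY aReal i else insert ⟨y, hy'⟩ (τ.row I.numY aReal i) := by
      intro v
      ext z
      rw [Mem.mem_row, Mem.setNat_nat_of_ne _ (by decide), Mem.setNat_nat]
      have h0 := hτ.zero y le_rfl
      by_cases hz : (z : ℕ) = y
      · have hz' : z = ⟨y, hy'⟩ := Fin.ext hz
        subst hz'
        split_ifs <;> simp_all [Mem.mem_row]
      · have hz' : z ≠ ⟨y, hy'⟩ := fun h => hz (congrArg Fin.val h)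
        split_ifs <;> simp_all [Mem.mem_row]
    rw [countDist, PMF.mean_bind, hs, prodSum_insert _ _ (by simp), Sampling.bitDist,
      hτ.row_index, hτ.col_index, dif_pos hy', mean_coin_map _ (I.commonProb_mem M _)]
    rw [ih _ _ (by omega) (hτ.bit hi _).2, ih _ _ (by omega) (hτ.bit hi _).2, hrow, hrow]
    simp [Finset.union_insert, Finset.insert_union]

/-- The sampled scenarios are independent, and each is distributed like the set of realized nodes
that are not rare. -/
theorem mean_samples (h0 : ∀ s < N, ∀ j, σ₀.nat aReal s j = 0)
    (G : Finset (Fin I.numY) → ℝ≥0∞) :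
    (countDist aS (Sampling.rowDist I M) N 0 (σ₀.setNat aS 0 0 0)).mean
      (fun υ => ∏ s ∈ Finset.range N, G (υ.row I.numY aReal s)) =
    (prodSum (fun z => ENNReal.ofReal (I.commonProb M z))
      (fun z => ENNReal.ofReal (1 - I.commonProb M z)) Finset.univ G) ^ N := by
  set E := prodSum (fun z => ENNReal.ofReal (I.commonProb M z))
      (fun z => ENNReal.ofReal (1 - I.commonProb M z)) Finset.univ G with hE
  have key : ∀ k i τ, i + k = N → Inv N σ₀ i τ →
      (countDist aS (Sampling.rowDist I M) k i τ).mean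
        (fun υ => ∏ s ∈ Finset.range N, G (υ.row I.numY aReal s)) =
      (∏ s ∈ Finset.range i, G (τ.row I.numY aReal s)) * E ^ k := by
    intro k
    induction k with
    | zero =>
      intro i τ hi _
      obtain rfl : i = N := by omega
      rw [countDist, PMF.mean_pure, pow_zero, mul_one]
    | succ k ih =>
      intro i τ hi hτ
      have hi' : i < N := by omega
      rw [countDist, PMF.mean_bind, PMF.mean_congr (h' := fun υ =>
        ((∏ s ∈ Finset.range i, G (τ.row I.numY aReal s)) * E ^ k) *
          G (υ.row I.numY aReal i)), PMF.mean_mul_left]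
      · have hrow : (τ.setNat aI 0 0 0).row I.numY aReal i = ∅ := by
          ext y
          rw [Mem.mem_row, Mem.setNat_nat_of_ne _ (by decide), hτ.zero i le_rfl hi']
          simp
        rw [Sampling.rowDist, mean_bits hi' G I.numY 0 _ (by omega) (hτ.rowInv hi'), hrow]
        simp only [Finset.empty_union, Nat.zero_le, Finset.filter_true]
        rw [← hE, pow_succ]
        ring
      · intro υ hυ
        have h1 := hτ.rowDist hi' υ hυ
        have h2 : ∀ s, (υ.setNat aS 0 0 (i + 1)).row I.numY aReal s = υ.row I.numY aReal s :=
          fun s => Mem.row_congr fun j _ => by rw [Mem.setNat_nat_of_ne _ (by decide)]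
        rw [ih (i + 1) _ (by omega) (hτ.next h1), Finset.prod_range_succ, h2]
        have h3 : ∏ s ∈ Finset.range i, G ((υ.setNat aS 0 0 (i + 1)).row I.numY aReal s) =
            ∏ s ∈ Finset.range i, G (τ.row I.numY aReal s) := by
          refine Finset.prod_congr rfl fun s hs => ?_
          rw [h2]
          congr 1
          exact Mem.row_congr fun j _ => h1.other s (Finset.mem_range.1 hs).ne j
        rw [h3]
        ring
  rw [key N 0 _ (by omega) (inv_zero h0), Finset.range_zero, Finset.prod_empty, one_mul]

end Sampling

/-! ### What the algorithm computes -/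

/-- The probability of a node if it is rare, and zero otherwise. -/
noncomputable def SeedingInstance.rareProb (I : SeedingInstance) (M : ℕ) (y : Fin I.numY) : ℝ :=
  if 1 ≤ I.prob y * M * M then 0 else I.prob y

/-- The estimate of the expectation of `g` from the samples `S 0, …, S (N - 1)` of the set of
realized nodes that are not rare, plus the contribution of the rare nodes. -/
noncomputable def SeedingInstance.estimate (I : SeedingInstance) (M N : ℕ)
    (S : ℕ → Finset (Fin I.numY)) (g : Finset (Fin I.numY) → ℝ) : ℝ :=
  ∑ s ∈ Finset.range N, 1 / (N : ℝ) * g (S s) + ∑ y, I.rareProb M y * g {y}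

/-- The tables contain all sets of at most `k` nodes, with their sizes, of both stages. -/
structure Tables.Complete (I : SeedingInstance) (k : ℕ) (T : Tables I.numY)
    (tX : ℕ → Finset (Fin I.numX)) : Prop where
  card_le : ∀ q < T.cX, (tX q).card ≤ T.sX q
  exists_row : ∀ D : Finset (Fin I.numX), D.card ≤ k → ∃ q < T.cX, tX q = D ∧ T.sX q = D.card
  length_eq : T.cX = (I.numX + 1) ^ k
  cov : ∀ q < T.cX, T.cov q = I.nbrs (tX q)
  card_le' : ∀ i < T.cY, (T.tY i).card ≤ T.sY i
  exists_row' : ∀ A : Finset (Fin I.numY), A.card ≤ k → ∃ i < T.cY, T.tY i = A ∧ T.sY i = A.card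

/-- The candidates `h 0, …, h (m - 1)` are chosen greedily with respect to the estimate. -/
def Tables.Greedy {I : SeedingInstance} (T : Tables I.numY) (M N : ℕ)
    (S : ℕ → Finset (Fin I.numY)) (h : ℕ → ℕ) (m : ℕ) : Prop :=
  ∀ k < m, h k < T.cX ∧ T.sX (h k) ≤ T.cost ∧ ∀ q < T.cX, T.sX q ≤ T.cost →
    I.estimate M N S (fun R => I.f (T.step I.f q R (T.sim I.f h R k))) ≤
      I.estimate M N S (fun R => I.f (T.sim I.f h R (k + 1)))

theorem SeedingInstance.f_nonneg (I : SeedingInstance) (A : Finset (Fin I.numY)) : 0 ≤ I.f A := by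
  rw [← I.f_empty]; exact I.f_mono _ _ (Finset.empty_subset _)

theorem Prog.bounds_plan : ∀ u ∈ plan.bounds, u ∈ [10, 11, 15, 18, 32, 35] ∧ u ∉ plan.writes := by
  decide

theorem Prog.bounds_respond :
    ∀ u ∈ respond.bounds, u ∈ [10, 11, 15, 18, 32, 35] ∧ u ∉ respond.writes := by
  decide

theorem Prog.writes_plan :
    plan.writes ⊆ [2, 20, 21, 22, 23, 24, 41, 42, 43, 44, 45, 46, 47] := by
  decide

open Prog in
/-- The algorithmic half of the argument: a polynomial-time algorithm which draws independent
samples `S`, whose plan consists of candidates chosen greedily with respect to the estimate from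
`S`, and whose response is the simulation `Tables.sim` in the revealed scenario. -/
theorem exists_algorithm {c₀ l₀ : ℕ} (k₀ : ℕ) (hc : 2 ≤ c₀) (hl : 1 ≤ l₀) :
    ∃ (alg : SeedingAlgorithm) (C d : ℕ), ∀ (I : SeedingInstance) (r : ℕ), ∀ t M N m L : ℕ,
      t = C * (I.numX + I.numY + r + 1) ^ d → M = I.numX + I.numY + r + c₀ → N = M ^ 11 →
      L = roundCost k₀ l₀ (min I.budget (I.numX + I.numY)) →
      m = min I.budget (I.numX + I.numY) / L →
      ∃ D : PMF Mem, runFor I.f t ([alg.plan], I.input r) = D.map (fun τ => ([], τ)) ∧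
        ∃ (T : Tables I.numY) (tX : ℕ → Finset (Fin I.numX)) (h : Mem → ℕ → ℕ)
          (S : Mem → ℕ → Finset (Fin I.numY)),
          T.Complete I k₀ tX ∧ T.cost = L ∧
          (∀ G : Finset (Fin I.numY) → ℝ≥0∞, D.mean (fun τ => ∏ s ∈ Finset.range N, G (S τ s)) =
            (prodSum (fun z => ENNReal.ofReal (I.commonProb M z))
              (fun z => ENNReal.ofReal (1 - I.commonProb M z)) Finset.univ G) ^ N) ∧
          ∀ τ ∈ D.support,
            I.firstStage τ = (Finset.range m).biUnion (fun k => tX (h τ k)) ∧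
            T.Greedy M N (S τ) (h τ) m ∧
            ∀ Q, ∃ υ, runFor I.f t ([alg.respond], I.reveal τ Q) = PMF.pure ([], υ) ∧
              I.secondStage υ = T.sim I.f (h τ) Q m := by
  obtain ⟨C, d, hCd⟩ := exists_cost_le (setup c₀ k₀ l₀ ;;
    forTo aS aSamples (forTo aI aNY (ite commonTest (nat 0 (.lit 0) (.lit 0) (.lit 0))
      (nat 0 (.lit 0) (.lit 0) (.lit 0)))) ;; plan ;; respond)
  refine ⟨⟨.seq (setup c₀ k₀ l₀).compile (.seq sample plan.compile), respond.compile⟩,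
    C * (c₀ ^ (k₀ + 12)) ^ d, (k₀ + 12) * d, fun I r t M N m L ht hM hN hL hm => ?_⟩
  set B := M ^ (k₀ + 12) with hB
  have hM2 : 2 ≤ M := by omega
  have hpow : ∀ {e}, e ≤ k₀ + 12 → M ^ e ≤ B := fun h => Nat.pow_le_pow_right (by omega) h
  have hB12 : M ^ 11 + I.numX + I.numY ≤ B := by
    have h1 : M ^ 12 ≤ B := hpow (by omega)
    have h2 : M ≤ M ^ 11 := Nat.le_self_pow (by norm_num) M
    have h3 : M ^ 11 * 2 ≤ M ^ 12 := by rw [pow_succ M 11]; exact Nat.mul_le_mul_left _ hM2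
    omega
  have hMB : M ≤ B := by simpa using hpow (e := 1) (by omega)
  have hX : (I.numX + 1) ^ k₀ ≤ B :=
    (Nat.pow_le_pow_left (by omega) k₀).trans (hpow (by omega))
  have hY : (I.numY + 1) ^ k₀ ≤ B :=
    (Nat.pow_le_pow_left (by omega) k₀).trans (hpow (by omega))
  have htime : ∀ B', B' ≤ C * B ^ d → B' ≤ t := fun B' h => h.trans <| by
    rw [ht, hB, mul_assoc, pow_mul, ← mul_pow, ← mul_pow]
    gcongr
    rw [hM]
    nlinarith [Nat.zero_le (I.numX + I.numY + r)]
  have hcost := hCd B (by omega)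
  obtain ⟨hR, h0⟩ := ready_setup (c₀ := c₀) (k₀ := k₀) hl I r
  set σ₀ := denote I.f (setup c₀ k₀ l₀) (I.input r) with hσ₀
  rw [← hM, ← hN] at h0
  have e_base := hR.base
  have e_cost := hR.cost
  have e_rounds := hR.rounds
  have e_samples := hR.samples
  have e_rows := hR.rows
  have w_sample := hR.wt_sample
  have w_node := hR.wt_node
  have r_node := hR.row_node
  rw [← hM] at e_base e_samples e_rows w_sample w_node r_node
  rw [← hN] at e_samples e_rows w_sample w_node r_node
  rw [← hL] at e_cost e_rounds
  rw [← hm] at e_rounds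
  have run₁ := (steps_compile (f := I.f) (wf_setup c₀ k₀ l₀) (I.input r)).runs
  have t₁ := time_setup_le (c₀ := c₀) (k₀ := k₀) hl I r (B := B) (by rw [← hM]; exact hB12)
    (by rw [← hM]; exact hMB) hX hY
  rw [← hσ₀] at run₁
  have run₂ := Sampling.runs_sample (f := I.f) (M := M) (N := N) e_base hR.numY e_samples hR.prob h0
  set D₀ := countDist aS (Sampling.rowDist I M) N 0 (σ₀.setNat aS 0 0 0) with hD₀
  have same : ∀ τ ∈ D₀.support, Sampling.Same N σ₀ τ := fun τ hτ =>
    Sampling.same_of_mem_support h0 hτ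
  have bd : ∀ τ : Mem, (∀ A, A ∈ [10, 11, 15, 18, 32, 35] → τ.nat A = σ₀.nat A) →
      ∀ u ∈ [10, 11, 15, 18, 32, 35], τ.nat u 0 0 ≤ B := by
    intro τ hτ u hu
    rw [hτ u hu]
    simp only [List.mem_cons, List.not_mem_nil, or_false] at hu
    rcases hu with rfl | rfl | rfl | rfl | rfl | rfl
    · rw [hR.numX]; omega
    · rw [hR.numY]; omega
    · rw [e_rounds, hm]
      have := Nat.div_le_self (min I.budget (I.numX + I.numY)) L
      omega
    · rw [e_rows, hN]; omega
    · rw [hR.tableX.length_eq]; exact hX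
    · rw [hR.tableY.length_eq]; exact hY
  have hplan : ∀ τ ∈ D₀.support, time I.f plan τ ≤ cost B plan := fun τ hτ =>
    time_le_cost wf_plan fun u hu => by
      obtain ⟨hu', hu''⟩ := bounds_plan u hu
      refine ⟨hu'', ?_⟩
      refine bd τ (fun A hA => ?_) u hu'
      simp only [List.mem_cons, List.not_mem_nil, or_false] at hA
      exact (same τ hτ).nat A (by omega) (by omega) (by omega)
  have tables : ∀ τ ∈ D₀.support, Tables.ofMem I.numY τ = Tables.ofMem I.numY σ₀ := fun τ hτ =>
    Tables.ofMem_congr fun A hA => by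
      simp only [List.mem_cons, List.not_mem_nil, or_false] at hA
      exact (same τ hτ).nat A (by omega) (by omega) (by omega)
  set T := Tables.ofMem I.numY σ₀ with hT
  have hcost' : cost B (setup c₀ k₀ l₀) + (3 + N * (3 + I.numY * 5 + 3)) + cost B plan +
      cost B respond + 3 ≤ C * B ^ d := by
    refine le_trans ?_ hcost
    have h1 : N * (3 + I.numY * 5 + 3) ≤ B * (3 + B * (1 + (1 + 1) + 3) + 3) := by
      gcongr
      · rw [hN]; omega
      · omega
      · norm_num
    simp only [cost]
    omega
  -- the distribution after the first stage, with a time bound that may depend on the samples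
  have run : ∀ s, runFor I.f (t + s) ([.seq (setup c₀ k₀ l₀).compile (.seq sample plan.compile)],
      I.input r) = (D₀.map (denote I.f plan)).map (fun τ => ([], τ)) := by
    intro s
    have h1 : cost B (setup c₀ k₀ l₀) + (3 + N * (3 + I.numY * 5 + 3)) + cost B plan + 2 ≤ t :=
      htime _ (by omega)
    obtain ⟨u, hu⟩ : ∃ u, t + s = (time I.f (setup c₀ k₀ l₀) (I.input r) +
        (((3 + N * (3 + I.numY * 5 + 3)) + (cost B plan + u)) + 1)) + 1 :=
      ⟨t + s - (time I.f (setup c₀ k₀ l₀) (I.input r) +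
        (((3 + N * (3 + I.numY * 5 + 3)) + (cost B plan)) + 1)) - 1, by omega⟩
    rw [hu, runFor_succ, step, PMF.pure_bind, run₁, PMF.pure_bind, runFor_succ, step,
      PMF.pure_bind, run₂, PMF.map_comp, ← PMF.bind_pure_comp]
    refine PMF.bind_congr_support fun τ hτ => ?_
    obtain ⟨v, hv⟩ := Nat.exists_eq_add_of_le (hplan τ hτ)
    rw [show cost B plan + u = time I.f plan τ + (v + u) by omega,
      steps_compile (f := I.f) wf_plan τ, runFor_nil]
    rfl
  refine ⟨D₀.map (denote I.f plan), run 0, T, σ₀.row I.numX aTX, fun τ => τ.nat aHist 0,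
    fun τ => τ.row I.numY aReal, ?_, e_cost, fun G => ?_, fun τ' hτ' => ?_⟩
  · exact ⟨hR.tableX.card_le, hR.tableX.exists_row, hR.tableX.length_eq, hR.cov,
      hR.tableY.card_le, hR.tableY.exists_row⟩
  · rw [← PMF.bind_pure_comp, PMF.mean_bind]
    simp only [Function.comp, PMF.mean_pure]
    rw [← Sampling.mean_samples h0]
    refine PMF.mean_congr fun τ _ => Finset.prod_congr rfl fun s _ => ?_
    rw [row_denote (by decide)]
  rw [PMF.support_map, Set.mem_image] at hτ'
  obtain ⟨τ, hτ, rfl⟩ := hτ'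
  have hs := same τ hτ
  have row_eq : ∀ A, A ≠ 20 → A ≠ 23 → A ≠ 40 → ∀ m i, τ.row m A i = σ₀.row m A i :=
    fun A h1 h2 h3 m i => Mem.row_congr fun j _ => by rw [hs.nat A h1 h2 h3]
  have row_zero : ∀ A, A ≠ 20 → A ≠ 23 → A ≠ 40 → (∀ i j, σ₀.nat A i j = 0) →
      ∀ m i, τ.row m A i = ∅ := fun A h1 h2 h3 h m i => by
    rw [row_eq A h1 h2 h3]; ext j; simp [Mem.mem_row, h]
  have er : τ.nat aRounds 0 0 = m := by
    rw [hs.nat _ (by decide) (by decide) (by decide), e_rounds]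
  have eY : τ.nat aNY 0 0 = I.numY := by
    rw [hs.nat _ (by decide) (by decide) (by decide), hR.numY]
  obtain ⟨hp1, hp2⟩ := plan_spec (f := I.f) (m := I.numX) (σ := τ)
    (by rw [hs.nat _ (by decide) (by decide) (by decide), hR.numX]) eY
    (by rw [hs.nat _ (by decide) (by decide) (by decide)]; exact hR.tableX.pos)
    (by rw [hs.nat _ (by decide) (by decide) (by decide)]; exact hR.tableX.size_zero)
    I.f_nonneg (fun s => by rw [hs.real]; exact hR.wt_nonneg s)
    (row_zero _ (by decide) (by decide) (by decide) hR.sel _)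
    (row_zero _ (by decide) (by decide) (by decide) hR.first _ _) rfl
  rw [er] at hp1 hp2
  rw [tables τ hτ] at hp2
  have hest : ∀ g : Finset (Fin I.numY) → ℝ, ∑ s ∈ Finset.range (τ.nat aRows 0 0),
      τ.real aWt 0 s * g (τ.row I.numY aReal s) = I.estimate M N (τ.row I.numY aReal) g := by
    intro g
    rw [hs.nat _ (by decide) (by decide) (by decide), e_rows, Finset.sum_range_add,
      SeedingInstance.estimate, Finset.sum_range (n := I.numY), hs.real]
    congr 1
    · exact Finset.sum_congr rfl fun s hs => by rw [w_sample s (Finset.mem_range.1 hs)]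
    · refine Finset.sum_congr rfl fun y _ => ?_
      rw [w_node, SeedingInstance.rareProb, ← r_node y]
      congr 2
      exact Mem.row_congr fun j _ => by rw [hs.rest _ (by omega)]
  have hrow : (denote I.f plan τ).row I.numY aReal = τ.row I.numY aReal := by
    ext i : 1
    exact row_denote (by decide) _ _
  refine ⟨?_, fun k hk => ?_, fun Q => ?_⟩
  · rw [SeedingInstance.firstStage, hp1, unionTX]
    exact Finset.biUnion_congr rfl fun k _ => row_eq _ (by decide) (by decide) (by decide) _ _
  · obtain ⟨h1, h2, h3⟩ := hp2 k hk
    refine ⟨h1, h2, fun q hq hq' => ?_⟩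
    have h4 := h3 q hq hq'
    rw [hest fun R => I.f (T.step I.f q R (T.sim I.f ((denote I.f plan τ).nat aHist 0) R k)),
      hest fun R => I.f (T.sim I.f ((denote I.f plan τ).nat aHist 0) R (k + 1))] at h4
    beta_reduce
    rw [hrow]
    exact h4
  · set ρ := I.reveal (denote I.f plan τ) Q with hρ
    have hρ' : ∀ A, A ∉ [3, 2, 20, 21, 22, 23, 24, 41, 42, 43, 44, 45, 46, 47] →
        ρ.nat A = τ.nat A := by
      intro A hA
      have h1 : ρ.nat A = (denote I.f plan τ).nat A := by
        ext i j
        simp only [hρ, SeedingInstance.reveal]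
        rw [if_neg (by simp at hA; omega)]
      rw [h1]
      exact denote_nat_of_notMem (fun h => hA (List.mem_cons_of_mem _ (writes_plan h))) _
    have hρ₀ : ∀ A, A ∉ [3, 2, 20, 21, 22, 23, 24, 40, 41, 42, 43, 44, 45, 46, 47] →
        ρ.nat A = σ₀.nat A := by
      intro A hA
      simp only [List.mem_cons, List.not_mem_nil, or_false, not_or] at hA
      rw [hρ' A (by simp; omega), hs.nat A (by omega) (by omega) (by omega)]
    have ht' : time I.f respond ρ ≤ cost B respond := time_le_cost wf_respond fun u hu => by
      obtain ⟨hu', hu''⟩ := bounds_respond u hu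
      refine ⟨hu'', ?_⟩
      refine bd ρ (fun A hA => hρ₀ A ?_) u hu'
      simp only [List.mem_cons, List.not_mem_nil, or_false] at hA ⊢
      omega
    obtain ⟨v, hv⟩ := Nat.exists_eq_add_of_le (ht'.trans (htime _ (by omega : _ ≤ C * B ^ d)))
    refine ⟨denote I.f respond ρ, ?_, ?_⟩
    · change runFor I.f t ([respond.compile], ρ) = _
      rw [hv, steps_compile (f := I.f) wf_respond ρ, runFor_nil]
    · have hTρ : Tables.ofMem I.numY ρ = T := Tables.ofMem_congr fun A hA => hρ₀ A (by
        simp only [List.mem_cons, List.not_mem_nil, or_false] at hA ⊢; omega)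
      have hhist : ρ.nat aHist 0 = (denote I.f plan τ).nat aHist 0 := by
        ext j; simp [hρ, SeedingInstance.reveal]
      have hQ : ρ.row I.numY aRevealed 0 = Q := by
        ext y; simp [Mem.mem_row, hρ, SeedingInstance.reveal]
      rw [SeedingInstance.secondStage, respond_spec (by rw [hρ₀ _ (by decide), hR.numY])
        (by rw [hρ₀ _ (by decide), hR.zero]) (by
          ext y; simp [Mem.mem_row, hρ₀ 4 (by decide), hR.second]), hTρ, hhist, hQ,
        hρ' _ (by decide), er]

/-! ### Independent random sets -/

section Prod

variable {ι : Type*} [DecidableEq ι]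

/-- The expectation of `H` over a random subset of `s` that contains every element `y`
independently with probability `p y`. -/
noncomputable def expect (p : ι → ℝ) (s : Finset ι) (H : Finset ι → ℝ) : ℝ :=
  prodSum p (fun y => 1 - p y) s H

theorem expect_empty (p : ι → ℝ) (H : Finset ι → ℝ) : expect p ∅ H = H ∅ := prodSum_empty _ _ _

theorem expect_insert (p : ι → ℝ) {s : Finset ι} {y : ι} (hy : y ∉ s) (H : Finset ι → ℝ) :
    expect p (insert y s) H = (1 - p y) * expect p s H + p y * expect p s fun R => H (insert y R) :=
  prodSum_insert _ _ hy H

theorem expect_congr {p p' : ι → ℝ} {s : Finset ι} {H H' : Finset ι → ℝ}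
    (hp : ∀ y ∈ s, p y = p' y) (hH : ∀ R ⊆ s, H R = H' R) : expect p s H = expect p' s H' :=
  prodSum_congr hp (fun y hy => by rw [hp y hy]) hH

theorem expect_add (p : ι → ℝ) (s : Finset ι) (H H' : Finset ι → ℝ) :
    (expect p s fun R => H R + H' R) = expect p s H + expect p s H' := by
  simp only [expect, prodSum, mul_add, Finset.sum_add_distrib]

theorem expect_const_mul (p : ι → ℝ) (s : Finset ι) (c : ℝ) (H : Finset ι → ℝ) :
    (expect p s fun R => c * H R) = c * expect p s H := by
  simp only [expect, prodSum, Finset.mul_sum]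
  exact Finset.sum_congr rfl fun R _ => by ring

theorem expect_sub (p : ι → ℝ) (s : Finset ι) (H H' : Finset ι → ℝ) :
    (expect p s fun R => H R - H' R) = expect p s H - expect p s H' := by
  simp only [expect, prodSum, mul_sub, Finset.sum_sub_distrib]

theorem expect_sum {κ : Type*} (p : ι → ℝ) (s : Finset ι) (t : Finset κ)
    (H : κ → Finset ι → ℝ) :
    (expect p s fun R => ∑ j ∈ t, H j R) = ∑ j ∈ t, expect p s (H j) := by
  simp only [expect, prodSum, Finset.mul_sum]
  exact Finset.sum_comm

theorem expect_const (p : ι → ℝ) (s : Finset ι) (c : ℝ) : (expect p s fun _ => c) = c := by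
  induction s using Finset.induction_on with
  | empty => rw [expect_empty]
  | insert y s hy ih => rw [expect_insert _ hy, ih]; ring

theorem expect_weight_nonneg {p : ι → ℝ} (hp : ∀ y, p y ∈ Set.Icc (0 : ℝ) 1) (s R : Finset ι) :
    0 ≤ (∏ y ∈ R, p y) * ∏ y ∈ s \ R, (1 - p y) :=
  mul_nonneg (Finset.prod_nonneg fun y _ => (hp y).1)
    (Finset.prod_nonneg fun y _ => sub_nonneg.2 (hp y).2)

theorem expect_mono {p : ι → ℝ} (hp : ∀ y, p y ∈ Set.Icc (0 : ℝ) 1) {s : Finset ι}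
    {H H' : Finset ι → ℝ} (h : ∀ R ⊆ s, H R ≤ H' R) : expect p s H ≤ expect p s H' :=
  Finset.sum_le_sum fun R hR => mul_le_mul_of_nonneg_left (h R (Finset.mem_powerset.1 hR))
    (expect_weight_nonneg hp s R)

theorem expect_nonneg {p : ι → ℝ} (hp : ∀ y, p y ∈ Set.Icc (0 : ℝ) 1) {s : Finset ι}
    {H : Finset ι → ℝ} (h : ∀ R ⊆ s, 0 ≤ H R) : 0 ≤ expect p s H := by
  rw [← expect_const p s 0]
  exact expect_mono hp h

/-- Fubini's theorem for the restrictions to two disjoint sets. -/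
theorem expect_union (p : ι → ℝ) {s t : Finset ι} (h : Disjoint s t) (H : Finset ι → ℝ) :
    expect p (s ∪ t) H = expect p s fun A => expect p t fun B => H (A ∪ B) := by
  induction s using Finset.induction_on generalizing H with
  | empty => simp [expect_empty]
  | insert y s hy ih =>
    rw [Finset.disjoint_insert_left] at h
    rw [Finset.insert_union, expect_insert _ (by simp [hy, h.1]), expect_insert _ hy,
      ih h.2 H, ih h.2 fun R => H (insert y R)]
    simp only [Finset.insert_union]

theorem expect_of_eq_zero {p : ι → ℝ} {s : Finset ι} (h : ∀ y ∈ s, p y = 0) (H : Finset ι → ℝ) :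
    expect p s H = H ∅ := by
  induction s using Finset.induction_on generalizing H with
  | empty => rw [expect_empty]
  | insert y s hy ih =>
    rw [expect_insert _ hy, h y (by simp), ih fun z hz => h z (by simp [hz])]
    ring

/-- A random subset of a random set. -/
theorem expect_expect (p w : ι → ℝ) (s : Finset ι) (H : Finset ι → ℝ) :
    (expect p s fun R => expect w R H) = expect (fun y => w y * p y) s H := by
  induction s using Finset.induction_on generalizing H with
  | empty => simp [expect_empty]
  | insert y s hy ih =>
    have h1 : expect p s (fun R => expect w (insert y R) H) =
        expect p s fun R => (1 - w y) * expect w R H + w y * expect w R fun R => H (insert y R) :=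
      expect_congr (fun _ _ => rfl) fun R hR => expect_insert _ (fun h => hy (hR h)) _
    rw [expect_insert _ hy, expect_insert _ hy, h1, expect_add, expect_const_mul,
      expect_const_mul, ih, ih]
    ring

/-- The probability that an element belongs to the random set. -/
theorem expect_mem (p : ι → ℝ) {s : Finset ι} {y : ι} (hy : y ∈ s) :
    (expect p s fun R => if y ∈ R then 1 else 0) = p y := by
  rw [← Finset.insert_erase hy, expect_insert _ (Finset.notMem_erase y s)]
  have h1 : (expect p (s.erase y) fun R => if y ∈ R then (1 : ℝ) else 0) = 0 := by
    refine (expect_congr (fun _ _ => rfl) fun R hR => if_neg fun h =>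
      Finset.notMem_erase y s (hR h)).trans (expect_const p (s.erase y) 0)
  simp [h1, expect_const]

/-- Nonincreasing functions of independent random bits are positively correlated. -/
theorem expect_mul_le_expect_mul {p : ι → ℝ} (hp : ∀ y, p y ∈ Set.Icc (0 : ℝ) 1) (s : Finset ι)
    {F G : Finset ι → ℝ} (hF : Antitone F) (hG : Antitone G) :
    expect p s F * expect p s G ≤ expect p s fun R => F R * G R := by
  induction s using Finset.induction_on generalizing F G with
  | empty => simp [expect_empty]
  | insert y s hy ih =>
    have ins : Monotone fun R : Finset ι => insert y R :=
      fun A B h => Finset.insert_subset_insert y h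
    rw [expect_insert _ hy, expect_insert _ hy, expect_insert _ hy]
    have h1 := ih hF hG
    have h2 := ih (hF.comp_monotone ins) (hG.comp_monotone ins)
    have h3 : expect p s (fun R => F (insert y R)) ≤ expect p s F :=
      expect_mono hp fun R _ => hF (Finset.subset_insert y R)
    have h4 : expect p s (fun R => G (insert y R)) ≤ expect p s G :=
      expect_mono hp fun R _ => hG (Finset.subset_insert y R)
    have h5 := mul_le_mul_of_nonneg_left h1 (sub_nonneg.2 (hp y).2)
    have h6 := mul_le_mul_of_nonneg_left h2 (hp y).1
    simp only [Function.comp_def] at h6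
    have h7 := mul_nonneg (mul_nonneg (hp y).1 (sub_nonneg.2 (hp y).2))
      (mul_nonneg (sub_nonneg.2 h3) (sub_nonneg.2 h4))
    nlinarith

/-- The variance of the number of elements of a random set in `G`, in the form of the second moment
about an arbitrary number. -/
theorem expect_card_sub_sq (p : ι → ℝ) (s G : Finset ι) (c : ℝ) :
    (expect p s fun U => (((U ∩ G).card : ℝ) - ∑ y ∈ s ∩ G, p y + c) ^ 2) =
      c ^ 2 + ∑ y ∈ s ∩ G, p y * (1 - p y) := by
  induction s using Finset.induction_on generalizing c with
  | empty => simp [expect_empty]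
  | insert y s hy ih =>
    rw [expect_insert _ hy]
    by_cases hG : y ∈ G
    · rw [Finset.insert_inter_of_mem hG, Finset.sum_insert (by simp [hy]),
        Finset.sum_insert (by simp [hy])]
      have h1 : (expect p s fun U => (((U ∩ G).card : ℝ) - (p y + ∑ y ∈ s ∩ G, p y) + c) ^ 2) =
          (c - p y) ^ 2 + ∑ y ∈ s ∩ G, p y * (1 - p y) := by
        rw [← ih (c - p y)]
        exact expect_congr (fun _ _ => rfl) fun U _ => by ring
      have h2 : (expect p s fun U => (((insert y U ∩ G).card : ℝ) -
          (p y + ∑ y ∈ s ∩ G, p y) + c) ^ 2) =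
          (c + 1 - p y) ^ 2 + ∑ y ∈ s ∩ G, p y * (1 - p y) := by
        rw [← ih (c + 1 - p y)]
        refine expect_congr (fun _ _ => rfl) fun U hU => ?_
        rw [Finset.insert_inter_of_mem hG, Finset.card_insert_of_notMem
          (by simp only [Finset.mem_inter, not_and]; exact fun h => absurd (hU h) hy)]
        push_cast
        ring
      rw [h1, h2]
      ring
    · simp only [Finset.insert_inter_of_notMem hG]
      rw [ih]
      ring

/-- Chebyshev's inequality for the number of elements of a random set in `G`. -/
theorem expect_card_ge_le {p : ι → ℝ} (hp : ∀ y, p y ∈ Set.Icc (0 : ℝ) 1) (s G : Finset ι)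
    {b Δ v : ℝ} (hΔ : 0 < Δ) (hb : ∑ y ∈ s ∩ G, p y + Δ ≤ b) (hv : ∑ y ∈ s ∩ G, p y ≤ v) :
    (expect p s fun U => if b ≤ ((U ∩ G).card : ℝ) then 1 else 0) ≤ v / Δ ^ 2 := by
  have h1 := expect_card_sub_sq p s G 0
  have h2 : ∑ y ∈ s ∩ G, p y * (1 - p y) ≤ v := le_trans (Finset.sum_le_sum fun y _ => by
    nlinarith [(hp y).1, (hp y).2]) hv
  rw [le_div_iff₀ (by positivity), mul_comm, ← expect_const_mul]
  refine le_trans (expect_mono hp fun U _ => ?_) (h1.le.trans (by simpa using h2))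
  split_ifs with h
  · rw [mul_one, add_zero]
    exact pow_le_pow_left₀ hΔ.le (by linarith) 2
  · rw [mul_zero]; positivity

end Prod

/-! ### Monotone submodular functions -/

section Submodular

variable {ι : Type*} [DecidableEq ι]

/-- A monotone submodular set function with value zero at the empty set. -/
structure IsMonoSubmodular (f : Finset ι → ℝ) : Prop where
  empty : f ∅ = 0
  mono : Monotone f
  submodular : ∀ A B, f (A ∪ B) ≤ f A + f B - f (A ∩ B)

namespace IsMonoSubmodular

variable {f : Finset ι → ℝ}

theorem nonneg (hf : IsMonoSubmodular f) (A : Finset ι) : 0 ≤ f A := by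
  rw [← hf.empty]; exact hf.mono (Finset.empty_subset A)

/-- Diminishing returns. -/
theorem marginal_le (hf : IsMonoSubmodular f) {A B : Finset ι} (h : A ⊆ B) (T : Finset ι) :
    f (B ∪ T) - f B ≤ f (A ∪ T) - f A := by
  have h1 := hf.submodular (A ∪ T) B
  have h2 : f A ≤ f ((A ∪ T) ∩ B) :=
    hf.mono (Finset.subset_inter Finset.subset_union_left h)
  have h3 : A ∪ T ∪ B = B ∪ T := by
    rw [Finset.union_right_comm, Finset.union_eq_right.2 h]
  rw [h3] at h1
  linarith

/-- The gain from a union is at most the sum of the gains. -/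
theorem union_biUnion_le (hf : IsMonoSubmodular f) {κ : Type*} [DecidableEq κ] (A : Finset ι)
    (s : Finset κ) (T : κ → Finset ι) :
    f (A ∪ s.biUnion T) - f A ≤ ∑ j ∈ s, (f (A ∪ T j) - f A) := by
  induction s using Finset.induction_on with
  | empty => simp
  | insert j s hj ih =>
    rw [Finset.biUnion_insert, Finset.sum_insert hj]
    have h1 := hf.marginal_le (A := A) (B := A ∪ s.biUnion T) Finset.subset_union_left (T j)
    rw [Finset.union_assoc, Finset.union_comm _ (T j)] at h1
    linarith

theorem le_sum (hf : IsMonoSubmodular f) (A : Finset ι) : f A ≤ ∑ y ∈ A, f {y} := by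
  have := hf.union_biUnion_le ∅ A fun y => {y}
  simpa [hf.empty, Finset.biUnion_singleton_eq_self] using this

end IsMonoSubmodular

/-- The derivative of the multilinear extension along a ray is at least the weighted sum of the
gains from the single elements. -/
theorem exists_hasDerivAt_expect {f : Finset ι → ℝ} (hf : Monotone f) {q : ι → ℝ}
    (hq : ∀ y, q y ∈ Set.Icc (0 : ℝ) 1) {t : ℝ} (ht : t ∈ Set.Icc (0 : ℝ) 1) (s : Finset ι) :
    ∀ A, ∃ d, HasDerivAt (fun t => expect (fun y => t * q y) s fun R => f (A ∪ R)) d t ∧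
      ∑ y ∈ s, q y * ((expect (fun y => t * q y) s fun R => f (insert y A ∪ R)) -
        expect (fun y => t * q y) s fun R => f (A ∪ R)) ≤ d := by
  have htq : ∀ y, t * q y ∈ Set.Icc (0 : ℝ) 1 := fun y =>
    ⟨mul_nonneg ht.1 (hq y).1, mul_le_one₀ ht.2 (hq y).1 (hq y).2⟩
  induction s using Finset.induction_on with
  | empty =>
    intro A
    simp only [expect_empty, Finset.sum_empty]
    exact ⟨0, hasDerivAt_const _ _, le_rfl⟩
  | insert y s hy ih =>
    intro A
    have hE : ∀ (t : ℝ) A, (expect (fun y => t * q y) (insert y s) fun R => f (A ∪ R)) =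
        (1 - t * q y) * (expect (fun y => t * q y) s fun R => f (A ∪ R)) +
        t * q y * expect (fun y => t * q y) s fun R => f (insert y A ∪ R) := by
      intro t A
      rw [expect_insert _ hy]
      simp only [Finset.union_insert, Finset.insert_union]
    obtain ⟨d₀, hd₀, hs₀⟩ := ih A
    obtain ⟨d₁, hd₁, hs₁⟩ := ih (insert y A)
    simp only [hE]
    have hlin : HasDerivAt (fun t : ℝ => t * q y) (q y) t := by
      simpa using (hasDerivAt_id t).mul_const (q y)
    refine ⟨_, ((hlin.const_sub 1).mul hd₀).add (hlin.mul hd₁), ?_⟩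
    set Φ : Finset ι → ℝ := fun A => expect (fun y => t * q y) s fun R => f (A ∪ R) with hΦ
    have hΦm : Φ A ≤ Φ (insert y A) := expect_mono htq fun R _ =>
      hf (Finset.union_subset_union_left (Finset.subset_insert y A))
    rw [Finset.sum_insert hy]
    have e1 : ∀ z ∈ s, q z * ((1 - t * q y) * Φ (insert z A) +
        t * q y * Φ (insert y (insert z A)) - ((1 - t * q y) * Φ A + t * q y * Φ (insert y A))) =
        (1 - t * q y) * (q z * (Φ (insert z A) - Φ A)) +
        t * q y * (q z * (Φ (insert z (insert y A)) - Φ (insert y A))) := by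
      intro z _
      rw [Finset.insert_comm y z A]
      ring
    rw [Finset.sum_congr rfl e1, Finset.sum_add_distrib, ← Finset.mul_sum, ← Finset.mul_sum]
    have e2 := mul_le_mul_of_nonneg_left hs₀ (sub_nonneg.2 (htq y).2)
    have e3 := mul_le_mul_of_nonneg_left hs₁ (htq y).1
    have e4 : insert y (insert y A) = insert y A := Finset.insert_idem y A
    simp only [Finset.insert_idem]
    have e5 := mul_nonneg (mul_nonneg (hq y).1 (htq y).1) (sub_nonneg.2 hΦm)
    simp only [hΦ] at e2 e3 e5 ⊢
    linarith

/-- The correlation gap: among the random sets with given marginals, the one with independent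
elements loses at most the factor `1 - 1 / e`. -/
theorem correlation_gap [Fintype ι] {f : Finset ι → ℝ} (hf : IsMonoSubmodular f) {κ : Type*}
    (s : Finset κ) {w : κ → ℝ} (hw : ∀ i, 0 ≤ w i) (hw1 : ∑ i ∈ s, w i = 1) (T : κ → Finset ι)
    {q : ι → ℝ} (hq : ∀ y, q y = ∑ i ∈ s, w i * if y ∈ T i then 1 else 0) :
    (1 - 1 / Real.exp 1) * ∑ i ∈ s, w i * f (T i) ≤ expect q Finset.univ f := by
  have hq01 : ∀ y, q y ∈ Set.Icc (0 : ℝ) 1 := fun y => by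
    rw [hq]
    refine ⟨Finset.sum_nonneg fun i _ => mul_nonneg (hw i) (by split_ifs <;> norm_num), ?_⟩
    refine le_trans (Finset.sum_le_sum fun i _ => ?_) hw1.le
    exact mul_le_of_le_one_right (hw i) (by split_ifs <;> norm_num)
  set g := ∑ i ∈ s, w i * f (T i) with hg
  set F : ℝ → ℝ := fun t => expect (fun y => t * q y) Finset.univ f with hF
  have key : ∀ t ∈ Set.Icc (0 : ℝ) 1, ∃ d, HasDerivAt F d t ∧ g - F t ≤ d := by
    intro t ht
    obtain ⟨d, hd, hle⟩ := exists_hasDerivAt_expect hf.mono hq01 ht Finset.univ ∅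
    simp only [Finset.empty_union] at hd hle
    refine ⟨d, hd, le_trans ?_ hle⟩
    have htq : ∀ y, t * q y ∈ Set.Icc (0 : ℝ) 1 := fun y =>
      ⟨mul_nonneg ht.1 (hq01 y).1, mul_le_one₀ ht.2 (hq01 y).1 (hq01 y).2⟩
    have e1 : ∀ i ∈ s, w i * (f (T i) - F t) ≤ w i * ∑ y ∈ T i,
        ((expect (fun y => t * q y) Finset.univ fun R => f (insert y ∅ ∪ R)) - F t) := by
      intro i _
      refine mul_le_mul_of_nonneg_left ?_ (hw i)
      have e2 : ∑ y ∈ T i, ((expect (fun y => t * q y) Finset.univ fun R =>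
          f (insert y ∅ ∪ R)) - F t) = expect (fun y => t * q y) Finset.univ fun R =>
          ∑ y ∈ T i, (f (insert y ∅ ∪ R) - f R) := by
        rw [expect_sum]
        exact Finset.sum_congr rfl fun y _ => by rw [expect_sub]
      rw [e2]
      have e3 : f (T i) - F t = expect (fun y => t * q y) Finset.univ fun R => f (T i) - f R := by
        rw [expect_sub, expect_const]
      rw [e3]
      refine expect_mono htq fun R _ => ?_
      have e4 := hf.union_biUnion_le R (T i) fun y => {y}
      rw [Finset.biUnion_singleton_eq_self] at e4
      have e5 : f (T i) ≤ f (R ∪ T i) := hf.mono Finset.subset_union_right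
      refine le_trans (by linarith) (e4.trans_eq (Finset.sum_congr rfl fun y _ => ?_))
      rw [Finset.union_comm R]
      rfl
    have e6 : g - F t = ∑ i ∈ s, w i * (f (T i) - F t) := by
      simp only [mul_sub, Finset.sum_sub_distrib, ← Finset.sum_mul, hw1, one_mul, hg]
    rw [e6]
    refine (Finset.sum_le_sum e1).trans_eq ?_
    have e7 : ∀ h : ι → ℝ, ∑ y, q y * h y = ∑ i ∈ s, w i * ∑ y ∈ T i, h y := by
      intro h
      simp only [hq, Finset.sum_mul]
      rw [Finset.sum_comm]
      refine Finset.sum_congr rfl fun i _ => ?_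
      rw [Finset.mul_sum, ← Finset.sum_filter_add_sum_filter_not Finset.univ (· ∈ T i)]
      rw [Finset.sum_eq_zero (s := Finset.univ.filter fun y => ¬ y ∈ T i) fun y hy => by
        rw [if_neg (Finset.mem_filter.1 hy).2]; ring, add_zero]
      simp only [Finset.filter_mem_eq_inter, Finset.univ_inter]
      exact Finset.sum_congr rfl fun y hy => by rw [if_pos hy, mul_one]
    exact (e7 _).symm
  choose! d hd hdle using key
  -- `F` increases from `0` at a rate of at least `g - F`, so this product is nondecreasing
  have hmono : MonotoneOn (fun t => Real.exp t * (F t - g)) (Set.Icc 0 1) := by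
    have hd' : ∀ t ∈ Set.Icc (0 : ℝ) 1, HasDerivAt (fun t => Real.exp t * (F t - g))
        (Real.exp t * (F t - g) + Real.exp t * d t) t := fun t ht =>
      (Real.hasDerivAt_exp t).mul ((hd t ht).sub_const g)
    refine monotoneOn_of_deriv_nonneg (convex_Icc 0 1)
      (fun t ht => (hd' t ht).continuousAt.continuousWithinAt)
      (fun t ht => (hd' t (interior_subset ht)).differentiableAt.differentiableWithinAt)
      fun t ht => ?_
    have ht' := interior_subset ht
    rw [(hd' t ht').deriv, ← mul_add]
    exact mul_nonneg (Real.exp_pos t).le (by linarith [hdle t ht'])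
  have h01 := hmono (Set.left_mem_Icc.2 zero_le_one) (Set.right_mem_Icc.2 zero_le_one) zero_le_one
  have hF0 : F 0 = 0 := by
    rw [hF]
    simp only [zero_mul]
    rw [expect_of_eq_zero (fun _ _ => rfl), hf.empty]
  have hF1 : F 1 = expect q Finset.univ f := by simp [hF]
  simp only [Real.exp_zero, one_mul, hF0, zero_sub, hF1] at h01
  have he := Real.exp_pos 1
  rw [sub_mul, one_mul, div_mul_eq_mul_div, one_mul, sub_le_iff_le_add, ← sub_le_iff_le_add',
    le_div_iff₀ he]
  linarith

end Submodular

/-! ### Contention resolution -/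

section

variable {ι : Type*} [DecidableEq ι]

/-- A scheme `T` that discards elements of a random set, each with conditional probability at most
`ε`, and that discards more from larger sets, preserves the expected value of a monotone submodular
function up to a factor `1 - ε`. The elements are exposed one after the other; the gain from an
element and the event that it is kept are both nonincreasing in the random set. -/
theorem expect_contention {f : Finset ι → ℝ} (hf : IsMonoSubmodular f) {q : ι → ℝ}
    (hq : ∀ y, q y ∈ Set.Icc (0 : ℝ) 1) (s : Finset ι) {T : Finset ι → Finset ι}
    (hT : ∀ U, T U ⊆ U) (hmono : ∀ U U', U ⊆ U' → ∀ y ∈ U, y ∈ T U' → y ∈ T U) {ε : ℝ}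
    (h : ∀ y ∈ s, 1 - ε ≤ expect q (s.erase y) fun U => if y ∈ T (insert y U) then 1 else 0) :
    (1 - ε) * expect q s f ≤ expect q s fun U => f (T U) := by
  have key : ∀ W ⊆ s, (1 - ε) * (expect q s fun U => f (U ∩ W)) ≤
      expect q s fun U => f (T U ∩ W) := by
    intro W
    induction W using Finset.induction_on with
    | empty => simp [hf.empty, expect_const]
    | insert y W hy ih =>
      intro hW
      have hys : y ∈ s := hW (by simp)
      have hW' := ih fun z hz => hW (by simp [hz])
      -- the gain from `y` over the elements exposed before
      set Δ : Finset ι → ℝ := fun A => f ((A ∩ W) ∪ {y}) - f (A ∩ W) with hΔ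
      have hΔ0 : ∀ A, 0 ≤ Δ A := fun A => sub_nonneg.2 (hf.mono Finset.subset_union_left)
      have hΔa : Antitone Δ := fun A B hAB =>
        hf.marginal_le (Finset.inter_subset_inter_right hAB) {y}
      have hins : ∀ A : Finset ι, A ∩ insert y W = if y ∈ A then (A ∩ W) ∪ {y} else A ∩ W := by
        intro A
        split_ifs with hA
        · rw [Finset.inter_insert_of_mem hA, Finset.union_comm]; rfl
        · rw [Finset.inter_insert_of_notMem hA]
      have e1 : (expect q s fun U => f (U ∩ insert y W)) =
          (expect q s fun U => f (U ∩ W)) + q y * expect q (s.erase y) Δ := by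
        have : ∀ U : Finset ι, f (U ∩ insert y W) = f (U ∩ W) + if y ∈ U then Δ U else 0 := by
          intro U
          rw [hins]
          split_ifs <;> simp [hΔ]
        simp only [this]
        rw [expect_add]
        congr 1
        nth_rw 1 [← Finset.insert_erase hys]
        rw [expect_insert _ (Finset.notMem_erase y s)]
        have h0 : (expect q (s.erase y) fun U => if y ∈ U then Δ U else 0) = 0 :=
          (expect_congr (fun _ _ => rfl) fun R hR => if_neg fun h =>
            Finset.notMem_erase y s (hR h)).trans (expect_const q (s.erase y) 0)
        rw [h0, mul_zero, zero_add]
        congr 1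
        refine expect_congr (fun _ _ => rfl) fun R _ => ?_
        rw [if_pos (by simp)]
        simp only [hΔ, Finset.insert_inter_of_notMem hy]
      have e2 : (expect q s fun U => f (T U ∩ W)) + q y * (expect q (s.erase y) fun U =>
          (if y ∈ T (insert y U) then 1 else 0) * Δ U) ≤
          expect q s fun U => f (T U ∩ insert y W) := by
        have : ∀ U : Finset ι, f (T U ∩ W) + (if y ∈ T U then 1 else 0) * Δ U ≤
            f (T U ∩ insert y W) := by
          intro U
          rw [hins]
          split_ifs
          · have := hf.marginal_le (Finset.inter_subset_inter_right (u := W) (hT U)) {y}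
            simp only [hΔ]
            linarith
          · simp
        refine le_trans (le_of_eq ?_) (expect_mono hq fun U _ => this U)
        rw [expect_add]
        congr 1
        conv_rhs => rw [← Finset.insert_erase hys]
        rw [expect_insert _ (Finset.notMem_erase y s)]
        have h0 : (expect q (s.erase y) fun U => (if y ∈ T U then 1 else 0) * Δ U) = 0 := by
          refine (expect_congr (fun _ _ => rfl) fun R hR => ?_).trans
            (expect_const q (s.erase y) 0)
          rw [if_neg fun h => Finset.notMem_erase y s (hR (hT R h)), zero_mul]
        rw [h0, mul_zero, zero_add]
        congr 1
        refine expect_congr (fun _ _ => rfl) fun R _ => ?_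
        simp only [hΔ, Finset.insert_inter_of_notMem hy]
      have e3 := expect_mul_le_expect_mul hq (s.erase y)
        (F := fun U => if y ∈ T (insert y U) then 1 else 0) (G := Δ) (fun A B hAB => by
          beta_reduce
          split_ifs with h1 h2
          · exact le_rfl
          · exact absurd (hmono _ _ (Finset.insert_subset_insert y hAB) y (by simp) h1) h2
          · exact zero_le_one
          · exact le_rfl) hΔa
      have e4 := mul_le_mul_of_nonneg_right (h y hys)
        (expect_nonneg hq (s := s.erase y) fun R _ => hΔ0 R)
      have e5 := mul_le_mul_of_nonneg_left (e4.trans e3) (hq y).1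
      rw [e1]
      linarith
  have h1 := key s subset_rfl
  have h2 : (expect q s fun U => f (U ∩ s)) = expect q s f :=
    expect_congr (fun _ _ => rfl) fun U hU => by rw [Finset.inter_eq_left.2 hU]
  have h3 : (expect q s fun U => f (T U ∩ s)) = expect q s fun U => f (T U) :=
    expect_congr (fun _ _ => rfl) fun U hU => by rw [Finset.inter_eq_left.2 ((hT U).trans hU)]
  rwa [h2, h3] at h1

end

/-! ### Bundles -/

section Bundles

variable {X Y : Type*}

/-- The weight of a bundle of nodes of the first and the second stage: the number of the former plus
the expected number of the latter. -/
noncomputable def bundleWeight (q : Y → ℝ) (B : Finset X × Finset Y) : ℝ :=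
  B.1.card + ∑ y ∈ B.2, q y

/-- A distribution of the second-stage nodes `G` to the bundles in `b :: l`, with every node `y`
accompanied by the first-stage node `x y` of `S`; the bundles in `l` have reached the capacity `c`.
A first-stage node may be repeated in several bundles, and the total weight exceeds that of `S` and
`G` by at most one such repetition for every bundle in `l`. -/
structure Packed (q : Y → ℝ) (c : ℝ) (x : Y → X) (S : Finset X) (G : Finset Y)
    (b : Finset X × Finset Y) (l : List (Finset X × Finset Y)) : Prop where
  weight_le : ∀ B ∈ b :: l, bundleWeight q B ≤ c + 2
  le_weight : ∀ B ∈ l, c ≤ bundleWeight q B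
  sum_le : ((b :: l).map (bundleWeight q)).sum ≤ S.card + ∑ y ∈ G, q y + l.length
  cover : ∀ y ∈ G, ∃ B ∈ b :: l, y ∈ B.2
  accompanied : ∀ B ∈ b :: l, ∀ y ∈ B.2, x y ∈ B.1

variable {q : Y → ℝ} {c : ℝ} {x : Y → X} {S : Finset X} {G : Finset Y} {b : Finset X × Finset Y}
  {l : List (Finset X × Finset Y)}

/-- A first-stage node is added to the current bundle, or opens a new one. -/
theorem Packed.insert_first [DecidableEq X] (hc : 0 ≤ c) (h : Packed q c x S G b l)
    {z : X} (hz : z ∉ S) :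
    ∃ b' l', Packed q c x (insert z S) G b' l' ∧ z ∈ b'.1 := by
  obtain ⟨h1, h2, h3, h4, h5⟩ := h
  rw [List.forall_mem_cons] at h1 h5
  simp only [List.map_cons, List.sum_cons, List.exists_mem_cons_iff] at h3 h4
  by_cases hb : bundleWeight q b < c
  · have hw : bundleWeight q (insert z b.1, b.2) ≤ bundleWeight q b + 1 := by
      simp only [bundleWeight]
      have : ((insert z b.1).card : ℝ) ≤ b.1.card + 1 := by exact_mod_cast Finset.card_insert_le _ _
      linarith
    refine ⟨(insert z b.1, b.2), l, ⟨?_, h2, ?_, ?_, ?_⟩, by simp⟩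
    · rw [List.forall_mem_cons]
      exact ⟨by linarith, h1.2⟩
    · simp only [List.map_cons, List.sum_cons]
      rw [Finset.card_insert_of_notMem hz]
      push_cast
      linarith
    · simpa only [List.exists_mem_cons_iff] using h4
    · rw [List.forall_mem_cons]
      exact ⟨fun y hy => by simp [h5.1 y hy], h5.2⟩
  · have hw : bundleWeight q (({z}, ∅) : Finset X × Finset Y) = 1 := by simp [bundleWeight]
    refine ⟨({z}, ∅), b :: l, ⟨?_, ?_, ?_, ?_, ?_⟩, by simp⟩
    · rw [List.forall_mem_cons, List.forall_mem_cons]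
      exact ⟨by linarith, h1⟩
    · rw [List.forall_mem_cons]
      exact ⟨not_lt.1 hb, h2⟩
    · simp only [List.map_cons, List.sum_cons, List.length_cons]
      rw [Finset.card_insert_of_notMem hz]
      push_cast
      linarith
    · simp only [List.exists_mem_cons_iff]
      exact fun y hy => .inr (h4 y hy)
    · rw [List.forall_mem_cons, List.forall_mem_cons]
      exact ⟨by simp, h5⟩

/-- A second-stage node is added to the current bundle, which contains its first-stage node, or
opens a new one in which that first-stage node is repeated. -/
theorem Packed.insert_second [DecidableEq Y] (hc : 0 ≤ c) (hq : ∀ y, q y ∈ Set.Icc (0 : ℝ) 1)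
    (h : Packed q c x S G b l) {y : Y} (hy : y ∉ G) (hx : x y ∈ b.1) :
    ∃ b' l', Packed q c x S (insert y G) b' l' ∧ x y ∈ b'.1 := by
  obtain ⟨h1, h2, h3, h4, h5⟩ := h
  rw [List.forall_mem_cons] at h1 h5
  simp only [List.map_cons, List.sum_cons, List.exists_mem_cons_iff] at h3 h4
  have hq' := hq y
  by_cases hb : bundleWeight q b < c
  · have hw : bundleWeight q (b.1, insert y b.2) ≤ bundleWeight q b + q y := by
      simp only [bundleWeight]
      by_cases hyb : y ∈ b.2
      · rw [Finset.insert_eq_of_mem hyb]; linarith [hq'.1]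
      · rw [Finset.sum_insert hyb]; linarith
    refine ⟨(b.1, insert y b.2), l, ⟨?_, h2, ?_, ?_, ?_⟩, hx⟩
    · rw [List.forall_mem_cons]
      exact ⟨by linarith [hq'.2], h1.2⟩
    · simp only [List.map_cons, List.sum_cons]
      rw [Finset.sum_insert hy]
      linarith
    · simp only [List.exists_mem_cons_iff]
      intro w hw
      rcases Finset.mem_insert.1 hw with rfl | hw
      · exact .inl (by simp)
      · exact (h4 w hw).imp_left fun h => by simp [h]
    · rw [List.forall_mem_cons]
      refine ⟨fun w hw => ?_, h5.2⟩
      rcases Finset.mem_insert.1 hw with rfl | hw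
      · exact hx
      · exact h5.1 w hw
  · have hw : bundleWeight q (({x y}, {y}) : Finset X × Finset Y) = 1 + q y := by
      simp [bundleWeight]
    refine ⟨({x y}, {y}), b :: l, ⟨?_, ?_, ?_, ?_, ?_⟩, by simp⟩
    · rw [List.forall_mem_cons, List.forall_mem_cons]
      exact ⟨by linarith [hq'.2], h1⟩
    · rw [List.forall_mem_cons]
      exact ⟨not_lt.1 hb, h2⟩
    · simp only [List.map_cons, List.sum_cons, List.length_cons]
      rw [Finset.sum_insert hy]
      push_cast
      linarith
    · simp only [List.exists_mem_cons_iff]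
      intro w hw
      rcases Finset.mem_insert.1 hw with rfl | hw
      · exact .inl (by simp)
      · exact .inr (h4 w hw)
    · rw [List.forall_mem_cons, List.forall_mem_cons]
      exact ⟨by simp, h5⟩

/-- The nodes are packed greedily, a first-stage node immediately before its second-stage nodes. -/
theorem exists_packed [DecidableEq X] [DecidableEq Y] (hc : 0 ≤ c)
    (hq : ∀ y, q y ∈ Set.Icc (0 : ℝ) 1) (S : Finset X) (G : Finset Y)
    (hx : ∀ y ∈ G, x y ∈ S) : ∃ b l, Packed q c x S G b l := by
  have key : ∀ S : Finset X, ∃ b l, Packed q c x S (G.filter fun y => x y ∈ S) b l := by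
    intro S
    induction S using Finset.induction_on with
    | empty =>
      exact ⟨(∅, ∅), [], ⟨by simp [bundleWeight]; linarith, by simp, by simp [bundleWeight],
        by simp, by simp⟩⟩
    | insert z S hz ih =>
      obtain ⟨b, l, h⟩ := ih
      have inner : ∀ F : Finset Y, F ⊆ G.filter (fun y => x y = z) → ∃ b l,
          Packed q c x (insert z S) ((G.filter fun y => x y ∈ S) ∪ F) b l ∧ z ∈ b.1 := by
        intro F
        induction F using Finset.induction_on with
        | empty =>
          intro _
          rw [Finset.union_empty]
          exact h.insert_first hc hz
        | insert y F hy ih =>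
          intro hF
          obtain ⟨b, l, h, hb⟩ := ih fun w hw => hF (by simp [hw])
          obtain rfl := (Finset.mem_filter.1 (hF (Finset.mem_insert_self y F))).2
          rw [Finset.union_insert]
          refine h.insert_second hc hq ?_ hb
          simp [hy, hz]
      obtain ⟨b, l, h, -⟩ := inner _ subset_rfl
      refine ⟨b, l, ?_⟩
      rw [← Finset.filter_or] at h
      convert! h using 2
      rw [Finset.mem_insert, or_comm]
  obtain ⟨b, l, h⟩ := key S
  rw [Finset.filter_true_of_mem hx] at h
  exact ⟨b, l, h⟩

/-- The number of bundles. -/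
theorem Packed.length_mul_le (h : Packed q c x S G b l) (hq : ∀ y, q y ∈ Set.Icc (0 : ℝ) 1) :
    (l.length : ℝ) * (c - 1) ≤ S.card + ∑ y ∈ G, q y := by
  have h1 : (l.length : ℝ) * c ≤ (l.map (bundleWeight q)).sum := by
    have := List.card_nsmul_le_sum (l.map (bundleWeight q)) c (by
      intro w hw
      obtain ⟨B, hB, rfl⟩ := List.mem_map.1 hw
      exact h.le_weight B hB)
    simpa using this
  have h2 : 0 ≤ bundleWeight q b :=
    add_nonneg (Nat.cast_nonneg _) (Finset.sum_nonneg fun y _ => (hq y).1)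
  have h3 := h.sum_le
  rw [List.map_cons, List.sum_cons] at h3
  linarith

end Bundles

/-! ### Discarding overfull bundles -/

section Trim

variable {ι κ : Type*} [DecidableEq ι]

/-- The part of `U` in the `j`-th bundle, discarded if it exceeds the bound. -/
def trimPart (G : κ → Finset ι) (b : κ → ℕ) (U : Finset ι) (j : κ) : Finset ι :=
  if (U ∩ G j).card ≤ b j then U ∩ G j else ∅

/-- The union of the parts of `U` that are not discarded. -/
def trim [Fintype κ] (G : κ → Finset ι) (b : κ → ℕ) (U : Finset ι) : Finset ι :=
  Finset.univ.biUnion (trimPart G b U)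

theorem mem_trim [Fintype κ] {G : κ → Finset ι} {b : κ → ℕ} {U : Finset ι} {y : ι} :
    y ∈ trim G b U ↔ ∃ j, (U ∩ G j).card ≤ b j ∧ y ∈ U ∩ G j := by
  simp only [trim, trimPart, Finset.mem_biUnion, Finset.mem_univ, true_and]
  refine exists_congr fun j => ?_
  split_ifs with h <;> simp [h]

theorem trim_subset [Fintype κ] (G : κ → Finset ι) (b : κ → ℕ) (U : Finset ι) :
    trim G b U ⊆ U := fun _ hy => by
  obtain ⟨j, -, h⟩ := mem_trim.1 hy
  exact Finset.mem_of_mem_inter_left h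

theorem trimPart_subset (G : κ → Finset ι) (b : κ → ℕ) (U : Finset ι) (j : κ) :
    trimPart G b U j ⊆ U ∩ G j := by
  rw [trimPart]
  split_ifs
  · exact subset_rfl
  · exact Finset.empty_subset _

theorem card_trimPart_le (G : κ → Finset ι) (b : κ → ℕ) (U : Finset ι) (j : κ) :
    (trimPart G b U j).card ≤ b j := by
  rw [trimPart]
  split_ifs with h
  · exact h
  · simp

theorem expect_univ [Fintype ι] {p : ι → ℝ} {s : Finset ι} (h : ∀ y ∉ s, p y = 0)
    (H : Finset ι → ℝ) : expect p Finset.univ H = expect p s H := by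
  rw [← Finset.union_compl s, expect_union _ disjoint_compl_right]
  refine expect_congr (fun _ _ => rfl) fun R _ => ?_
  rw [expect_of_eq_zero fun y hy => h y (Finset.mem_compl.1 hy), Finset.union_empty]

/-- Discarding overfull bundles loses little if the bounds exceed the expected sizes by `Δ`: given
that an element is present, Chebyshev's inequality bounds the probability that its bundle is
overfull. -/
theorem expect_trim [Fintype ι] [Fintype κ] {f : Finset ι → ℝ} (hf : IsMonoSubmodular f) {q : ι → ℝ}
    (hq : ∀ y, q y ∈ Set.Icc (0 : ℝ) 1) {G : κ → Finset ι} {b : κ → ℕ}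
    (hG : ∀ y, q y ≠ 0 → ∃ j, y ∈ G j) {Δ v : ℝ} (hΔ : 0 < Δ)
    (hb : ∀ j, ∑ y ∈ G j, q y + Δ ≤ b j) (hv : ∀ j, ∑ y ∈ G j, q y ≤ v) :
    (1 - v / Δ ^ 2) * expect q Finset.univ f ≤ expect q Finset.univ fun U => f (trim G b U) := by
  classical
  have h0 : ∀ y ∉ Finset.univ.filter (fun y => ∃ j, y ∈ G j), q y = 0 := fun y hy => by
    by_contra h
    exact hy (by simpa using hG y h)
  rw [expect_univ h0, expect_univ h0]
  refine expect_contention hf hq _ (trim_subset G b) (fun U U' hU y hy hy' => ?_) fun y hy => ?_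
  · obtain ⟨j, h1, h2⟩ := mem_trim.1 hy'
    exact mem_trim.2 ⟨j, (Finset.card_le_card (Finset.inter_subset_inter_right hU)).trans h1,
      Finset.mem_inter.2 ⟨hy, Finset.mem_of_mem_inter_right h2⟩⟩
  · obtain ⟨j, hj⟩ : ∃ j, y ∈ G j := by simpa using hy
    set s := (Finset.univ.filter (fun y => ∃ j, y ∈ G j)).erase y
    have hs : ∑ z ∈ s ∩ G j, q z ≤ ∑ z ∈ G j, q z :=
      Finset.sum_le_sum_of_subset_of_nonneg Finset.inter_subset_right fun z _ _ => (hq z).1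
    have h1 := expect_card_ge_le hq s (G j) hΔ (b := b j) (v := v) (by linarith [hb j])
      (hs.trans (hv j))
    have h2 : (expect q s fun U => 1 - if y ∈ trim G b (insert y U) then (1 : ℝ) else 0) ≤
        expect q s fun U => if (b j : ℝ) ≤ ((U ∩ G j).card : ℝ) then 1 else 0 := by
      refine expect_mono hq fun U _ => ?_
      by_cases hm : y ∈ trim G b (insert y U)
      · rw [if_pos hm]
        split_ifs <;> norm_num
      · rw [if_neg hm, if_pos, sub_zero]
        by_contra hlt
        rw [not_le, Nat.cast_lt] at hlt
        refine hm (mem_trim.2 ⟨j, ?_, by simp [hj]⟩)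
        rw [Finset.insert_inter_of_mem hj]
        exact (Finset.card_insert_le _ _).trans hlt
    rw [expect_sub, expect_const] at h2
    linarith

end Trim

/-! ### The tables and the rounds -/

section Improve

variable {n : ℕ} {f : Finset (Fin n) → ℝ} {t : ℕ → Finset (Fin n)} {ok : ℕ → Prop}
  [DecidablePred ok] {A : Finset (Fin n)}

theorem improve_eq_or (c : ℕ) :
    improve f t ok A c = A ∨ ∃ i < c, ok i ∧ improve f t ok A c = A ∪ t i := by
  induction c with
  | zero => exact .inl rfl
  | succ c ih =>
    rw [improve]
    split_ifs with h
    · exact .inr ⟨c, by omega, h.1, rfl⟩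
    · exact ih.imp_right fun ⟨i, h1, h2⟩ => ⟨i, by omega, h2⟩

theorem le_improve (c : ℕ) : f A ≤ f (improve f t ok A c) := by
  induction c with
  | zero => exact le_rfl
  | succ c ih =>
    rw [improve]
    split_ifs with h
    · exact ih.trans h.2.le
    · exact ih

theorem union_le_improve {c i : ℕ} (hi : i < c) (hok : ok i) :
    f (A ∪ t i) ≤ f (improve f t ok A c) := by
  induction c with
  | zero => omega
  | succ c ih =>
    rw [improve]
    rcases Nat.lt_succ_iff_lt_or_eq.1 hi with hi | rfl
    · split_ifs with h
      · exact (ih hi).trans h.2.le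
      · exact ih hi
    · split_ifs with h
      · exact le_rfl
      · exact not_lt.1 fun h' => h ⟨hok, h'⟩

end Improve

namespace Tables

variable {n : ℕ} (T : Tables n) (f : Finset (Fin n) → ℝ)

open Classical in
theorem step_eq_or (q : ℕ) (R A : Finset (Fin n)) : T.step f q R A = A ∨ ∃ i < T.cY,
    (T.tY i ⊆ R ∩ T.cov q ∧ T.sY i + T.sX q ≤ T.cost) ∧ T.step f q R A = A ∪ T.tY i :=
  improve_eq_or _

theorem le_step (q : ℕ) (R A : Finset (Fin n)) : f A ≤ f (T.step f q R A) := le_improve _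

variable {f}

theorem union_le_step {q i : ℕ} {R A : Finset (Fin n)} (hi : i < T.cY)
    (h : T.tY i ⊆ R ∩ T.cov q) (hs : T.sY i + T.sX q ≤ T.cost) :
    f (A ∪ T.tY i) ≤ f (T.step f q R A) := by
  classical
  exact union_le_improve hi ⟨h, hs⟩

theorem step_congr {q : ℕ} {R R' : Finset (Fin n)} (h : R ∩ T.cov q = R' ∩ T.cov q)
    (A : Finset (Fin n)) : T.step f q R A = T.step f q R' A := by
  simp only [step, h]

theorem sim_inter {h : ℕ → ℕ} {m : ℕ} {W : Finset (Fin n)} (hW : ∀ k < m, T.cov (h k) ⊆ W)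
    (R : Finset (Fin n)) : T.sim f h (R ∩ W) m = T.sim f h R m := by
  induction m with
  | zero => rfl
  | succ m ih =>
    rw [sim, sim, ih fun k hk => hW k (by omega)]
    refine T.step_congr ?_ _
    rw [Finset.inter_assoc, Finset.inter_eq_right.2 (hW m (by omega))]

theorem sim_subset (h : ℕ → ℕ) (R : Finset (Fin n)) (m : ℕ) :
    T.sim f h R m ⊆ R ∩ (Finset.range m).biUnion fun k => T.cov (h k) := by
  induction m with
  | zero => simp [sim]
  | succ m ih =>
    have ih' : T.sim f h R m ⊆ R ∩ (Finset.range (m + 1)).biUnion fun k => T.cov (h k) :=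
      ih.trans (Finset.inter_subset_inter_left
        (Finset.biUnion_subset_biUnion_of_subset_left _ (Finset.range_subset_range.2 (by omega))))
    rw [sim]
    rcases T.step_eq_or f (h m) R (T.sim f h R m) with h1 | ⟨i, -, ⟨h1, -⟩, h2⟩
    · rwa [h1]
    · rw [h2]
      refine Finset.union_subset ih' (h1.trans (Finset.inter_subset_inter_left ?_))
      exact Finset.subset_biUnion_of_mem (fun k => T.cov (h k)) (Finset.mem_range.2 (by omega))

theorem card_sim_le {h : ℕ → ℕ} {m : ℕ} (hs : ∀ i < T.cY, (T.tY i).card ≤ T.sY i)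
    (hc : ∀ k < m, T.sX (h k) ≤ T.cost) (R : Finset (Fin n)) :
    (T.sim f h R m).card + ∑ k ∈ Finset.range m, T.sX (h k) ≤ m * T.cost := by
  induction m with
  | zero => simp [sim]
  | succ m ih =>
    have h1 := ih fun k hk => hc k (by omega)
    rw [Finset.sum_range_succ, sim, add_mul, one_mul]
    rcases T.step_eq_or f (h m) R (T.sim f h R m) with h2 | ⟨i, hi, ⟨-, h2⟩, h3⟩
    · rw [h2]
      have := hc m (by omega)
      omega
    · rw [h3]
      have := Finset.card_union_le (T.sim f h R m) (T.tY i)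
      have := hs i hi
      omega

/-- If only one of the realized nodes is taken into account, then the value is not larger. -/
theorem sim_singleton_le (hf : IsMonoSubmodular f) (h : ℕ → ℕ) {R : Finset (Fin n)} {y : Fin n}
    (hy : y ∈ R) (m : ℕ) : f (T.sim f h {y} m) ≤ f (T.sim f h R m) := by
  induction m with
  | zero => exact le_rfl
  | succ m ih =>
    rw [sim, sim]
    rcases T.step_eq_or f (h m) {y} (T.sim f h {y} m) with h1 | ⟨i, hi, ⟨h1, h2⟩, h3⟩
    · rw [h1]
      exact ih.trans (T.le_step f _ _ _)
    · rw [h3]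
      have h4 : T.sim f h {y} m ⊆ {y} := (T.sim_subset h {y} m).trans Finset.inter_subset_left
      rcases Finset.subset_singleton_iff.1 (h1.trans Finset.inter_subset_left) with h5 | h5
      · rw [h5, Finset.union_empty]
        exact ih.trans (T.le_step f _ _ _)
      · have h6 : T.sim f h {y} m ∪ T.tY i = T.tY i := by rw [h5]; exact Finset.union_eq_right.2 h4
        rw [h6]
        refine le_trans (hf.mono Finset.subset_union_right) (T.union_le_step (A := T.sim f h R m) hi
          (Finset.subset_inter ?_ (h1.trans Finset.inter_subset_right)) h2)
        rw [h5]
        exact Finset.singleton_subset_iff.2 hy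

end Tables

namespace SeedingInstance

variable (I : SeedingInstance)

theorem isMonoSubmodular : IsMonoSubmodular I.f :=
  ⟨I.f_empty, fun _ _ h => I.f_mono _ _ h, I.f_submodular⟩

variable {I} {M N : ℕ} {S : ℕ → Finset (Fin I.numY)}

theorem rareProb_nonneg (y : Fin I.numY) : 0 ≤ I.rareProb M y := by
  rw [rareProb]; split_ifs
  · exact le_rfl
  · exact I.prob_nonneg y

theorem estimate_mono {g g' : Finset (Fin I.numY) → ℝ} (h : ∀ R, g R ≤ g' R) :
    I.estimate M N S g ≤ I.estimate M N S g' := by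
  rw [estimate, estimate]
  gcongr with s _ y _
  · exact h _
  · exact rareProb_nonneg y
  · exact h _

theorem estimate_sub (g g' : Finset (Fin I.numY) → ℝ) :
    I.estimate M N S (fun R => g R - g' R) = I.estimate M N S g - I.estimate M N S g' := by
  simp only [estimate, mul_sub, Finset.sum_sub_distrib]
  ring

theorem estimate_sum {κ : Type*} (s : Finset κ) (g : κ → Finset (Fin I.numY) → ℝ) :
    I.estimate M N S (fun R => ∑ j ∈ s, g j R) = ∑ j ∈ s, I.estimate M N S (g j) := by
  simp only [estimate, Finset.mul_sum, Finset.sum_add_distrib]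
  rw [Finset.sum_comm, Finset.sum_comm (s := Finset.univ)]

end SeedingInstance

/-- The greedy choice is compared with a family of candidates that together gain, in every scenario,
at least the difference to `c`. -/
theorem Tables.Greedy.le_estimate {I : SeedingInstance} {T : Tables I.numY} {M N m : ℕ}
    {S : ℕ → Finset (Fin I.numY)} {h : ℕ → ℕ} (hg : T.Greedy M N S h m) {κ : Type*} [Fintype κ]
    [Nonempty κ] {q : κ → ℕ} (hq : ∀ j, q j < T.cX ∧ T.sX (q j) ≤ T.cost)
    {c : Finset (Fin I.numY) → ℝ} (hc : ∀ R A, c R - I.f A ≤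
      ∑ j, (I.f (T.step I.f (q j) R A) - I.f A)) :
    (1 - (1 - 1 / (Fintype.card κ : ℝ)) ^ m) * I.estimate M N S c ≤
      I.estimate M N S fun R => I.f (T.sim I.f h R m) := by
  set J : ℝ := (Fintype.card κ : ℝ) with hJ
  have hJ1 : 1 ≤ J := by rw [hJ]; exact_mod_cast Fintype.card_pos
  set V : ℕ → ℝ := fun k => I.estimate M N S fun R => I.f (T.sim I.f h R k) with hV
  -- the best candidate closes at least the average share `1 / J` of the gap
  have step : ∀ k < m, I.estimate M N S c - V (k + 1) ≤
      (1 - 1 / J) * (I.estimate M N S c - V k) := by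
    intro k hk
    have h1 : I.estimate M N S c - V k ≤ ∑ _j : κ, (V (k + 1) - V k) := by
      rw [hV]
      beta_reduce
      rw [← SeedingInstance.estimate_sub]
      refine (SeedingInstance.estimate_mono fun R => hc R (T.sim I.f h R k)).trans ?_
      rw [SeedingInstance.estimate_sum]
      refine Finset.sum_le_sum fun j _ => ?_
      rw [SeedingInstance.estimate_sub]
      exact sub_le_sub_right ((hg k hk).2.2 (q j) (hq j).1 (hq j).2) _
    rw [Finset.sum_const, Finset.card_univ, nsmul_eq_mul, ← hJ] at h1
    have h2 : (I.estimate M N S c - V k) / J ≤ V (k + 1) - V k := by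
      rw [div_le_iff₀ (by linarith)]; linarith
    have h3 : (1 - 1 / J) * (I.estimate M N S c - V k) =
        (I.estimate M N S c - V k) - (I.estimate M N S c - V k) / J := by ring
    linarith
  have hJ0 : 0 ≤ 1 - 1 / J := by
    rw [sub_nonneg, div_le_one (by linarith)]; exact hJ1
  have key : ∀ k ≤ m, I.estimate M N S c - V k ≤ (1 - 1 / J) ^ k * I.estimate M N S c := by
    intro k
    induction k with
    | zero =>
      intro _
      have : V 0 = 0 := by simp [hV, Tables.sim, SeedingInstance.estimate, I.f_empty]
      rw [this]; simp
    | succ k ih =>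
      intro hk
      have h1 := step k (by omega)
      have h2 := mul_le_mul_of_nonneg_left (ih (by omega)) hJ0
      rw [pow_succ']
      linarith
  have := key m le_rfl
  rw [hV] at this
  linarith

/-! ### Concentration -/

/-- A bound on the moment generating function of a bounded function of a random set. -/
theorem expect_exp_le {ι : Type*} [DecidableEq ι] {p : ι → ℝ} (hp : ∀ y, p y ∈ Set.Icc (0 : ℝ) 1)
    {s : Finset ι} {F : Finset ι → ℝ} {B l μ : ℝ} (hμ : μ = expect p s F) (hB : ∀ R ⊆ s, |F R| ≤ B)
    (hl : 0 ≤ l) (hlB : l * (2 * B) ≤ 1) :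
    (expect p s fun R => Real.exp (l * (F R - μ))) ≤ Real.exp ((l * (2 * B)) ^ 2) := by
  have hμB : |μ| ≤ B := by
    rw [abs_le]
    constructor
    · rw [hμ, ← expect_const p s (-B)]
      exact expect_mono hp fun R hR => (abs_le.1 (hB R hR)).1
    · rw [hμ, ← expect_const p s B]
      exact expect_mono hp fun R hR => (abs_le.1 (hB R hR)).2
  have h1 : ∀ R ⊆ s, Real.exp (l * (F R - μ)) ≤
      (1 + (l * (2 * B)) ^ 2) + l * (F R - μ) := by
    intro R hR
    have h2 : |l * (F R - μ)| ≤ l * (2 * B) := by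
      rw [abs_mul, abs_of_nonneg hl]
      refine mul_le_mul_of_nonneg_left ?_ hl
      calc |F R - μ| ≤ |F R| + |μ| := abs_sub _ _
        _ ≤ 2 * B := by linarith [hB R hR]
    have h3 := Real.abs_exp_sub_one_sub_id_le (h2.trans hlB)
    have h4 := (abs_le.1 h3).2
    have h5 : (l * (F R - μ)) ^ 2 ≤ (l * (2 * B)) ^ 2 := sq_le_sq' (by
      linarith [(abs_le.1 h2).1]) (abs_le.1 h2).2
    linarith
  refine (expect_mono hp h1).trans ?_
  rw [expect_add, expect_const, expect_const_mul, expect_sub, expect_const, ← hμ, sub_self,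
    mul_zero, add_zero, add_comm]
  exact Real.add_one_le_exp _

/-- If random sets `S τ 0, …, S τ (N - 1)` are independent, then with large probability the averages
of finitely many bounded functions do not exceed their expectations by much. -/
theorem measure_deviation_le {n N : ℕ} (hN : 0 < N) {p : Fin n → ℝ}
    (hp : ∀ y, p y ∈ Set.Icc (0 : ℝ) 1) {α : Type*} (D : PMF α) (S : α → ℕ → Finset (Fin n))
    (hS : ∀ G : Finset (Fin n) → ℝ≥0∞, D.mean (fun τ => ∏ s ∈ Finset.range N, G (S τ s)) =
      (prodSum (fun z => ENNReal.ofReal (p z)) (fun z => ENNReal.ofReal (1 - p z))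
        Finset.univ G) ^ N) {κ : Type*} [Fintype κ] (F : κ → Finset (Fin n) → ℝ) {B δ : ℝ}
    (hB : 0 < B) (hF : ∀ h R, (∀ y ∈ R, p y ≠ 0) → |F h R| ≤ B) (hδ : 0 ≤ δ) (hδB : δ ≤ 4 * B) :
    D.toOuterMeasure {τ | ∃ h, expect p Finset.univ (F h) + δ <
      ∑ s ∈ Finset.range N, 1 / (N : ℝ) * F h (S τ s)} ≤
      ENNReal.ofReal (Fintype.card κ * Real.exp (-(N * (δ / (4 * B)) ^ 2))) := by
  set C := Finset.univ.filter fun y => p y ≠ 0 with hC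
  have hpC : ∀ y ∉ C, p y = 0 := fun y hy => by simpa [hC] using hy
  -- this parameter minimizes the exponent `(l * (2 * B)) ^ 2 - l * δ` of the Chernoff bound
  set l := δ / (8 * B ^ 2) with hl
  have hl0 : 0 ≤ l := by positivity
  have hlB : l * (2 * B) = δ / (4 * B) := by rw [hl]; field_simp; ring
  set μ : κ → ℝ := fun h => expect p Finset.univ (F h) with hμ
  let G : κ → Finset (Fin n) → ℝ := fun h R => Real.exp (l * (F h R - μ h)) * Real.exp (-(l * δ))
  have hG : ∀ h, expect p Finset.univ (G h) ≤ Real.exp (-((δ / (4 * B)) ^ 2)) := by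
    intro h
    have h1 : expect p Finset.univ (G h) =
        Real.exp (-(l * δ)) * expect p C fun R => Real.exp (l * (F h R - μ h)) := by
      rw [expect_univ hpC, ← expect_const_mul]
      exact expect_congr (fun _ _ => rfl) fun R _ => mul_comm _ _
    have h2 := expect_exp_le hp (s := C) (F := F h) (B := B) (l := l) (μ := μ h)
      (by rw [hμ]; exact expect_univ hpC _)
      (fun R hR => hF h R fun y hy => (Finset.mem_filter.1 (hR hy)).2) hl0
      (by rw [hlB, div_le_one (by linarith)]; exact hδB)
    rw [h1]
    refine (mul_le_mul_of_nonneg_left h2 (Real.exp_pos _).le).trans_eq ?_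
    rw [← Real.exp_add, hlB]
    congr 1
    rw [hl]
    field_simp
    ring
  -- Markov's inequality is applied to the sum over all `h`, which combines it with a union bound
  have hmean : (D.mean fun τ => ∑ h, ∏ s ∈ Finset.range N, ENNReal.ofReal (G h (S τ s))) ≤
      ENNReal.ofReal (Fintype.card κ * Real.exp (-(N * (δ / (4 * B)) ^ 2))) := by
    have h1 : (D.mean fun τ => ∑ h, ∏ s ∈ Finset.range N, ENNReal.ofReal (G h (S τ s))) =
        ∑ h, ENNReal.ofReal (expect p Finset.univ (G h)) ^ N := by
      simp only [PMF.mean, Finset.mul_sum]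
      rw [Summable.tsum_finsetSum fun _ _ => ENNReal.summable]
      refine Finset.sum_congr rfl fun h _ => ?_
      have := hS fun R => ENNReal.ofReal (G h R)
      rw [PMF.mean] at this
      rw [this, expect, ofReal_prodSum (fun y => (hp y).1) (fun y => sub_nonneg.2 (hp y).2)
        fun R => by positivity]
    rw [h1]
    calc _ ≤ ∑ _h : κ, ENNReal.ofReal (Real.exp (-(N * (δ / (4 * B)) ^ 2))) := by
          refine Finset.sum_le_sum fun h _ => ?_
          rw [← ENNReal.ofReal_pow (expect_nonneg hp fun R _ => by positivity)]
          refine ENNReal.ofReal_le_ofReal ?_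
          refine (pow_le_pow_left₀ (expect_nonneg hp fun R _ => by positivity) (hG h) N).trans_eq ?_
          rw [← Real.exp_nat_mul]
          congr 1
          ring
      _ = _ := by
          rw [Finset.sum_const, Finset.card_univ, nsmul_eq_mul, ENNReal.ofReal_mul (by positivity),
            ENNReal.ofReal_natCast]
  refine le_trans ?_ hmean
  rw [PMF.toOuterMeasure_apply, PMF.mean]
  refine ENNReal.tsum_le_tsum fun τ => ?_
  rw [Set.indicator_apply]
  split_ifs with hτ
  · obtain ⟨h, hh⟩ := hτ
    conv_lhs => rw [← mul_one (D τ)]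
    gcongr
    refine le_trans ?_ (Finset.single_le_sum (f := fun h => ∏ s ∈ Finset.range N,
      ENNReal.ofReal (G h (S τ s))) (fun _ _ => zero_le) (Finset.mem_univ h))
    rw [← ENNReal.ofReal_prod_of_nonneg fun s _ => by positivity, ← ENNReal.ofReal_one]
    refine ENNReal.ofReal_le_ofReal ?_
    have e1 : ∏ s ∈ Finset.range N, G h (S τ s) = Real.exp (l * (N *
        (∑ s ∈ Finset.range N, 1 / (N : ℝ) * F h (S τ s) - (μ h + δ)))) := by
      simp only [G, ← Real.exp_add]
      rw [← Real.exp_sum]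
      congr 1
      rw [← Finset.mul_sum, Finset.sum_add_distrib, ← Finset.mul_sum, Finset.sum_sub_distrib]
      simp only [Finset.sum_const, Finset.card_range, nsmul_eq_mul]
      field_simp
      ring
    rw [e1]
    refine Real.one_le_exp (mul_nonneg hl0 (mul_nonneg (Nat.cast_nonneg _) ?_))
    exact sub_nonneg.2 hh.le
  · exact zero_le

/-- The failure probability for the number of samples and the accuracy used by the algorithm: a
union bound over all sequences of candidates. -/
theorem failure_le {M k₀ m c r : ℕ} {η : ℝ} (hη : 0 < η) (hM : 16 * (k₀ + 2) ≤ M * η ^ 2)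
    (hM1 : 1 ≤ M) (hm : m ≤ M) (hc : c ≤ M ^ k₀) (hr : 1 ≤ r) (hrM : r ≤ M) :
    ((c ^ m + 1 : ℕ) : ℝ) * Real.exp (-((M ^ 11 : ℕ) * (η / (4 * (M : ℝ) ^ 3)) ^ 2)) ≤ 1 / r := by
  have hMr : (1 : ℝ) ≤ M := by exact_mod_cast hM1
  have h1 : ((c ^ m + 1 : ℕ) : ℝ) ≤ Real.exp (k₀ * M ^ 2 + 1) := by
    have h2 : (c ^ m : ℕ) ≤ M ^ (k₀ * M) := by
      calc c ^ m ≤ (M ^ k₀) ^ m := Nat.pow_le_pow_left hc m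
        _ ≤ (M ^ k₀) ^ M := Nat.pow_le_pow_right (Nat.one_le_pow _ _ hM1) hm
        _ = M ^ (k₀ * M) := (pow_mul _ _ _).symm
    have h3 : ((M ^ (k₀ * M) : ℕ) : ℝ) ≤ Real.exp (k₀ * M ^ 2) := by
      have h4 : (M : ℝ) ≤ Real.exp M := by linarith [Real.add_one_le_exp (M : ℝ)]
      push_cast
      calc (M : ℝ) ^ (k₀ * M) ≤ Real.exp M ^ (k₀ * M) := by gcongr
        _ = Real.exp (k₀ * M ^ 2) := by
          rw [← Real.exp_nat_mul]; push_cast; ring_nf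
    have h5 : (2 : ℝ) ≤ Real.exp 1 := by linarith [Real.add_one_le_exp (1 : ℝ)]
    have h6 : (1 : ℝ) ≤ Real.exp (k₀ * M ^ 2) := Real.one_le_exp (by positivity)
    have h7 : ((c ^ m : ℕ) : ℝ) ≤ Real.exp (k₀ * M ^ 2) := le_trans (by exact_mod_cast h2) h3
    rw [Real.exp_add]
    push_cast at h7 ⊢
    nlinarith
  have h8 : ((M ^ 11 : ℕ) : ℝ) * (η / (4 * (M : ℝ) ^ 3)) ^ 2 = M ^ 4 * (M * η ^ 2) / 16 := by
    push_cast
    field_simp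
    ring
  rw [h8]
  calc _ ≤ Real.exp (k₀ * M ^ 2 + 1) * Real.exp (-(M ^ 4 * (M * η ^ 2) / 16)) := by gcongr
    _ = Real.exp (k₀ * M ^ 2 + 1 - M ^ 4 * (M * η ^ 2) / 16) := by
      rw [← Real.exp_add]; ring_nf
    _ ≤ Real.exp (-M) := by
      refine Real.exp_le_exp.2 ?_
      have e1 : (M : ℝ) ^ 4 * (16 * (k₀ + 2)) ≤ M ^ 4 * (M * η ^ 2) := by gcongr
      have e2 : (M : ℝ) ^ 2 ≤ M ^ 4 := pow_le_pow_right₀ hMr (by norm_num)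
      have e3 : (M : ℝ) ≤ M ^ 4 := le_self_pow₀ hMr (by norm_num)
      have e4 : (k₀ : ℝ) * M ^ 2 ≤ k₀ * M ^ 4 := by gcongr
      nlinarith
    _ ≤ 1 / r := by
      rw [Real.exp_neg, ← one_div]
      have e5 : (r : ℝ) ≤ M := by exact_mod_cast hrM
      have e6 : (M : ℝ) ≤ Real.exp M := by linarith [Real.add_one_le_exp (M : ℝ)]
      have e7 : (0 : ℝ) < r := by exact_mod_cast hr
      exact one_div_le_one_div_of_le e7 (e5.trans e6)

/-! ### Rare nodes and the optimal policy -/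

/-- A lower bound that takes into account only the outcomes with at most one element. -/
theorem prod_mul_le_expect {ι : Type*} [DecidableEq ι] {p : ι → ℝ}
    (hp : ∀ y, p y ∈ Set.Icc (0 : ℝ) 1) (s : Finset ι) {K : Finset ι → ℝ} (hK : ∀ R, 0 ≤ K R) :
    (∏ y ∈ s, (1 - p y)) * (K ∅ + ∑ y ∈ s, p y * K {y}) ≤ expect p s K := by
  induction s using Finset.induction_on generalizing K with
  | empty => simp [expect_empty]
  | insert z s hz ih =>
    have hW : 0 ≤ ∏ y ∈ s, (1 - p y) := Finset.prod_nonneg fun y _ => sub_nonneg.2 (hp y).2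
    have h1 := ih hK
    have h2 := ih (K := fun R => K (insert z R)) fun R => hK _
    have h3 : 0 ≤ ∑ y ∈ s, p y * K (insert z {y}) :=
      Finset.sum_nonneg fun y _ => mul_nonneg (hp y).1 (hK _)
    have h4 : (∏ y ∈ s, (1 - p y)) * K {z} ≤ expect p s fun R => K (insert z R) :=
      le_trans (mul_le_mul_of_nonneg_left (by simpa using h3) hW) h2
    rw [expect_insert _ hz, Finset.prod_insert hz, Finset.sum_insert hz]
    have h5 := mul_le_mul_of_nonneg_left h1 (sub_nonneg.2 (hp z).2)
    have h6 := mul_le_mul_of_nonneg_left h4 (hp z).1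
    have h7 : 0 ≤ p z * (p z * ((∏ y ∈ s, (1 - p y)) * K {z})) :=
      mul_nonneg (hp z).1 (mul_nonneg (hp z).1 (mul_nonneg hW (hK _)))
    linarith

theorem one_sub_sum_le_prod {ι : Type*} [DecidableEq ι] {p : ι → ℝ}
    (hp : ∀ y, p y ∈ Set.Icc (0 : ℝ) 1) (s : Finset ι) :
    1 - ∑ y ∈ s, p y ≤ ∏ y ∈ s, (1 - p y) := by
  induction s using Finset.induction_on with
  | empty => simp
  | insert z s hz ih =>
    rw [Finset.sum_insert hz, Finset.prod_insert hz]
    have h1 : ∏ y ∈ s, (1 - p y) ≤ 1 := Finset.prod_le_one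
      (fun y _ => sub_nonneg.2 (hp y).2) fun y _ => by linarith [(hp y).1]
    nlinarith [(hp z).1]

namespace SeedingInstance

variable (I : SeedingInstance)

theorem prob_mem (y : Fin I.numY) : I.prob y ∈ Set.Icc (0 : ℝ) 1 :=
  ⟨I.prob_nonneg y, I.prob_le_one y⟩

theorem sum_realizationProb_mul (H : Finset (Fin I.numY) → ℝ) :
    ∑ R, I.realizationProb R * H R = expect I.prob Finset.univ H := by
  rw [expect, prodSum, Finset.powerset_univ]
  rfl

variable {I}

/-- With probability at least `1 - 1 / M` no rare node is realized. So the scenarios with at most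
one rare node account for almost the whole expectation that the estimate aims at. -/
theorem le_expect_prob {M : ℕ} (hM : I.numY ≤ M) (hM0 : 0 < M) {g : Finset (Fin I.numY) → ℝ}
    (hg : ∀ R, 0 ≤ g R) (hgy : ∀ R, ∀ y ∈ R, g {y} ≤ g R) :
    (1 - 1 / (M : ℝ)) * (expect (I.commonProb M) Finset.univ g + ∑ y, I.rareProb M y * g {y}) ≤
      expect I.prob Finset.univ g := by
  classical
  set Z := Finset.univ.filter fun y => ¬ 1 ≤ I.prob y * M * M with hZ
  have hMr : (0 : ℝ) < M := by exact_mod_cast hM0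
  set K : Finset (Fin I.numY) → ℝ := fun A => expect I.prob Zᶜ fun B => g (A ∪ B) with hKdef
  have hK : ∀ A, 0 ≤ K A := fun A => expect_nonneg I.prob_mem fun R _ => hg _
  have h1 : expect I.prob Finset.univ g = expect I.prob Z K := by
    rw [← Finset.union_compl Z, expect_union _ disjoint_compl_right]
  have h2 : expect (I.commonProb M) Finset.univ g = K ∅ := by
    rw [expect_univ (s := Zᶜ) fun y hy => ?_]
    · refine expect_congr (fun y hy => ?_) fun R _ => by rw [Finset.empty_union]
      rw [commonProb, if_pos]
      simpa [hZ] using hy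
    · rw [commonProb, if_neg]
      simpa [hZ] using hy
  have h3 : ∑ y, I.rareProb M y * g {y} ≤ ∑ y ∈ Z, I.prob y * K {y} := by
    rw [hZ, Finset.sum_filter]
    refine Finset.sum_le_sum fun y _ => ?_
    rw [rareProb]
    by_cases h : 1 ≤ I.prob y * M * M
    · rw [if_pos h, if_neg (not_not.2 h), zero_mul]
    · rw [if_neg h, if_pos h]
      refine mul_le_mul_of_nonneg_left ?_ (I.prob_nonneg y)
      rw [hKdef, ← expect_const I.prob Zᶜ (g {y})]
      exact expect_mono I.prob_mem fun R _ => hgy _ y (by simp)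
  have h4 : 1 - 1 / (M : ℝ) ≤ ∏ y ∈ Z, (1 - I.prob y) := by
    refine le_trans ?_ (one_sub_sum_le_prod I.prob_mem Z)
    have h5 : ∑ y ∈ Z, I.prob y ≤ ∑ _y ∈ Z, 1 / ((M : ℝ) * M) := by
      refine Finset.sum_le_sum fun y hy => ?_
      have : I.prob y * M * M < 1 := by simpa [hZ] using hy
      rw [le_div_iff₀ (by positivity)]
      linarith
    have h6 : ∑ _y ∈ Z, 1 / ((M : ℝ) * M) ≤ 1 / M := by
      have : (Z.card : ℝ) ≤ M := by
        have := Finset.card_le_univ Z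
        rw [Fintype.card_fin] at this
        exact_mod_cast this.trans hM
      rw [Finset.sum_const, nsmul_eq_mul]
      calc (Z.card : ℝ) * (1 / (M * M)) ≤ M * (1 / (M * M)) := by gcongr
        _ = 1 / M := by field_simp
    linarith
  rw [h1, h2]
  refine le_trans ?_ (prod_mul_le_expect I.prob_mem Z hK)
  refine mul_le_mul h4 (by linarith) ?_
    (Finset.prod_nonneg fun y _ => sub_nonneg.2 (I.prob_le_one y))
  exact add_nonneg (hK _) (Finset.sum_nonneg fun y _ => mul_nonneg (rareProb_nonneg y) (hg _))

/-- The decomposition of the value of a policy into the contributions of common and of rare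
nodes. -/
theorem value_le (M : ℕ) (π : AdaptivePolicy I) :
    π.value ≤
      (expect I.prob Finset.univ fun R => I.f ((π.T R).filter fun y => 1 ≤ I.prob y * M * M)) +
      ∑ y, I.rareProb M y * if y ∈ I.nbrs π.S ∧ π.S.card < I.budget then I.f {y} else 0 := by
  have hf := I.isMonoSubmodular
  rw [AdaptivePolicy.value, sum_realizationProb_mul]
  have h1 : ∀ R, I.f (π.T R) ≤ I.f ((π.T R).filter fun y => 1 ≤ I.prob y * M * M) +
      ∑ y, (if 1 ≤ I.prob y * M * M then 0 else
        if y ∈ I.nbrs π.S ∧ π.S.card < I.budget then I.f {y} else 0) *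
          (if y ∈ R then 1 else 0) := by
    intro R
    have h2 := hf.marginal_le (Finset.empty_subset ((π.T R).filter fun y => 1 ≤ I.prob y * M * M))
      ((π.T R).filter fun y => ¬ 1 ≤ I.prob y * M * M)
    rw [Finset.filter_union_filter_not_eq, Finset.empty_union, hf.empty] at h2
    have h3 := hf.le_sum ((π.T R).filter fun y => ¬ 1 ≤ I.prob y * M * M)
    rw [Finset.sum_filter] at h3
    have h4 : ∑ y ∈ π.T R, (if ¬ 1 ≤ I.prob y * M * M then I.f {y} else 0) ≤
        ∑ y ∈ π.T R, (if 1 ≤ I.prob y * M * M then 0 else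
        if y ∈ I.nbrs π.S ∧ π.S.card < I.budget then I.f {y} else 0) *
          (if y ∈ R then 1 else 0) := by
      refine Finset.sum_le_sum fun y hy => ?_
      have hy' := Finset.mem_inter.1 (π.T_subset R hy)
      have hc : π.S.card < I.budget := by
        have := π.card_le R
        have := Finset.card_pos.2 ⟨y, hy⟩
        omega
      rw [if_pos hy'.1, if_pos (show y ∈ I.nbrs π.S ∧ π.S.card < I.budget from ⟨hy'.2, hc⟩),
        ite_not, mul_one]
    have h5 : ∀ y : Fin I.numY, 0 ≤ (if 1 ≤ I.prob y * M * M then 0 else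
        if y ∈ I.nbrs π.S ∧ π.S.card < I.budget then I.f {y} else 0) *
          (if y ∈ R then (1 : ℝ) else 0) := fun y => by
      have := hf.nonneg {y}
      split_ifs <;> simp [this]
    have h6 := Finset.sum_le_sum_of_subset_of_nonneg (Finset.subset_univ (π.T R))
      fun y _ _ => h5 y
    linarith
  refine (expect_mono I.prob_mem fun R _ => h1 R).trans_eq ?_
  rw [expect_add, expect_sum]
  congr 1
  refine Finset.sum_congr rfl fun y _ => ?_
  rw [expect_const_mul, expect_mem _ (Finset.mem_univ y), rareProb]
  split_ifs <;> ring

/-- The policy that selects nothing. -/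
def trivialPolicy (I : SeedingInstance) : AdaptivePolicy I where
  S := ∅
  T _ := ∅
  T_subset _ := Finset.empty_subset _
  card_le _ := by simp

theorem exists_optimal (I : SeedingInstance) :
    ∃ π : AdaptivePolicy I, ∀ π₁ : AdaptivePolicy I, π₁.value ≤ π.value := by
  have : Finite (AdaptivePolicy I) := by
    refine Finite.of_injective (fun π : AdaptivePolicy I => (π.S, π.T)) fun π π' h => ?_
    cases π; cases π'
    simp only [Prod.mk.injEq] at h
    obtain ⟨rfl, rfl⟩ := h
    rfl
  have : Nonempty (AdaptivePolicy I) := ⟨trivialPolicy I⟩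
  exact Finite.exists_max fun π : AdaptivePolicy I => π.value

theorem value_nonneg (π : AdaptivePolicy I) : 0 ≤ π.value := by
  rw [AdaptivePolicy.value, sum_realizationProb_mul]
  exact expect_nonneg I.prob_mem fun R _ => I.isMonoSubmodular.nonneg _

/-- A policy of positive value selects a node in each stage. -/
theorem two_le_budget {π : AdaptivePolicy I} (h : 0 < π.value) : 2 ≤ I.budget := by
  by_contra hb
  have h1 : ∀ R, π.T R = ∅ := by
    intro R
    by_contra hne
    obtain ⟨y, hy⟩ := Finset.nonempty_iff_ne_empty.2 hne
    obtain ⟨x, hx, -⟩ := Finset.mem_biUnion.1 (Finset.mem_inter.1 (π.T_subset R hy)).2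
    have h1 := Finset.card_pos.2 ⟨y, hy⟩
    have h2 := Finset.card_pos.2 ⟨x, hx⟩
    have h3 := π.card_le R
    omega
  rw [AdaptivePolicy.value] at h
  simp [h1, I.f_empty] at h

/-- A common node that can be reached is worth at most a polynomial multiple of the optimum. -/
theorem f_singleton_le {M : ℕ} {π : AdaptivePolicy I}
    (hopt : ∀ π₁ : AdaptivePolicy I, π₁.value ≤ π.value) (hb : 2 ≤ I.budget) {y : Fin I.numY}
    (hy : I.commonProb M y ≠ 0) {x : Fin I.numX} (hx : y ∈ I.nbr x) :
    I.f {y} ≤ M ^ 2 * π.value := by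
  have hy' : 1 ≤ I.prob y * M * M := by
    by_contra h
    exact hy (if_neg h)
  let π₁ : AdaptivePolicy I := {
    S := {x}
    T := fun R => R ∩ {y}
    T_subset := fun R => Finset.inter_subset_inter_left (by simpa [nbrs] using hx)
    card_le := fun R => by
      have := Finset.card_le_card (Finset.inter_subset_right : R ∩ {y} ⊆ {y})
      rw [Finset.card_singleton] at this ⊢
      omega }
  have h1 : π₁.value = I.prob y * I.f {y} := by
    rw [AdaptivePolicy.value, sum_realizationProb_mul, ← expect_mem I.prob (Finset.mem_univ y),
      mul_comm, ← expect_const_mul]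
    refine expect_congr (fun _ _ => rfl) fun R _ => ?_
    by_cases h : y ∈ R
    · simp [π₁, h]
    · simp [π₁, h, I.f_empty]
  have h2 := hopt π₁
  rw [h1] at h2
  have h3 := I.isMonoSubmodular.nonneg {y}
  calc I.f {y} ≤ (I.prob y * M * M) * I.f {y} := le_mul_of_one_le_left h3 hy'
    _ = M ^ 2 * (I.prob y * I.f {y}) := by ring
    _ ≤ M ^ 2 * π.value := by gcongr

/-- The range of the values that are sampled is polynomial in terms of the optimum. -/
theorem f_le_of_common {M : ℕ} (hM : I.numY ≤ M) {π : AdaptivePolicy I}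
    (hopt : ∀ π₁ : AdaptivePolicy I, π₁.value ≤ π.value) (hb : 2 ≤ I.budget)
    {A : Finset (Fin I.numY)} (hA : ∀ y ∈ A, I.commonProb M y ≠ 0 ∧ ∃ x, y ∈ I.nbr x) :
    I.f A ≤ M ^ 3 * π.value := by
  have hv := value_nonneg π
  calc I.f A ≤ ∑ y ∈ A, I.f {y} := I.isMonoSubmodular.le_sum A
    _ ≤ ∑ _y ∈ A, (M : ℝ) ^ 2 * π.value := Finset.sum_le_sum fun y hy => by
      obtain ⟨h1, x, hx⟩ := hA y hy
      exact f_singleton_le hopt hb h1 hx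
    _ = A.card * ((M : ℝ) ^ 2 * π.value) := by rw [Finset.sum_const, nsmul_eq_mul]
    _ ≤ M * ((M : ℝ) ^ 2 * π.value) := by
      have : (A.card : ℝ) ≤ M := by
        have := Finset.card_le_univ A
        rw [Fintype.card_fin] at this
        exact_mod_cast this.trans hM
      gcongr
    _ = M ^ 3 * π.value := by ring

end SeedingInstance

/-! ### Comparison with the optimal policy -/

namespace SeedingInstance

variable {I : SeedingInstance}

theorem expect_filter_common (M : ℕ) (H : Finset (Fin I.numY) → ℝ) :
    (expect I.prob Finset.univ fun R => H (R.filter fun y => 1 ≤ I.prob y * M * M)) =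
      expect (I.commonProb M) Finset.univ H := by
  classical
  set C := Finset.univ.filter fun y => 1 ≤ I.prob y * M * M with hC
  rw [expect_univ (p := I.commonProb M) (s := C) fun y hy => if_neg (by simpa [hC] using hy),
    ← Finset.union_compl C, expect_union _ disjoint_compl_right]
  refine expect_congr (fun y hy => ?_) fun R hR => ?_
  · rw [commonProb, if_pos (by simpa [hC] using hy)]
  · refine (expect_congr (fun _ _ => rfl) fun B hB => ?_).trans (expect_const I.prob Cᶜ (H R))
    congr 1
    ext y
    have h1 : y ∈ R → 1 ≤ I.prob y * M * M := fun h => by simpa [hC] using hR h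
    have h2 : y ∈ B → ¬ 1 ≤ I.prob y * M * M := fun h => by simpa [hC] using hB h
    simp only [Finset.mem_filter, Finset.mem_union]
    tauto

end SeedingInstance

/-- A family of `J` candidates which, in every scenario, together gain at least the difference to
`c`; the estimate of `c` is at least `γ` times the value of `π`, and `m` greedy rounds obtain at
least the fraction `θ` of it. -/
structure Comparator (I : SeedingInstance) (M : ℕ) (T : Tables I.numY) (m : ℕ)
    (π : AdaptivePolicy I) (γ θ : ℝ) (J : ℕ) (q : Fin J → ℕ) (c : Finset (Fin I.numY) → ℝ) :
    Prop where
  pos : 0 < J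
  admissible : ∀ j, q j < T.cX ∧ T.sX (q j) ≤ T.cost
  sub_le : ∀ R A, c R - I.f A ≤ ∑ j, (I.f (T.step I.f (q j) R A) - I.f A)
  nonneg : ∀ R, 0 ≤ c R
  le_of_forall : ∀ R B, (∀ A ⊆ R, (∀ y ∈ A, ∃ x, y ∈ I.nbr x) → I.f A ≤ B) → c R ≤ B
  value_le : γ * π.value ≤
    expect (I.commonProb M) Finset.univ c + ∑ y, I.rareProb M y * c {y}
  fraction : θ ≤ 1 - (1 - 1 / (J : ℝ)) ^ m

theorem Tables.Complete.union_le_step {I : SeedingInstance} {k : ℕ} {T : Tables I.numY}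
    {tX : ℕ → Finset (Fin I.numX)} (hT : T.Complete I k tX) {D : Finset (Fin I.numX)} {q : ℕ}
    (hq : q < T.cX) (hD : tX q = D) (hs : T.sX q = D.card) {R A A' : Finset (Fin I.numY)}
    (hA : A' ⊆ R ∩ I.nbrs D) (hk : A'.card ≤ k) (hc : A'.card + D.card ≤ T.cost) :
    I.f (A ∪ A') ≤ I.f (T.step I.f q R A) := by
  obtain ⟨i, hi, rfl, h2⟩ := hT.exists_row' A' hk
  refine T.union_le_step hi ?_ (by rw [h2, hs]; exact hc)
  rw [hT.cov q hq, hD]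
  exact hA

namespace AdaptivePolicy

variable {I : SeedingInstance} (π : AdaptivePolicy I)

theorem card_add_card_le (R : Finset (Fin I.numY)) :
    π.S.card + (π.T R).card ≤ min I.budget (I.numX + I.numY) := by
  have h1 := π.card_le R
  have h2 := Finset.card_le_univ π.S
  have h3 := Finset.card_le_univ (π.T R)
  rw [Fintype.card_fin] at h2 h3
  omega

end AdaptivePolicy

/-- If the whole budget is spent in one round, then the first stage of the policy is itself a
candidate. -/
theorem exists_comparator_of_le {I : SeedingInstance} {k : ℕ} (M : ℕ) {T : Tables I.numY}
    {tX : ℕ → Finset (Fin I.numX)} (hT : T.Complete I k tX) (π : AdaptivePolicy I)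
    (hk : min I.budget (I.numX + I.numY) ≤ k)
    (hcost : T.cost = min I.budget (I.numX + I.numY)) :
    ∃ q c, Comparator I M T 1 π 1 1 1 q c := by
  set kk := min I.budget (I.numX + I.numY) with hkk
  have hS : π.S.card ≤ kk := by have := π.card_add_card_le ∅; omega
  have hex : ∀ R : Finset (Fin I.numY), ∃ A, (A ⊆ R ∩ I.nbrs π.S ∧ A.card ≤ kk - π.S.card) ∧
      ∀ A', A' ⊆ R ∩ I.nbrs π.S ∧ A'.card ≤ kk - π.S.card → I.f A' ≤ I.f A := by
    intro R
    obtain ⟨A, hA, hmax⟩ := Finset.exists_max_image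
      ((R ∩ I.nbrs π.S).powerset.filter fun A => A.card ≤ kk - π.S.card) I.f
      ⟨∅, Finset.mem_filter.2 ⟨Finset.empty_mem_powerset _, by simp⟩⟩
    simp only [Finset.mem_filter, Finset.mem_powerset] at hA hmax
    exact ⟨A, hA, fun A' h => hmax A' h⟩
  choose A hA hmax using hex
  obtain ⟨q, hq, hq1, hq2⟩ := hT.exists_row π.S (hS.trans hk)
  have hf := I.isMonoSubmodular
  refine ⟨fun _ => q, fun R => I.f (A R), one_pos, fun _ => ⟨hq, by rw [hq2, hcost]; exact hS⟩,
    fun R A' => ?_, fun R => hf.nonneg _, fun R B h => ?_, ?_, by simp⟩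
  · simp only [Finset.univ_unique, Finset.sum_const, Finset.card_singleton, one_smul]
    refine sub_le_sub_right ((hf.mono Finset.subset_union_right).trans
      (hT.union_le_step hq hq1 hq2 (hA R).1 ?_ ?_)) _
    · have := (hA R).2; omega
    · have := (hA R).2; omega
  · refine h _ ((hA R).1.trans Finset.inter_subset_left) fun y hy => ?_
    obtain ⟨x, -, hx⟩ := Finset.mem_biUnion.1 (Finset.mem_inter.1 ((hA R).1 hy)).2
    exact ⟨x, hx⟩
  · rw [one_mul, ← SeedingInstance.expect_filter_common]
    refine (SeedingInstance.value_le M π).trans (add_le_add (expect_mono I.prob_mem fun R _ => ?_)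
      (Finset.sum_le_sum fun y _ => mul_le_mul_of_nonneg_left ?_
        (SeedingInstance.rareProb_nonneg y)))
    · refine hmax _ _ ⟨fun y hy => ?_, ?_⟩
      · obtain ⟨h1, h2⟩ := Finset.mem_filter.1 hy
        have h3 := Finset.mem_inter.1 (π.T_subset R h1)
        exact Finset.mem_inter.2 ⟨Finset.mem_filter.2 ⟨h3.1, h2⟩, h3.2⟩
      · have h1 := Finset.card_filter_le (π.T R) fun y => 1 ≤ I.prob y * M * M
        have h2 := π.card_add_card_le R
        omega
    · split_ifs with h
      · refine hmax _ _ ⟨by simpa using h.1, ?_⟩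
        have h1 := Finset.card_le_univ π.S
        rw [Fintype.card_fin] at h1
        have h2 : 0 < I.numY := by have := y.2; omega
        rw [Finset.card_singleton]
        omega
      · exact hf.nonneg _

/-- The probabilities with which the policy selects the common nodes. -/
noncomputable def AdaptivePolicy.marginal {I : SeedingInstance} (π : AdaptivePolicy I) (M : ℕ)
    (y : Fin I.numY) : ℝ :=
  ∑ R, I.realizationProb R *
    if y ∈ (π.T R).filter fun y => 1 ≤ I.prob y * M * M then 1 else 0

namespace AdaptivePolicy

variable {I : SeedingInstance} (π : AdaptivePolicy I) (M : ℕ)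

theorem realizationProb_nonneg (R : Finset (Fin I.numY)) : 0 ≤ I.realizationProb R :=
  mul_nonneg (Finset.prod_nonneg fun y _ => I.prob_nonneg y)
    (Finset.prod_nonneg fun y _ => sub_nonneg.2 (I.prob_le_one y))

theorem sum_realizationProb : ∑ R, I.realizationProb R = 1 := by
  have := I.sum_realizationProb_mul fun _ => 1
  simpa [expect_const] using this

theorem marginal_nonneg (y : Fin I.numY) : 0 ≤ π.marginal M y :=
  Finset.sum_nonneg fun R _ => mul_nonneg (realizationProb_nonneg R) (by split_ifs <;> norm_num)

theorem marginal_le (y : Fin I.numY) : π.marginal M y ≤ I.commonProb M y := by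
  rw [SeedingInstance.commonProb]
  split_ifs with h
  · rw [← expect_mem I.prob (Finset.mem_univ y), ← I.sum_realizationProb_mul]
    refine Finset.sum_le_sum fun R _ => mul_le_mul_of_nonneg_left ?_ (realizationProb_nonneg R)
    by_cases hy : y ∈ R
    · rw [if_pos hy]; split_ifs <;> norm_num
    · rw [if_neg hy, if_neg]
      exact fun h' => hy (Finset.mem_inter.1 (π.T_subset R (Finset.mem_filter.1 h').1)).1
  · refine (Finset.sum_eq_zero fun R _ => ?_).le
    rw [if_neg (by simp [h]), mul_zero]

theorem mem_nbrs_of_marginal_ne_zero {y : Fin I.numY} (h : π.marginal M y ≠ 0) :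
    y ∈ I.nbrs π.S := by
  obtain ⟨R, -, hR⟩ := Finset.exists_ne_zero_of_sum_ne_zero h
  have : y ∈ (π.T R).filter fun y => 1 ≤ I.prob y * M * M := by
    by_contra h'
    exact hR (by rw [if_neg h', mul_zero])
  exact (Finset.mem_inter.1 (π.T_subset R (Finset.mem_filter.1 this).1)).2

theorem card_add_sum_marginal_le :
    (π.S.card : ℝ) + ∑ y, π.marginal M y ≤ (min I.budget (I.numX + I.numY) : ℕ) := by
  have h1 : ∑ y, π.marginal M y ≤
      ∑ R, I.realizationProb R * (((min I.budget (I.numX + I.numY) : ℕ) : ℝ) - π.S.card) := by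
    simp only [marginal]
    rw [Finset.sum_comm]
    refine Finset.sum_le_sum fun R _ => ?_
    rw [← Finset.mul_sum]
    refine mul_le_mul_of_nonneg_left ?_ (realizationProb_nonneg R)
    rw [Finset.sum_boole]
    have h2 := π.card_add_card_le R
    have h3 := Finset.card_filter_le (π.T R) fun y => 1 ≤ I.prob y * M * M
    have h4 : (Finset.univ.filter fun y => y ∈ (π.T R).filter fun y => 1 ≤ I.prob y * M * M) =
        (π.T R).filter fun y => 1 ≤ I.prob y * M * M := by ext; simp
    rw [h4, le_sub_iff_add_le', ← Nat.cast_add, Nat.cast_le]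
    omega
  rw [← Finset.sum_mul, sum_realizationProb, one_mul] at h1
  linarith

end AdaptivePolicy

/-! ### The comparator for large budgets -/

/-- The number of rounds is at least `1 - 4 / a` times the number of bundles, so that the greedy
rounds fall short of the comparator by a factor close to `1 / e`. -/
theorem one_sub_inv_pow_le {a L c m J l : ℕ} (ha : 4 ≤ a) (hL : L = a ^ 4 + a ^ 3 + 3)
    (hc : a * L < c) (hm : m = c / L) (hJ : J = l + 1) (hl : (l : ℝ) * a ^ 4 ≤ c) :
    (1 - 1 / (J : ℝ)) ^ m ≤ 1 / Real.exp 1 + 4 / a := by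
  have ha' : (4 : ℝ) ≤ a := by exact_mod_cast ha
  set x : ℝ := 1 / a with hx
  have hx0 : 0 < x := by positivity
  have hx1 : x ≤ 1 / 4 := one_div_le_one_div_of_le (by norm_num) ha'
  have hax : (a : ℝ) * x = 1 := by rw [hx]; field_simp
  have hJ1 : (1 : ℝ) ≤ J := by rw [hJ]; push_cast; linarith [Nat.cast_nonneg (α := ℝ) l]
  have hL0 : 0 < L := by omega
  set B : ℝ := (a : ℝ) ^ 4 with hB
  have hB0 : 0 < B := by positivity
  have hLR : (L : ℝ) ≤ B * (1 + 2 * x) := by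
    have h1 : B * x = (a : ℝ) ^ 3 := by rw [hB, hx]; field_simp
    have h2 : (3 : ℝ) ≤ (a : ℝ) ^ 3 := by
      calc (3 : ℝ) ≤ 4 ^ 3 := by norm_num
        _ ≤ (a : ℝ) ^ 3 := pow_le_pow_left₀ (by norm_num) ha' 3
    rw [hL]
    push_cast
    linarith
  have hBL : B ≤ L := by
    rw [hL, hB]
    push_cast
    linarith [pow_nonneg (Nat.cast_nonneg (α := ℝ) a) 3]
  have hcR : (a : ℝ) * L ≤ c := by exact_mod_cast hc.le
  have hcx : (L : ℝ) ≤ c * x := by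
    calc (L : ℝ) = (a * x) * L := by rw [hax, one_mul]
      _ = (a * L) * x := by ring
      _ ≤ c * x := mul_le_mul_of_nonneg_right hcR hx0.le
  have hmL : (c : ℝ) ≤ m * L + L := by
    have h1 := Nat.div_add_mod c L
    have h2 := Nat.mod_lt c hL0
    have : c ≤ m * L + L := by rw [hm, mul_comm]; omega
    exact_mod_cast this
  have hJc : (J : ℝ) * B ≤ c * (1 + x) := by
    rw [hJ]; push_cast; nlinarith
  -- the ratio is at least `(1 - x) / ((1 + x) * (1 + 2 * x))`
  have hmJ : (1 - 4 * x) * J ≤ m := by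
    have h1 : (c : ℝ) * (1 - x) ≤ m * (B * (1 + 2 * x)) := by
      have := mul_le_mul_of_nonneg_left hLR (Nat.cast_nonneg (α := ℝ) m)
      linarith
    have h2 : (1 - 4 * x) * (1 + 2 * x) * (J * B) ≤ (1 - 4 * x) * (1 + 2 * x) * (c * (1 + x)) :=
      mul_le_mul_of_nonneg_left hJc (mul_nonneg (by linarith) (by linarith))
    have h3 : (1 - 4 * x) * (1 + 2 * x) * (1 + x) ≤ 1 - x := by
      nlinarith [sq_nonneg x, mul_pos hx0 hx0, mul_pos (mul_pos hx0 hx0) hx0]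
    have h4 : (1 - 4 * x) * (1 + 2 * x) * (c * (1 + x)) ≤ (c : ℝ) * (1 - x) := by
      have := mul_le_mul_of_nonneg_left h3 (Nat.cast_nonneg (α := ℝ) c)
      linarith
    have h5 : (B * (1 + 2 * x)) * ((1 - 4 * x) * J) ≤ (B * (1 + 2 * x)) * m := by linarith
    exact le_of_mul_le_mul_left h5 (mul_pos hB0 (by linarith))
  have h1 : 1 - 1 / (J : ℝ) ≤ Real.exp (-(1 / J)) := Real.one_sub_le_exp_neg _
  have h2 : 0 ≤ 1 - 1 / (J : ℝ) := sub_nonneg.2 ((div_le_one (by linarith)).2 hJ1)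
  calc (1 - 1 / (J : ℝ)) ^ m ≤ Real.exp (-(1 / J)) ^ m := pow_le_pow_left₀ h2 h1 m
    _ = Real.exp (-(m / J)) := by rw [← Real.exp_nat_mul]; congr 1; ring
    _ ≤ Real.exp (-1 + 4 * x) := by
        refine Real.exp_le_exp.2 ?_
        have : 1 - 4 * x ≤ m / J := (le_div_iff₀ (by linarith)).2 hmJ
        linarith
    _ = 1 / Real.exp 1 * Real.exp (4 * x) := by rw [Real.exp_add, Real.exp_neg, one_div]
    _ ≤ 1 / Real.exp 1 * (1 + 2 * (4 * x)) := by
        refine mul_le_mul_of_nonneg_left ?_ (by positivity)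
        have h3 := Real.abs_exp_sub_one_le (x := 4 * x) (by rw [abs_of_pos (by linarith)]; linarith)
        rw [abs_of_pos (by linarith : 0 < 4 * x)] at h3
        linarith [le_abs_self (Real.exp (4 * x) - 1)]
    _ ≤ 1 / Real.exp 1 + 4 / a := by
        have h3 : 1 / Real.exp 1 ≤ 1 / 2 :=
          one_div_le_one_div_of_le (by norm_num) (by linarith [Real.add_one_le_exp (1 : ℝ)])
        have h4 : (4 : ℝ) / a = 4 * x := by rw [hx]; ring
        rw [h4]
        nlinarith

namespace AdaptivePolicy

variable {I : SeedingInstance} (π : AdaptivePolicy I)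

theorem exists_mem_of_value_pos (h : 0 < π.value) : π.S.Nonempty := by
  by_contra hS
  rw [Finset.not_nonempty_iff_eq_empty] at hS
  refine h.ne' (Finset.sum_eq_zero fun R _ => ?_)
  have h1 : π.T R = ∅ := by
    have := π.T_subset R
    rw [hS, SeedingInstance.nbrs, Finset.biUnion_empty, Finset.inter_empty] at this
    exact Finset.subset_empty.1 this
  rw [h1, I.f_empty, mul_zero]

/-- A choice of a neighbour in the first stage of the policy for every node that it can reach. -/
theorem exists_anchor (h : 0 < π.value) :
    ∃ x : Fin I.numY → Fin I.numX, ∀ y ∈ I.nbrs π.S, x y ∈ π.S ∧ y ∈ I.nbr (x y) := by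
  obtain ⟨z, -⟩ := π.exists_mem_of_value_pos h
  have : ∀ y, ∃ x, y ∈ I.nbrs π.S → x ∈ π.S ∧ y ∈ I.nbr x := by
    intro y
    by_cases hy : y ∈ I.nbrs π.S
    · obtain ⟨x, hx⟩ := Finset.mem_biUnion.1 hy
      exact ⟨x, fun _ => hx⟩
    · exact ⟨z, fun h => absurd h hy⟩
  exact ⟨fun y => (this y).choose, fun y => (this y).choose_spec⟩

/-- The correlation gap for the common nodes selected by the policy. -/
theorem le_expect_marginal (M : ℕ) : (1 - 1 / Real.exp 1) *
    (expect I.prob Finset.univ fun R => I.f ((π.T R).filter fun y => 1 ≤ I.prob y * M * M)) ≤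
      expect (π.marginal M) Finset.univ I.f := by
  rw [← I.sum_realizationProb_mul]
  exact correlation_gap I.isMonoSubmodular Finset.univ realizationProb_nonneg
    sum_realizationProb _ fun y => rfl

end AdaptivePolicy

/-- For large budgets the first stage of the policy, and the common nodes with their marginal
probabilities of being selected, are packed into bundles of nearly the cost of one round. In a
scenario `R` the comparator draws a random subset of `R` in which every node has its marginal
probability, and discards the overfull bundles. -/
theorem exists_comparator_of_lt {I : SeedingInstance} {a L k : ℕ} (ha : 4 ≤ a)
    (hL : L = a ^ 4 + a ^ 3 + 3) (hk : k = a * L) (M : ℕ) {T : Tables I.numY}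
    {tX : ℕ → Finset (Fin I.numX)} (hT : T.Complete I k tX) (π : AdaptivePolicy I)
    (hπ : 0 < π.value) (hkk : k < min I.budget (I.numX + I.numY)) (hcost : T.cost = L) :
    ∃ J q c, Comparator I M T (min I.budget (I.numX + I.numY) / L) π
      ((1 - 1 / Real.exp 1) * (1 - 4 / a)) (1 - 1 / Real.exp 1 - 4 / a) J q c := by
  classical
  have hf := I.isMonoSubmodular
  have hLk : L ≤ k := hk ▸ Nat.le_mul_of_pos_left L (by omega)
  have ha' : (4 : ℝ) ≤ a := by exact_mod_cast ha
  set μ := π.marginal M with hμ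
  have hp := fun y => I.commonProb_mem M y
  have hμ01 : ∀ y, μ y ∈ Set.Icc (0 : ℝ) 1 :=
    fun y => ⟨π.marginal_nonneg M y, (π.marginal_le M y).trans (hp y).2⟩
  obtain ⟨x, hx⟩ := π.exists_anchor hπ
  obtain ⟨b₀, l, hpk⟩ := exists_packed (c := (a : ℝ) ^ 4 + 1) (x := x) (by positivity) hμ01 π.S
    (I.nbrs π.S) fun y hy => (hx y hy).1
  set J := (b₀ :: l).length with hJ
  set D : Fin J → Finset (Fin I.numX) := fun j => ((b₀ :: l).get j).1 with hD
  set G : Fin J → Finset (Fin I.numY) := fun j => ((b₀ :: l).get j).2 ∩ I.nbrs (D j) with hG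
  have hw : ∀ j, ((D j).card : ℝ) + ∑ y ∈ G j, μ y ≤ (a : ℝ) ^ 4 + 3 := fun j => by
    have h1 := hpk.weight_le _ (List.get_mem (b₀ :: l) j)
    have h2 : ∑ y ∈ G j, μ y ≤ ∑ y ∈ ((b₀ :: l).get j).2, μ y :=
      Finset.sum_le_sum_of_subset_of_nonneg Finset.inter_subset_left fun y _ _ => (hμ01 y).1
    rw [bundleWeight] at h1
    linarith
  have hsum0 : ∀ j, 0 ≤ ∑ y ∈ G j, μ y := fun j => Finset.sum_nonneg fun y _ => (hμ01 y).1
  have hDc : ∀ j, (D j).card ≤ a ^ 4 + 3 := fun j => by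
    have h1 := hw j
    have h2 := hsum0 j
    have : ((D j).card : ℝ) ≤ ((a ^ 4 + 3 : ℕ) : ℝ) := by push_cast; linarith
    exact_mod_cast this
  have ha3 : 1 ≤ a ^ 3 := Nat.one_le_pow _ _ (by omega)
  have hcov : ∀ y ∈ I.nbrs π.S, ∃ j, y ∈ G j := fun y hy => by
    obtain ⟨B, hB, hyB⟩ := hpk.cover y hy
    obtain ⟨j, rfl⟩ := List.get_of_mem hB
    exact ⟨j, Finset.mem_inter.2 ⟨hyB, Finset.mem_biUnion.2
      ⟨x y, hpk.accompanied _ hB y hyB, (hx y hy).2⟩⟩⟩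
  choose q hq hq1 hq2 using fun j => hT.exists_row (D j) (by have := hDc j; omega)
  set b : Fin J → ℕ := fun j => L - (D j).card with hb
  -- thinning the common nodes with these probabilities yields the marginals of the policy
  set w : Fin I.numY → ℝ := fun y => μ y / I.commonProb M y with hwdef
  have hw01 : ∀ y, w y ∈ Set.Icc (0 : ℝ) 1 := fun y =>
    ⟨div_nonneg (hμ01 y).1 (hp y).1, div_le_one_of_le₀ (π.marginal_le M y) (hp y).1⟩
  have hwp : ∀ y, w y * I.commonProb M y = μ y := fun y => by
    rcases eq_or_ne (I.commonProb M y) 0 with h | h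
    · rw [h, mul_zero]
      exact ((h ▸ π.marginal_le M y : μ y ≤ 0).antisymm (hμ01 y).1).symm
    · exact div_mul_cancel₀ _ h
  -- the comparator has to gain the full value of a rare node in the scenario in which it is alone
  set g : Finset (Fin I.numY) → ℝ := fun R =>
    if R.card = 1 ∧ R ⊆ I.nbrs π.S then I.f R else 0 with hg
  have hstep0 : ∀ R A j, 0 ≤ I.f (T.step I.f (q j) R A) - I.f A :=
    fun R A j => sub_nonneg.2 (T.le_step I.f _ R A)
  have hpart : ∀ R U, U ⊆ R → ∀ A j,
      I.f (A ∪ trimPart G b U j) ≤ I.f (T.step I.f (q j) R A) := fun R U hU A j => by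
    have h1 := card_trimPart_le G b U j
    have h2 := hDc j
    have h3 : b j = L - (D j).card := rfl
    refine hT.union_le_step (hq j) (hq1 j) (hq2 j) (fun y hy => ?_) (by omega) (by omega)
    obtain ⟨h3, h4⟩ := Finset.mem_inter.1 (trimPart_subset G b U j hy)
    exact Finset.mem_inter.2 ⟨hU h3, Finset.mem_of_mem_inter_right h4⟩
  refine ⟨J, q, fun R => max (expect w R fun U => I.f (trim G b U)) (g R), Nat.succ_pos _,
    fun j => ⟨hq j, ?_⟩, fun R A => ?_, fun R => ?_, fun R B hB => ?_, ?_, ?_⟩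
  · have := hDc j
    rw [hq2, hcost]
    omega
  · rw [sub_le_iff_le_add, max_le_iff]
    constructor
    · rw [← expect_const w R (∑ j, (I.f (T.step I.f (q j) R A) - I.f A) + I.f A)]
      refine expect_mono hw01 fun U hU => ?_
      have h1 := hf.union_biUnion_le A Finset.univ (trimPart G b U)
      have h2 := hf.mono (Finset.subset_union_right (s₁ := A) (s₂ := trim G b U))
      have h3 : ∑ j, (I.f (A ∪ trimPart G b U j) - I.f A) ≤
          ∑ j, (I.f (T.step I.f (q j) R A) - I.f A) :=
        Finset.sum_le_sum fun j _ => sub_le_sub_right (hpart R U hU A j) _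
      rw [trim] at h2 ⊢
      linarith
    · simp only [hg]
      split_ifs with h
      · obtain ⟨y, rfl⟩ := Finset.card_eq_one.1 h.1
        obtain ⟨j, hj⟩ := hcov y (by simpa using h.2)
        have h1 : I.f (A ∪ {y}) ≤ I.f (T.step I.f (q j) {y} A) := by
          have h2 := hDc j
          refine hT.union_le_step (hq j) (hq1 j) (hq2 j) (A' := {y}) ?_
            (by rw [Finset.card_singleton]; omega) (by rw [Finset.card_singleton]; omega)
          exact Finset.singleton_subset_iff.2 (Finset.mem_inter.2
            ⟨Finset.mem_singleton_self y, Finset.mem_of_mem_inter_right hj⟩)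
        have h2 := hf.mono (Finset.subset_union_right (s₁ := A) (s₂ := {y}))
        have h3 := Finset.single_le_sum (f := fun j => I.f (T.step I.f (q j) {y} A) - I.f A)
          (fun j _ => hstep0 _ _ j) (Finset.mem_univ j)
        linarith
      · exact add_nonneg (Finset.sum_nonneg fun j _ => hstep0 _ _ j) (hf.nonneg _)
  · exact le_max_of_le_left (expect_nonneg hw01 fun U _ => hf.nonneg _)
  · refine max_le ?_ ?_
    · rw [← expect_const w R B]
      refine expect_mono hw01 fun U hU => hB _ ((trim_subset G b U).trans hU) fun y hy => ?_
      obtain ⟨j, -, hj⟩ := mem_trim.1 hy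
      obtain ⟨z, -, hz⟩ := Finset.mem_biUnion.1
        (Finset.mem_of_mem_inter_right (Finset.mem_of_mem_inter_right hj))
      exact ⟨z, hz⟩
    · simp only [hg]
      split_ifs with h
      · refine hB R subset_rfl fun y hy => ?_
        obtain ⟨z, -, hz⟩ := Finset.mem_biUnion.1 (h.2 hy)
        exact ⟨z, hz⟩
      · simpa [I.f_empty] using hB ∅ (Finset.empty_subset R) (by simp)
  · have hv : 1 - 4 / (a : ℝ) ≤ 1 - ((a : ℝ) ^ 4 + 3) / ((a : ℝ) ^ 3) ^ 2 := by
      refine sub_le_sub_left ((div_le_div_iff₀ (by positivity) (by positivity)).2 ?_) 1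
      have h1 : (1 : ℝ) ≤ (a : ℝ) ^ 5 := one_le_pow₀ (by linarith)
      have h2 : (a : ℝ) ^ 5 ≤ (a : ℝ) ^ 6 := pow_le_pow_right₀ (by linarith) (by norm_num)
      have h3 : (a : ℝ) ≤ (a : ℝ) ^ 6 := le_self_pow₀ (by linarith) (by norm_num)
      nlinarith
    have h0 : 0 ≤ expect μ Finset.univ I.f := expect_nonneg hμ01 fun U _ => hf.nonneg U
    have h1 : (1 - 4 / (a : ℝ)) * expect μ Finset.univ I.f ≤
        expect (I.commonProb M) Finset.univ fun R => expect w R fun U => I.f (trim G b U) := by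
      rw [expect_expect, show (fun y => w y * I.commonProb M y) = μ from funext hwp]
      refine (mul_le_mul_of_nonneg_right hv h0).trans
        (expect_trim hf hμ01 (fun y hy => hcov y (π.mem_nbrs_of_marginal_ne_zero M hy))
          (by positivity) (fun j => ?_) fun j => ?_)
      · have h2 := hDc j
        have h3 : ((b j : ℕ) : ℝ) = L - (D j).card := Nat.cast_sub (by omega)
        rw [h3, hL]
        push_cast
        linarith [hw j]
      · linarith [hw j, Nat.cast_nonneg (α := ℝ) (D j).card]
    have h2 := π.le_expect_marginal M
    have h3 := SeedingInstance.value_le M π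
    have h4 : (expect (I.commonProb M) Finset.univ fun R => expect w R fun U => I.f (trim G b U)) ≤
        expect (I.commonProb M) Finset.univ fun R =>
          max (expect w R fun U => I.f (trim G b U)) (g R) :=
      expect_mono hp fun R _ => le_max_left _ _
    have h5 : ∑ y, I.rareProb M y *
        (if y ∈ I.nbrs π.S ∧ π.S.card < I.budget then I.f {y} else 0) ≤
        ∑ y, I.rareProb M y * max (expect w {y} fun U => I.f (trim G b U)) (g {y}) := by
      refine Finset.sum_le_sum fun y _ => mul_le_mul_of_nonneg_left (le_max_of_le_right ?_)
        (SeedingInstance.rareProb_nonneg y)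
      simp only [hg]
      split_ifs with h6 h7 h7
      · exact le_rfl
      · exact absurd ⟨Finset.card_singleton y, Finset.singleton_subset_iff.2 h6.1⟩ h7
      · exact hf.nonneg _
      · exact le_rfl
    have h6 : 0 ≤ ∑ y, I.rareProb M y *
        (if y ∈ I.nbrs π.S ∧ π.S.card < I.budget then I.f {y} else 0) :=
      Finset.sum_nonneg fun y _ => mul_nonneg (SeedingInstance.rareProb_nonneg y)
        (by split_ifs; exacts [hf.nonneg _, le_rfl])
    have hu0 : 0 ≤ 1 - 1 / Real.exp 1 :=
      sub_nonneg.2 ((div_le_one (Real.exp_pos 1)).2 (Real.one_le_exp zero_le_one))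
    have hu1 : 1 - 1 / Real.exp 1 ≤ 1 := sub_le_self _ (by positivity)
    have hx0 : 0 ≤ 1 - 4 / (a : ℝ) := sub_nonneg.2 ((div_le_one (by linarith)).2 ha')
    have hx1 : 1 - 4 / (a : ℝ) ≤ 1 := sub_le_self _ (by positivity)
    have h7 := mul_le_mul_of_nonneg_left h3 (mul_nonneg hu0 hx0)
    have h8 := mul_le_mul_of_nonneg_left h2 hx0
    have h9 := mul_le_of_le_one_left h6 (mul_le_one₀ hu1 hx0 hx1)
    linarith
  · have h1 := hpk.length_mul_le hμ01
    have h2 := π.card_add_sum_marginal_le M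
    have h3 : ∑ y ∈ I.nbrs π.S, μ y ≤ ∑ y, μ y :=
      Finset.sum_le_sum_of_subset_of_nonneg (Finset.subset_univ _) fun y _ _ => (hμ01 y).1
    have h4 := one_sub_inv_pow_le (l := l.length) ha hL (hk ▸ hkk) rfl (J := J)
      (by rw [hJ, List.length_cons]) (by rw [add_sub_cancel_right] at h1; linarith)
    linarith

/-! ### The guarantee -/

theorem Comparator.weaken {I : SeedingInstance} {M m J : ℕ} {T : Tables I.numY}
    {π : AdaptivePolicy I} {γ γ' θ θ' : ℝ} {q : Fin J → ℕ} {c : Finset (Fin I.numY) → ℝ}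
    (h : Comparator I M T m π γ θ J q c) (hγ : γ' ≤ γ) (hθ : θ' ≤ θ) :
    Comparator I M T m π γ' θ' J q c :=
  { h with
    value_le := (mul_le_mul_of_nonneg_right hγ (SeedingInstance.value_nonneg π)).trans h.value_le
    fraction := hθ.trans h.fraction }

/-- If the sample averages of the comparator and of the policy computed deviate from the
expectations, in the unfavourable directions, by at most `δ`, then the computed policy inherits the
guarantee of the greedy rounds. -/
theorem Comparator.le_expect_sim {I : SeedingInstance} {M N m J : ℕ} {T : Tables I.numY}
    {π : AdaptivePolicy I} {γ θ δ : ℝ} {q : Fin J → ℕ} {c : Finset (Fin I.numY) → ℝ}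
    (hc : Comparator I M T m π γ θ J q c) (hθ : 0 ≤ θ) {S : ℕ → Finset (Fin I.numY)} {h : ℕ → ℕ}
    (hg : T.Greedy M N S h m)
    (h1 : ∑ s ∈ Finset.range N, 1 / (N : ℝ) * I.f (T.sim I.f h (S s) m) ≤
      (expect (I.commonProb M) Finset.univ fun R => I.f (T.sim I.f h R m)) + δ)
    (h2 : ∑ s ∈ Finset.range N, 1 / (N : ℝ) * -c (S s) ≤
      (expect (I.commonProb M) Finset.univ fun R => -c R) + δ) :
    θ * (γ * π.value - δ) - δ ≤
      (expect (I.commonProb M) Finset.univ fun R => I.f (T.sim I.f h R m)) +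
        ∑ y, I.rareProb M y * I.f (T.sim I.f h {y} m) := by
  have : Nonempty (Fin J) := ⟨⟨0, hc.pos⟩⟩
  have h3 := hg.le_estimate hc.admissible hc.sub_le
  rw [Fintype.card_fin] at h3
  have h4 : 0 ≤ I.estimate M N S c := by
    rw [SeedingInstance.estimate]
    exact add_nonneg
      (Finset.sum_nonneg fun s _ => mul_nonneg (by positivity) (hc.nonneg _))
      (Finset.sum_nonneg fun y _ => mul_nonneg (SeedingInstance.rareProb_nonneg y) (hc.nonneg _))
  have h5 := mul_le_mul_of_nonneg_right hc.fraction h4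
  have h6 : γ * π.value - δ ≤ I.estimate M N S c := by
    have h7 := expect_sub (I.commonProb M) Finset.univ (fun _ => 0) c
    simp only [zero_sub, expect_const] at h7
    simp only [mul_neg, Finset.sum_neg_distrib, h7] at h2
    rw [SeedingInstance.estimate]
    linarith [hc.value_le]
  have h7 := (mul_le_mul_of_nonneg_left h6 hθ).trans (h5.trans h3)
  rw [SeedingInstance.estimate] at h7
  linarith

/-- With probability at least `1 - 1 / r`, no policy that can result from the rounds is
overestimated, and the comparator is not underestimated, by more than a small fraction of the
optimum. -/
theorem Comparator.measure_failure_le {I : SeedingInstance} {M m J k r : ℕ} {T : Tables I.numY}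
    {tX : ℕ → Finset (Fin I.numX)} (hT : T.Complete I k tX)
    {π : AdaptivePolicy I} {γ θ η : ℝ} {q : Fin J → ℕ} {c : Finset (Fin I.numY) → ℝ}
    (hc : Comparator I M T m π γ θ J q c) (hopt : ∀ π₁ : AdaptivePolicy I, π₁.value ≤ π.value)
    (hπ : 0 < π.value) (hη : 0 < η) (hη1 : η ≤ 1) (hM : 16 * (k + 2) ≤ M * η ^ 2)
    (hX : I.numX + 1 ≤ M) (hY : I.numY ≤ M) (hm : m ≤ M) (hr : 1 ≤ r) (hrM : r ≤ M)
    {α : Type*} (D : PMF α) (S : α → ℕ → Finset (Fin I.numY)) (h : α → ℕ → ℕ)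
    (hS : ∀ G : Finset (Fin I.numY) → ℝ≥0∞,
      D.mean (fun τ => ∏ s ∈ Finset.range (M ^ 11), G (S τ s)) =
        (prodSum (fun z => ENNReal.ofReal (I.commonProb M z))
          (fun z => ENNReal.ofReal (1 - I.commonProb M z)) Finset.univ G) ^ (M ^ 11))
    (hh : ∀ τ ∈ D.support, ∀ i < m, h τ i < T.cX) :
    D.toOuterMeasure {τ | ¬ (
      (∑ s ∈ Finset.range (M ^ 11), 1 / ((M ^ 11 : ℕ) : ℝ) * I.f (T.sim I.f (h τ) (S τ s) m) ≤
        (expect (I.commonProb M) Finset.univ fun R => I.f (T.sim I.f (h τ) R m)) + η * π.value) ∧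
      ∑ s ∈ Finset.range (M ^ 11), 1 / ((M ^ 11 : ℕ) : ℝ) * -c (S τ s) ≤
        (expect (I.commonProb M) Finset.univ fun R => -c R) + η * π.value)} ≤ (r : ℝ≥0∞)⁻¹ := by
  have hM1 : 1 ≤ M := by omega
  have hMr : (1 : ℝ) ≤ M := by exact_mod_cast hM1
  have hM3 : (1 : ℝ) ≤ (M : ℝ) ^ 3 := one_le_pow₀ hMr
  set ext : (Fin m → Fin T.cX) → ℕ → ℕ := fun u i => if hi : i < m then u ⟨i, hi⟩ else 0 with hext
  set F : Option (Fin m → Fin T.cX) → Finset (Fin I.numY) → ℝ := fun o R =>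
    o.elim (-c R) fun u => I.f (T.sim I.f (ext u) R m) with hF
  have hbd : ∀ R : Finset (Fin I.numY), (∀ y ∈ R, I.commonProb M y ≠ 0) → ∀ A ⊆ R,
      (∀ y ∈ A, ∃ x, y ∈ I.nbr x) → I.f A ≤ M ^ 3 * π.value := fun R hR A hA hx =>
    SeedingInstance.f_le_of_common hY hopt (SeedingInstance.two_le_budget hπ)
      fun y hy => ⟨hR y (hA hy), hx y hy⟩
  have key := measure_deviation_le (N := M ^ 11) (by positivity) (I.commonProb_mem M) D S hS F
    (B := M ^ 3 * π.value) (δ := η * π.value) (by positivity) (fun o R hR => ?_) (by positivity)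
    (by nlinarith)
  · refine (D.toOuterMeasure_mono ?_).trans (key.trans ?_)
    · rintro τ ⟨hτ, hτs⟩
      rw [Set.mem_ofPred_eq, not_and_or, not_le, not_le] at hτ
      rcases hτ with hτ | hτ
      · refine ⟨some fun i => ⟨h τ i, hh τ hτs i i.2⟩, ?_⟩
        have hsim : ∀ R, T.sim I.f (ext fun i => ⟨h τ i, hh τ hτs i i.2⟩) R m =
            T.sim I.f (h τ) R m := fun R => T.sim_congr I.f R fun i hi => by simp [hext, hi]
        simpa only [hF, Option.elim_some, hsim] using hτ
      · exact ⟨none, hτ⟩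
    · have hcX : T.cX ≤ M ^ k := hT.length_eq ▸ Nat.pow_le_pow_left hX k
      have h1 := failure_le hη hM hM1 hm hcX hr hrM
      have h2 : η * π.value / (4 * ((M : ℝ) ^ 3 * π.value)) = η / (4 * (M : ℝ) ^ 3) := by
        field_simp
      rw [h2, Fintype.card_option, Fintype.card_fun, Fintype.card_fin, Fintype.card_fin]
      refine (ENNReal.ofReal_le_ofReal h1).trans ?_
      rw [one_div, ENNReal.ofReal_inv_of_pos (by exact_mod_cast hr), ENNReal.ofReal_natCast]
  · cases o with
    | none =>
      simp only [hF, Option.elim_none, abs_neg, abs_of_nonneg (hc.nonneg R)]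
      exact hc.le_of_forall R _ (hbd R hR)
    | some u =>
      simp only [hF, Option.elim_some, abs_of_nonneg (I.f_nonneg _)]
      refine hbd R hR _ ((T.sim_subset _ R m).trans Finset.inter_subset_left) fun y hy => ?_
      obtain ⟨i, hi, hy'⟩ := Finset.mem_biUnion.1
        (Finset.mem_inter.1 (T.sim_subset _ R m hy)).2
      have hi' := Finset.mem_range.1 hi
      have hu : ext u i < T.cX := by simp [hext, hi']
      rw [hT.cov _ hu] at hy'
      obtain ⟨x, -, hx⟩ := Finset.mem_biUnion.1 hy'
      exact ⟨x, hx⟩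

/-- The candidates of the rounds, with the simulation as second stage, form an adaptive policy,
which needs to know only the realized neighbours of its first stage. -/
theorem Tables.Complete.exists_policy {I : SeedingInstance} {k m : ℕ} {T : Tables I.numY}
    {tX : ℕ → Finset (Fin I.numX)} (hT : T.Complete I k tX) (hm : m * T.cost ≤ I.budget)
    {h : ℕ → ℕ} (hh : ∀ i < m, h i < T.cX ∧ T.sX (h i) ≤ T.cost) :
    ∃ π : AdaptivePolicy I, π.S = (Finset.range m).biUnion (fun i => tX (h i)) ∧
      (∀ R, π.T R = T.sim I.f h (R ∩ I.nbrs π.S) m) ∧ ∀ R, π.T R = T.sim I.f h R m := by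
  set S := (Finset.range m).biUnion (fun i => tX (h i)) with hS
  have hcov : ∀ i < m, T.cov (h i) ⊆ I.nbrs S := fun i hi => by
    rw [hT.cov _ (hh i hi).1]
    exact Finset.biUnion_subset_biUnion_of_subset_left _
      (Finset.subset_biUnion_of_mem (fun i => tX (h i)) (Finset.mem_range.2 hi))
  refine ⟨⟨S, fun R => T.sim I.f h R m, fun R => ?_, fun R => ?_⟩, rfl,
    fun R => (T.sim_inter hcov R).symm, fun R => rfl⟩
  · refine (T.sim_subset h R m).trans (Finset.inter_subset_inter_left ?_)
    exact Finset.biUnion_subset.2 fun i hi => hcov i (Finset.mem_range.1 hi)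
  · have h1 := T.card_sim_le (f := I.f) (h := h) (m := m) hT.card_le' (fun i hi => (hh i hi).2) R
    have h2 : S.card ≤ ∑ i ∈ Finset.range m, T.sX (h i) :=
      Finset.card_biUnion_le.trans (Finset.sum_le_sum fun i hi =>
        hT.card_le _ (hh i (Finset.mem_range.1 hi)).1)
    omega

/-- A comparator exists for every budget. -/
theorem exists_comparator {I : SeedingInstance} {a l₀ k L : ℕ} (ha : 8 ≤ a)
    (hl : l₀ = a ^ 4 + a ^ 3 + 3) (hk : k = a * l₀) (M : ℕ) {T : Tables I.numY}
    {tX : ℕ → Finset (Fin I.numX)} (hT : T.Complete I k tX) (π : AdaptivePolicy I)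
    (hπ : 0 < π.value) (hL : L = Prog.roundCost k l₀ (min I.budget (I.numX + I.numY)))
    (hcost : T.cost = L) :
    ∃ J q c, Comparator I M T (min I.budget (I.numX + I.numY) / L) π
      ((1 - 1 / Real.exp 1) * (1 - 4 / a)) (1 - 1 / Real.exp 1 - 4 / a) J q c := by
  set kk := min I.budget (I.numX + I.numY) with hkk
  have hkk1 : 1 ≤ kk := by
    have h1 := SeedingInstance.two_le_budget hπ
    obtain ⟨x, -⟩ := π.exists_mem_of_value_pos hπ
    have h2 := x.2
    omega
  have ha' : (8 : ℝ) ≤ a := by exact_mod_cast ha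
  have he : 0 ≤ 1 / Real.exp 1 := by positivity
  have hu : 0 ≤ 1 - 1 / Real.exp 1 :=
    sub_nonneg.2 ((div_le_one (Real.exp_pos 1)).2 (Real.one_le_exp zero_le_one))
  have hx : 0 ≤ 4 / (a : ℝ) := by positivity
  by_cases h : kk ≤ k
  · have hL' : L = kk := by rw [hL, Prog.roundCost, if_pos ⟨hkk1, h⟩]
    obtain ⟨q, c, hc⟩ := exists_comparator_of_le M hT π h (by rw [hcost, hL'])
    refine ⟨1, q, c, ?_⟩
    rw [hL', Nat.div_self hkk1]
    exact hc.weaken (by nlinarith) (by linarith)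
  · have hL' : L = l₀ := by rw [hL, Prog.roundCost, if_neg fun h' => h h'.2]
    rw [hL']
    exact exists_comparator_of_lt (by omega) hl hk M hT π hπ (not_le.1 h) (by rw [hcost, hL'])

/-- The losses in the factor `(1 - 1 / e) ^ 2` add up to at most `11 / a`. -/
theorem factor_le {x u y V z : ℝ} (hx : 0 ≤ x) (hx1 : x ≤ 1 / 8) (hu : 1 / 2 ≤ u) (hu1 : u ≤ 1)
    (hz : 0 ≤ z) (hV : 0 ≤ V) (hy : y ≤ x)
    (h : (u - 4 * x) * (u * (1 - 4 * x) * z - x * z) - x * z ≤ V) :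
    (u ^ 2 - 11 * x) * z ≤ (1 - y) * V := by
  have h1 : (u ^ 2 - 10 * x) * z ≤ V := by
    refine le_trans ?_ h
    have : u ^ 2 - 10 * x ≤ (u - 4 * x) * (u * (1 - 4 * x) - x) - x := by
      have hu0 : 0 ≤ u := by linarith
      nlinarith [mul_nonneg hx hx, mul_nonneg hx (sub_nonneg.2 hu1), mul_nonneg hx hu0,
        mul_nonneg (mul_nonneg hx hx) hu0, mul_nonneg (mul_nonneg hx (sub_nonneg.2 hu1)) hu0]
    have := mul_le_mul_of_nonneg_right this hz
    linarith
  have h2 : (1 - x) * ((u ^ 2 - 10 * x) * z) ≤ (1 - x) * V :=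
    mul_le_mul_of_nonneg_left h1 (by linarith)
  have h3 : (1 - x) * V ≤ (1 - y) * V := mul_le_mul_of_nonneg_right (by linarith) hV
  have h4 : (u ^ 2 - 11 * x) ≤ (1 - x) * (u ^ 2 - 10 * x) := by
    nlinarith [mul_nonneg hx hx, mul_nonneg hx (by nlinarith : 0 ≤ 1 - u ^ 2)]
  have := mul_le_mul_of_nonneg_right h4 hz
  linarith

theorem PMF.one_sub_le_toOuterMeasure {α : Type*} (D : PMF α) {A B : Set α}
    (h : ∀ τ ∈ D.support, τ ∉ A → τ ∈ B) {p : ℝ≥0∞} (hA : D.toOuterMeasure A ≤ p) :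
    1 - p ≤ D.toOuterMeasure B := by
  have h1 : D.toOuterMeasure (A ∪ B) = 1 := by
    rw [PMF.toOuterMeasure_apply_eq_one_iff]
    intro τ hτ
    by_cases hA : τ ∈ A
    · exact .inl hA
    · exact .inr (h τ hτ hA)
  rw [tsub_le_iff_left, ← h1]
  exact (MeasureTheory.measure_union_le A B).trans (add_le_add_left hA _)

theorem mainTheorem1 (ε : ℝ) (hε : 0 < ε) :
    ∃ (alg : SeedingAlgorithm) (C d : ℕ), ∀ (I : SeedingInstance) (r : ℕ), 0 < r →
      ∀ t : ℕ, t = C * (I.numX + I.numY + r + 1) ^ d →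
        (∀ c ∈ (runFor I.f t ([alg.plan], I.input r)).support,
          c.1 = [] ∧ ∃ π : AdaptivePolicy I, alg.Represents I t c.2 π) ∧
        1 - (r : ℝ≥0∞)⁻¹ ≤
          (runFor I.f t ([alg.plan], I.input r)).toOuterMeasure
            {c | c.1 = [] ∧ ∃ π : AdaptivePolicy I, alg.Represents I t c.2 π ∧
              ∀ π₁ : AdaptivePolicy I,
                ((1 - 1 / Real.exp 1) ^ 2 - ε) * π₁.value ≤ π.value} := by
  -- the losses amount to `11 / a`, and the estimates of the losses require `8 ≤ a`
  set a := max 8 ⌈11 / ε⌉₊ with ha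
  have ha8 : 8 ≤ a := le_max_left _ _
  have ha0 : (8 : ℝ) ≤ a := by exact_mod_cast ha8
  have haε : 11 * (1 / (a : ℝ)) ≤ ε := by
    have h1 : 11 / ε ≤ a := (Nat.le_ceil _).trans (by exact_mod_cast le_max_right _ _)
    rw [div_le_iff₀ hε] at h1
    rw [mul_one_div, div_le_iff₀ (by linarith)]
    linarith
  -- bundles have weight at most `a ^ 4 + 3`, and rounds have an additional margin of `a ^ 3`
  set l₀ := a ^ 4 + a ^ 3 + 3 with hl₀
  -- if the budget exceeds `k₀`, then rounding it to a multiple of `l₀` loses a fraction `1 / a`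
  set k₀ := a * l₀ with hk₀
  -- this makes `M` large enough for the concentration bound with the accuracy `1 / a`
  set c₀ := 16 * (k₀ + 2) * a ^ 2 with hc₀
  have hac : a ≤ c₀ := by
    have h1 : a ≤ a ^ 2 := Nat.le_self_pow (by norm_num) a
    exact h1.trans (Nat.le_mul_of_pos_left _ (by omega))
  obtain ⟨alg, C, d, halg⟩ := exists_algorithm (c₀ := c₀) (l₀ := l₀) k₀ (by omega) (by omega)
  refine ⟨alg, C, d, fun I r hr t ht => ?_⟩
  obtain ⟨D, hD, T, tX, h, S, hT, hcost, hS, hτ⟩ := halg I r t _ _ _ _ ht rfl rfl rfl rfl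
  set M := I.numX + I.numY + r + c₀ with hM
  set kk := min I.budget (I.numX + I.numY) with hkk
  set L := Prog.roundCost k₀ l₀ kk with hL
  set m := kk / L with hm
  have hmL : m * T.cost ≤ I.budget := by
    rw [hcost]
    exact (Nat.div_mul_le_self kk L).trans (min_le_left _ _)
  have hrep : ∀ τ ∈ D.support, ∃ π : AdaptivePolicy I, alg.Represents I t τ π ∧
      ∀ R, π.T R = T.sim I.f (h τ) R m := by
    intro τ hs
    obtain ⟨h1, h2, h3⟩ := hτ τ hs
    obtain ⟨π, h4, h5, h6⟩ := hT.exists_policy hmL fun i hi => ⟨(h2 i hi).1, (h2 i hi).2.1⟩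
    refine ⟨π, ⟨h4.trans h1.symm, fun R => ?_⟩, h6⟩
    obtain ⟨υ, h7, h8⟩ := h3 (R ∩ I.nbrs π.S)
    exact ⟨υ, h7, (h5 R).trans h8.symm⟩
  rw [hD]
  constructor
  · intro c hc
    obtain ⟨τ, hs, rfl⟩ := (PMF.mem_support_map_iff _ _ _).1 hc
    obtain ⟨π, h1, -⟩ := hrep τ hs
    exact ⟨rfl, π, h1⟩
  rw [PMF.toOuterMeasure_map_apply]
  obtain ⟨π, hopt⟩ := SeedingInstance.exists_optimal I
  -- it suffices to compare with the optimal policy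
  have hsuff : ∀ τ ∈ D.support, (∀ π' : AdaptivePolicy I, (∀ R, π'.T R = T.sim I.f (h τ) R m) →
      ((1 - 1 / Real.exp 1) ^ 2 - 11 * (1 / (a : ℝ))) * π.value ≤ π'.value) →
      τ ∈ (fun τ => (([], τ) : Config)) ⁻¹' {c | c.1 = [] ∧ ∃ π : AdaptivePolicy I,
        alg.Represents I t c.2 π ∧ ∀ π₁ : AdaptivePolicy I,
          ((1 - 1 / Real.exp 1) ^ 2 - ε) * π₁.value ≤ π.value} := by
    intro τ hs hv
    obtain ⟨π', h1, h2⟩ := hrep τ hs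
    refine ⟨rfl, π', h1, fun π₁ => ?_⟩
    have h3 := hv π' h2
    have h4 := SeedingInstance.value_nonneg π'
    have h5 := SeedingInstance.value_nonneg π₁
    rcases le_total 0 ((1 - 1 / Real.exp 1) ^ 2 - ε) with h6 | h6
    · refine (mul_le_mul_of_nonneg_left (hopt π₁) h6).trans (le_trans ?_ h3)
      exact mul_le_mul_of_nonneg_right (by linarith) (SeedingInstance.value_nonneg π)
    · exact (mul_nonpos_of_nonpos_of_nonneg h6 h5).trans h4
  rcases (SeedingInstance.value_nonneg π).eq_or_lt with h0 | h0
  · refine D.one_sub_le_toOuterMeasure (A := ∅) (fun τ hs _ => hsuff τ hs fun π' _ => ?_) (by simp)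
    rw [← h0, mul_zero]
    exact SeedingInstance.value_nonneg π'
  obtain ⟨J, q, c, hc⟩ := exists_comparator ha8 hl₀ hk₀ M hT π h0 rfl hcost
  have hx0 : (0 : ℝ) < 1 / a := by positivity
  have hx1 : 1 / (a : ℝ) ≤ 1 / 8 := one_div_le_one_div_of_le (by norm_num) ha0
  have hu : 1 / 2 ≤ 1 - 1 / Real.exp 1 := by
    have : 1 / Real.exp 1 ≤ 1 / 2 :=
      one_div_le_one_div_of_le (by norm_num) (by linarith [Real.add_one_le_exp (1 : ℝ)])
    linarith
  have hu1 : 1 - 1 / Real.exp 1 ≤ 1 := sub_le_self _ (by positivity)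
  have h4x : 4 / (a : ℝ) = 4 * (1 / a) := by ring
  rw [h4x] at hc
  have hMη : 16 * ((k₀ : ℝ) + 2) ≤ M * (1 / (a : ℝ)) ^ 2 := by
    have h1 : (c₀ : ℝ) ≤ M := by exact_mod_cast Nat.le_add_left _ _
    have h2 : (c₀ : ℝ) * (1 / (a : ℝ)) ^ 2 = 16 * ((k₀ : ℝ) + 2) := by
      rw [hc₀]
      push_cast
      field_simp
    rw [← h2]
    exact mul_le_mul_of_nonneg_right h1 (by positivity)
  have hmM : m ≤ M := (Nat.div_le_self kk L).trans (by omega)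
  refine D.one_sub_le_toOuterMeasure (fun τ hs hgood => hsuff τ hs fun π' hπ' => ?_)
    (hc.measure_failure_le hT hopt h0 hx0 (by linarith) hMη (by omega) (by omega) hmM hr (by omega)
      D S h hS fun τ hs i hi => ((hτ τ hs).2.1 i hi).1)
  rw [Set.mem_ofPred_eq, not_not] at hgood
  have h1 := hc.le_expect_sim (by linarith) (hτ τ hs).2.1 hgood.1 hgood.2
  have h2 := SeedingInstance.le_expect_prob (I := I) (M := M) (by omega) (by omega)
    (g := fun R => I.f (T.sim I.f (h τ) R m)) (fun R => I.f_nonneg _)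
    fun R y hy => T.sim_singleton_le I.isMonoSubmodular (h τ) hy m
  have h3 : π'.value = expect I.prob Finset.univ fun R => I.f (T.sim I.f (h τ) R m) := by
    rw [AdaptivePolicy.value, ← SeedingInstance.sum_realizationProb_mul]
    simp only [hπ']
  rw [h3]
  refine le_trans (factor_le hx0.le hx1 hu hu1 h0.le ?_ ?_ h1) h2
  · exact add_nonneg (expect_nonneg (I.commonProb_mem M) fun R _ => I.f_nonneg _)
      (Finset.sum_nonneg fun y _ => mul_nonneg (SeedingInstance.rareProb_nonneg y) (I.f_nonneg _))
  · refine one_div_le_one_div_of_le (by linarith) ?_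
    exact_mod_cast hac.trans (Nat.le_add_left _ _)
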